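/- **Setting.** Let $0<\sigma<R$ and let $\Phi$ be an even pair potential with hard core of length $\sigma$ and range $R$: $\Phi\in C^2((\sigma,\infty))$, $\Phi(q)\to+\infty$ as $q\downarrow\sigma$, $\Phi(q)=0$ for $|q|>R$ (and $\Phi=+\infty$ for $|q|\le\sigma$). Particles of unit mass on the line carry labels $-s_1,\dots,-1,1,\dots,s_2$ ($s_1,s_2\ge 0$) and have phase points $x_i=(q_i,p_i)\in\mathbb R\times\mathbb R$. Labels that are consecutive in this list are called neighbours; the neighbour to the right of $j$ is written $j+1$ and the one to the left $j-1$ (so the right neighbour of $-1$ is $1$). Only neighbours interact. A phase point is allowed if $\sigma+q_j<q_{j+1}$ for all pairs of neighbours, and forbidden otherwise; $\Omega_{s_1+s_2}$ denotes the open set of allowed phase points $(x_{-s_1},\dots,x_{s_2})$. For a block $X$ of consecutive labels let $X_i(t,\cdot)$, $i\in X$, be the global solution, with allowed values, of the Hamilton equations of the particles of $X$ alone, with Hamiltonian $\sum_{i\in X} p_i^2/2+\sum_{(j,j+1)}\Phi(q_j-q_{j+1})$, the last sum being over the pairs of neighbours in $X$. Let $(S^*_{|X|}(t,X)f)(x)$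 be the value of $f$ at the point obtained from $x$ by replacing $x_i$, $i\in X$, by $X_i(-t,(x_k)_{k\in X})$ if $(x_k)_{k\in X}$ is allowed, and $0$ otherwise; let $S_{|X|}(t,X)=S^*_{|X|}(-t,X)$. Put $$\mathcal L_{\rm int}(j,j+1)=-\frac{\partial\Phi(q_j-q_{j+1})}{\partial q_j}\Big(\frac{\partial}{\partial p_j}-\frac{\partial}{\partial p_{j+1}}\Big),\qquad \mathcal L_{s_1+s_2}=\sum_j p_j\frac{\partial}{\partial q_j}+\sum_{(j,j+1)}\mathcal L_{\rm int}(j,j+1),$$ $\mathcal L^*_{s_1+s_2}=-\mathcal L_{s_1+s_2}$ and $\mathcal L^*_{\rm int}=-\mathcal L_{\rm int}$. **Cauchy problem.** For double sequences $B(t)=\{B_{s_1+s_2}(t,x_{-s_1},\dots,x_{s_2})\}_{s_1,s_2\ge0}$ of functions that are zero at forbidden phase points, consider, with $B(0)=B^0$ given, $$\frac{\partial}{\partial t}B_{s_1+s_2}(t)=\mathcal L_{s_1+s_2}B_{s_1+s_2}(t)+\mathcal L_{\rm int}(-s_1,-s_1+1)B_{s_1-1+s_2}(t,x_{-s_1+1},\dots,x_{s_2})+\mathcal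 L_{\rm int}(s_2-1,s_2)B_{s_1+s_2-1}(t,x_{-s_1},\dots,x_{s_2-1}),$$ where $-s_1+1$ and $s_2-1$ stand for the right neighbour of the leftmost particle and the left neighbour of the rightmost one; the second term is absent if $s_1=0$, the third if $s_2=0$, and both if $s_1+s_2\le1$. * A *global classical solution* is a double sequence of functions that are $C^1$ in $(t,x)\in\mathbb R\times\Omega_{s_1+s_2}$, satisfy these equations at all $t\in\mathbb R$ and all allowed phase points, and satisfy $B(0)=B^0$. * For $0<\gamma<1$, $C_\gamma$ is the space of double sequences $b$ of functions that are bounded and continuous on $\Omega_{s_1+s_2}$ and zero at forbidden phase points, with finite norm $\|b\|_{C_\gamma}=\sup_{s_1,s_2}\gamma^{s_1+s_2}\sup_x|b_{s_1+s_2}(x)|$. * A *global generalized solution* in $C_\gamma$ is a map $t\mapsto B(t)\in C_\gamma$, $t\in\mathbb R$, bounded in norm on bounded time intervals, with $B(0)=B^0$, such that for all $s_1,s_2$, all $\varphi\in C_c^\infty(\Omega_{s_1+s_2})$ and all $t\in\mathbb R$ $$\frac{d}{dt}\int B_{s_1+s_2}(t)\varphi\,dx=\int\Big(B_{s_1+s_2}(t)\,\mathcal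 L^*_{s_1+s_2}\varphi+B_{s_1-1+s_2}(t)\,\mathcal L^*_{\rm int}(-s_1,-s_1+1)\varphi+B_{s_1+s_2-1}(t)\,\mathcal L^*_{\rm int}(s_2-1,s_2)\varphi\Big)dx,$$ with the same convention on absent terms. * $C_0$ is the space of finite double sequences (all but finitely many members vanish) of functions with compact support that are bounded and infinitely differentiable on $\Omega_{s_1+s_2}$ and zero at forbidden phase points. **Theorem.** Define on allowed phase points (and by zero on forbidden ones) $$B_{s_1+s_2}(t,x_{-s_1},\dots,x_{s_2})=\sum_{n_1=0}^{s_1}\sum_{n_2=0}^{s_2}\mathfrak A_{1+s_1-n_1+s_2-n_2}\big(t,-s_1,\dots,-(n_1+1),\{-n_1,\dots,n_2\},n_2+1,\dots,s_2\big)\,B^0_{n_1+n_2}(x_{-n_1},\dots,x_{n_2}),$$ where the generating operators are the cumulants $$\mathfrak A_{1+s_1-n_1+s_2-n_2}(t,\dots)=\sum_{\mathrm P}(-1)^{|\mathrm P|-1}\prod_{X_i\in\mathrm P}S_{|\theta(X_i)|}(t,\theta(X_i));$$ the sum is over all partitions $\mathrm P$ of the ordered set $(-s_1,\dots,-(n_1+1),\{-n_1,\dots,n_2\},n_2+1,\dots,s_2)$,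 in which the (possibly empty) cluster $\{-n_1,\dots,n_2\}$ counts as one element, into nonempty blocks of consecutive elements, and $\theta$ replaces the cluster by its particles. 1. For every $B^0\in C_0$ this double sequence is a global classical solution of the Cauchy problem, and it is the only one. 2. For every $0<\gamma<1$ and every $B^0\in C_\gamma$ it is a global generalized solution in $C_\gamma$ of the Cauchy problem, and it is the only one. -/

import Mathlib

noncomputable section

namespace TopologicalParticles

/-!  Labels.  The particles carry the labels `…, -2, -1, 1, 2, …` (nonzero integers, in the order of
their positions on the line).  To make neighbouring labels consecutive, the positive label `j` is
written here as the integer `j - 1`, negative labels are unchanged.  So the particles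
`-s₁, …, -1, 1, …, s₂` are the integers of `[-s₁, s₂)`, and particles `i`, `i + 1` are neighbours. -/

/-- Phase points `x_i = (q_i, p_i)` of the particles with labels in `[a, b)`. -/
abbrev Phase (a b : ℤ) : Type := ↥(Finset.Ico a b) → ℝ × ℝ

/-- Double sequences of functions `b_{s₁+s₂}(x_{-s₁}, …, x_{-1}, x_1, …, x_{s₂})`. -/
abbrev DoubleSeq : Type := ∀ s₁ s₂ : ℕ, Phase (-(s₁ : ℤ)) (s₂ : ℤ) → ℝ

/-- The pair potential: even, of range `R`, with a hard core of length `σ` at which it becomes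
infinite, twice continuously differentiable outside of the core.  (Its values on `[-σ, σ]` are
never used: there the potential is `+∞`.) -/
structure IsPairPotential (Φ : ℝ → ℝ) (σ R : ℝ) : Prop where
  core_pos : 0 < σ
  core_lt_range : σ < R
  even : ∀ q, Φ (-q) = Φ q
  short_range : ∀ q, R < |q| → Φ q = 0
  smooth : ContDiffOn ℝ 2 Φ (Set.Ioi σ)
  hard_core : Filter.Tendsto Φ (nhdsWithin σ (Set.Ioi σ)) Filter.atTop

/-- Phase points with an allowed configuration (the complement of the forbidden set): neighbours
are ordered and at a distance greater than `σ`. -/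
def Allowed (σ : ℝ) (a b : ℤ) : Set (Phase a b) :=
  {x | ∀ i j : ↥(Finset.Ico a b), (j : ℤ) = (i : ℤ) + 1 → σ + (x i).1 < (x j).1}

/-- The phase points of the particles `[c, d)` among those of the particles `[a, b)`; only used for
`[c, d) ⊆ [a, b)`, so that the default value does not occur. -/
def restrict {a b : ℤ} (c d : ℤ) (x : Phase a b) : Phase c d :=
  fun i => if h : (i : ℤ) ∈ Finset.Ico a b then x ⟨i, h⟩ else 0

/-- A function of the particles `[c, d)`, considered as a function of the particles `[a, b)`. -/
def lift {c d : ℤ} (a b : ℤ) (f : Phase c d → ℝ) : Phase a b → ℝ :=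
  fun x => f (restrict c d x)

section Dynamics

variable (Φ : ℝ → ℝ) (σ : ℝ)

/-- The force `-∂H/∂q_i`, where `H = ∑ p_i² / 2 + ∑ Φ(q_i - q_{i+1})`, the last sum over the pairs
of neighbours in `[a, b)`. -/
def force {a b : ℤ} (x : Phase a b) (i : ↥(Finset.Ico a b)) : ℝ :=
  (if h : (i : ℤ) + 1 ∈ Finset.Ico a b then - deriv Φ ((x i).1 - (x ⟨(i : ℤ) + 1, h⟩).1) else 0) +
  (if h : (i : ℤ) - 1 ∈ Finset.Ico a b then deriv Φ ((x ⟨(i : ℤ) - 1, h⟩).1 - (x i).1) else 0)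

/-- Global solutions of the Hamilton equations of the particles `[a, b)`. -/
structure IsTrajectory (a b : ℤ) (X : ℝ → Phase a b) : Prop where
  allowed : ∀ t, X t ∈ Allowed σ a b
  position : ∀ t i, HasDerivAt (fun τ => (X τ i).1) (X t i).2 t
  momentum : ∀ t i, HasDerivAt (fun τ => (X τ i).2) (force Φ (X t) i) t

open Classical in
/-- `X(t, x)`: the global solution of the Hamilton equations with `X(0, x) = x`. -/
def flow (a b : ℤ) (t : ℝ) (x : Phase a b) : Phase a b :=
  if h : ∃ X : ℝ → Phase a b, IsTrajectory Φ σ a b X ∧ X 0 = x then h.choose t else x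

/-- The particles of the block `[c, d)` move according to their own dynamics during the time `t`,
the other particles of `[a, b)` stay where they are. -/
def evolve (a b c d : ℤ) (t : ℝ) (x : Phase a b) : Phase a b :=
  fun i => if h : (i : ℤ) ∈ Finset.Ico c d then flow Φ σ c d t (restrict c d x) ⟨i, h⟩ else x i

open Classical in
/-- The operators `S^*(t, c, …, d - 1)` of the block `[c, d)`, acting on functions of the particles
`[a, b)`: `f ↦ f(X(-t, ·))` on allowed configurations of the block, and zero on forbidden ones. -/
def groupStar (a b c d : ℤ) (t : ℝ) : Module.End ℝ (Phase a b → ℝ) where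
  toFun f := fun x =>
    if restrict c d x ∈ Allowed σ c d then f (evolve Φ σ a b c d (-t) x) else 0
  map_add' f g := by
    funext x
    by_cases h : restrict c d x ∈ Allowed σ c d <;> simp [h]
  map_smul' r f := by
    funext x
    by_cases h : restrict c d x ∈ Allowed σ c d <;> simp [h]

/-- The adjoint groups `S(t) = S^*(-t)`. -/
def group (a b c d : ℤ) (t : ℝ) : Module.End ℝ (Phase a b → ℝ) :=
  groupStar Φ σ a b c d (-t)

/-- The ordered set `(-s₁, …, -(n₁+1), {-n₁, …, n₂}, n₂+1, …, s₂)` has `1 + (s₁-n₁) + (s₂-n₂)`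
elements, the cluster in braces being one of them.  The first `m` elements are, after
declusterization, the particles `[-s₁, cut s₁ n₁ n₂ m)`. -/
def cut (s₁ n₁ n₂ m : ℕ) : ℤ :=
  if m ≤ s₁ - n₁ then -(s₁ : ℤ) + m else -(s₁ : ℤ) + m + ((n₁ : ℤ) + n₂ - 1)

/-- The cumulant of order `1 + (s₁-n₁) + (s₂-n₂)` of the groups `S(t)`,
`𝔄(t, -s₁, …, -(n₁+1), {-n₁, …, n₂}, n₂+1, …, s₂) = ∑_P (-1)^{|P|-1} ∏_{X ∈ P} S(t, θ(X))`.
The sum is over the ordered partitions `P` of the ordered set into nonempty blocks of consecutive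
elements, that is, over the compositions of the number of its elements. -/
def cumulant (s₁ s₂ n₁ n₂ : ℕ) (t : ℝ) :
    Module.End ℝ (Phase (-(s₁ : ℤ)) (s₂ : ℤ) → ℝ) :=
  ∑ P : Composition (1 + (s₁ - n₁) + (s₂ - n₂)),
    (-1 : ℝ) ^ (P.length - 1) •
      (List.ofFn fun k : Fin P.length =>
        group Φ σ (-(s₁ : ℤ)) (s₂ : ℤ)
          (cut s₁ n₁ n₂ (P.sizeUpTo k)) (cut s₁ n₁ n₂ (P.sizeUpTo (k + 1))) t).prod

/-- The expansions
`B_{s₁+s₂}(t) = ∑_{n₁ ≤ s₁} ∑_{n₂ ≤ s₂} 𝔄(t, -s₁, …, {-n₁, …, n₂}, …, s₂) B⁰_{n₁+n₂}`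
on allowed configurations, zero on forbidden ones. -/
def expansion (B₀ : DoubleSeq) (t : ℝ) : DoubleSeq := fun s₁ s₂ =>
  Set.indicator (Allowed σ (-(s₁ : ℤ)) (s₂ : ℤ)) fun x =>
    ∑ n₁ ∈ Finset.range (s₁ + 1), ∑ n₂ ∈ Finset.range (s₂ + 1),
      cumulant Φ σ s₁ s₂ n₁ n₂ t (lift (-(s₁ : ℤ)) (s₂ : ℤ) (B₀ n₁ n₂)) x

end Dynamics

section Generators

variable (Φ : ℝ → ℝ)

/-- `∂f/∂q_i`. -/
def dq {a b : ℤ} (i : ↥(Finset.Ico a b)) (f : Phase a b → ℝ) (x : Phase a b) : ℝ :=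
  fderiv ℝ f x (Pi.single i ((1 : ℝ), (0 : ℝ)))

/-- `∂f/∂p_i`. -/
def dp {a b : ℤ} (i : ↥(Finset.Ico a b)) (f : Phase a b → ℝ) (x : Phase a b) : ℝ :=
  fderiv ℝ f x (Pi.single i ((0 : ℝ), (1 : ℝ)))

/-- `(L^*_int(j, j+1) f)(x) = ∂Φ(q_j - q_{j+1})/∂q_j (∂/∂p_j - ∂/∂p_{j+1}) f(x)`;
zero unless both `j` and `j + 1` are labels of particles. -/
def liouvilleStarInt (a b j : ℤ) (f : Phase a b → ℝ) (x : Phase a b) : ℝ :=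
  if h : j ∈ Finset.Ico a b ∧ j + 1 ∈ Finset.Ico a b then
    deriv Φ ((x ⟨j, h.1⟩).1 - (x ⟨j + 1, h.2⟩).1) * (dp ⟨j, h.1⟩ f x - dp ⟨j + 1, h.2⟩ f x)
  else 0

/-- The Liouville operator `L^* = ∑_j (-p_j ∂/∂q_j) + ∑_{(j,j+1)} L^*_int(j, j+1)`. -/
def liouvilleStar (a b : ℤ) (f : Phase a b → ℝ) (x : Phase a b) : ℝ :=
  (∑ i : ↥(Finset.Ico a b), -((x i).2 * dq i f x)) +
    ∑ j ∈ Finset.Ico a b, liouvilleStarInt Φ a b j f x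

/-- `L_int(j, j+1) = -L^*_int(j, j+1)`. -/
def liouvilleInt (a b j : ℤ) (f : Phase a b → ℝ) (x : Phase a b) : ℝ :=
  -liouvilleStarInt Φ a b j f x

/-- `L = -L^*`. -/
def liouville (a b : ℤ) (f : Phase a b → ℝ) (x : Phase a b) : ℝ :=
  -liouvilleStar Φ a b f x

end Generators

/-- The creation operator `(𝔞⁺₋ b)_{s₁+s₂}(x_{-s₁}, …, x_{s₂}) = b_{s₁-1+s₂}(x_{-s₁+1}, …, x_{s₂})`,
zero for `s₁ = 0`. -/
def createLeft (b : DoubleSeq) : DoubleSeq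
  | 0, _ => fun _ => 0
  | n₁ + 1, s₂ => lift (-((n₁ + 1 : ℕ) : ℤ)) (s₂ : ℤ) (b n₁ s₂)

/-- The creation operator `(𝔞⁺₊ b)_{s₁+s₂}(x_{-s₁}, …, x_{s₂}) = b_{s₁+s₂-1}(x_{-s₁}, …, x_{s₂-1})`,
zero for `s₂ = 0`. -/
def createRight (b : DoubleSeq) : DoubleSeq
  | _, 0 => fun _ => 0
  | s₁, n₂ + 1 => lift (-(s₁ : ℤ)) ((n₂ + 1 : ℕ) : ℤ) (b s₁ n₂)

/-- The space of functions of `s₁ + s₂` particles that are bounded and continuous on the allowed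
phase points and zero on the forbidden ones. -/
def MemC (σ : ℝ) (s₁ s₂ : ℕ) (f : Phase (-(s₁ : ℤ)) (s₂ : ℤ) → ℝ) : Prop :=
  ContinuousOn f (Allowed σ (-(s₁ : ℤ)) (s₂ : ℤ)) ∧
  (∀ x, x ∉ Allowed σ (-(s₁ : ℤ)) (s₂ : ℤ) → f x = 0) ∧
  ∃ M, ∀ x, |f x| ≤ M

/-- `‖b‖ ≤ M` for the norm `‖b‖ = sup γ^{s₁+s₂} sup_x |b_{s₁+s₂}(x)|`. -/
def NormLE (γ : ℝ) (b : DoubleSeq) (M : ℝ) : Prop :=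
  ∀ s₁ s₂ x, γ ^ (s₁ + s₂) * |b s₁ s₂ x| ≤ M

/-- The space `C_γ` of double sequences of functions of the spaces above, with finite norm. -/
def MemCGamma (σ γ : ℝ) (b : DoubleSeq) : Prop :=
  (∀ s₁ s₂, MemC σ s₁ s₂ (b s₁ s₂)) ∧ ∃ M, NormLE γ b M

/-- The space `C_0` of finite sequences of infinitely differentiable functions with compact
supports.  The functions are smooth on the allowed phase points; their supports are compact in
`ℝ^{2(s₁+s₂)}` and may touch the set of forbidden configurations. -/
def MemCZero (σ : ℝ) (b : DoubleSeq) : Prop :=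
  (∀ s₁ s₂, MemC σ s₁ s₂ (b s₁ s₂) ∧ HasCompactSupport (b s₁ s₂) ∧
    ContDiffOn ℝ ((⊤ : ℕ∞) : WithTop ℕ∞) (b s₁ s₂) (Allowed σ (-(s₁ : ℤ)) (s₂ : ℤ))) ∧
  ∃ N : ℕ, ∀ s₁ s₂, N < s₁ + s₂ → b s₁ s₂ = 0

/-- Global classical solutions of the Cauchy problem
`∂B_{s₁+s₂}(t)/∂t = L B_{s₁+s₂}(t) + L_int(-s₁, -s₁+1) B_{s₁-1+s₂}(t) + L_int(s₂-1, s₂) B_{s₁+s₂-1}(t)`,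
`B(0) = B₀`: continuously differentiable in time and phase variables jointly, and satisfying
the equations at every time and every allowed phase point. -/
structure IsClassicalSolution (Φ : ℝ → ℝ) (σ : ℝ) (B₀ : DoubleSeq) (B : ℝ → DoubleSeq) :
    Prop where
  zero_forbidden : ∀ (t : ℝ) (s₁ s₂ : ℕ) (x : Phase (-(s₁ : ℤ)) (s₂ : ℤ)),
    x ∉ Allowed σ (-(s₁ : ℤ)) (s₂ : ℤ) → B t s₁ s₂ x = 0
  smooth : ∀ s₁ s₂ : ℕ,
    ContDiffOn ℝ 1 (fun z : ℝ × Phase (-(s₁ : ℤ)) (s₂ : ℤ) => B z.1 s₁ s₂ z.2)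
      (Set.univ ×ˢ Allowed σ (-(s₁ : ℤ)) (s₂ : ℤ))
  equation : ∀ (t : ℝ) (s₁ s₂ : ℕ), ∀ x ∈ Allowed σ (-(s₁ : ℤ)) (s₂ : ℤ),
    HasDerivAt (fun τ => B τ s₁ s₂ x)
      (liouville Φ (-(s₁ : ℤ)) s₂ (B t s₁ s₂) x
        + liouvilleInt Φ (-(s₁ : ℤ)) s₂ (-(s₁ : ℤ)) (createLeft (B t) s₁ s₂) x
        + liouvilleInt Φ (-(s₁ : ℤ)) s₂ ((s₂ : ℤ) - 2) (createRight (B t) s₁ s₂) x) t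
  initial : B 0 = B₀

/-- Test functions: smooth, with a compact support in the set of allowed phase points. -/
def IsTest (σ : ℝ) (a b : ℤ) (φ : Phase a b → ℝ) : Prop :=
  ContDiff ℝ ((⊤ : ℕ∞) : WithTop ℕ∞) φ ∧ HasCompactSupport φ ∧ tsupport φ ⊆ Allowed σ a b

/-- Global generalized solutions in `C_γ` of the same Cauchy problem: `B` is locally bounded in time
in the norm of `C_γ`, and the equations hold when paired with test functions, the Liouville
operators being transferred to the test functions. -/
structure IsGeneralizedSolution (Φ : ℝ → ℝ) (σ γ : ℝ) (B₀ : DoubleSeq) (B : ℝ → DoubleSeq) :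
    Prop where
  mem : ∀ t, MemCGamma σ γ (B t)
  locally_bounded : ∀ T : ℝ, ∃ M, ∀ t, |t| ≤ T → NormLE γ (B t) M
  equation : ∀ (s₁ s₂ : ℕ) (φ : Phase (-(s₁ : ℤ)) (s₂ : ℤ) → ℝ),
    IsTest σ (-(s₁ : ℤ)) (s₂ : ℤ) φ → ∀ t : ℝ,
      HasDerivAt (fun τ => ∫ x, B τ s₁ s₂ x * φ x)
        (∫ x, (B t s₁ s₂ x * liouvilleStar Φ (-(s₁ : ℤ)) s₂ φ x
          + createLeft (B t) s₁ s₂ x * liouvilleStarInt Φ (-(s₁ : ℤ)) s₂ (-(s₁ : ℤ)) φ x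
          + createRight (B t) s₁ s₂ x
              * liouvilleStarInt Φ (-(s₁ : ℤ)) s₂ ((s₂ : ℤ) - 2) φ x)) t
  initial : B 0 = B₀

end TopologicalParticles

end

noncomputable section

namespace TopologicalParticles

open Set Filter Topology Metric
open scoped NNReal

/-! ### Global solutions of Lipschitz differential equations, Gronwall estimates -/

section GlobalLipschitzODE

variable {E : Type*} [NormedAddCommGroup E] [NormedSpace ℝ E]

/-! The proof rests on two facts about the double difference `(1 - 𝔞⁺₋)(1 - 𝔞⁺₊)` (`doubleDiff`).

The first is that it sums up the cumulant expansion. A function of the cluster feels only the group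
of the block containing the cluster, since the other groups move other particles. Once this block is
fixed, the decompositions of the elements left over on one side contribute an alternating count,
equal to 1, -1 or 0 according to whether no, one or more elements are left over (`altCount`). So at
allowed points a cumulant has at most four terms: the cluster is carried along by the dynamics of
all particles, or of all but the leftmost, all but the rightmost, or all but both
(`signedSum_left_of_cluster`, `cumulant_lift_apply`). Summation over `n₁`, `n₂` gives `B(t) = (1 -
𝔞⁺₋)(1 - 𝔞⁺₊) V(t)`, where `V(t)` is the sequence of the partial sums of `B⁰` composed with the full
Hamiltonian flow (`expansion_eq`).

The second is that it conjugates the generator of the hierarchy to the diagonal operator with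
entries `L` (`hierarchy_doubleDiff`). On a function that ignores the leftmost particle, `L` is the
Liouville operator of the remaining particles plus the interaction of the two leftmost ones, and
this interaction annihilates functions that ignore both; the same holds on the right. So `B` solves
the hierarchy as soon as each `V` solves its Liouville equation, which is the chain rule along the
flow.

The flow has to be global and of class `C¹`. Energy conservation and the divergence of `Φ` at the
core keep a trajectory at a positive distance from the core (`exists_gap`). Near an allowed point
the dynamics is therefore that of a compactly supported `C²` potential (`exists_local_flow`), whose
vector field is `C¹` and globally Lipschitz, and `exists_contDiff_flow` applies.

For uniqueness, the hierarchy is triangular in the number of particles: by induction the difference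
of two solutions solves the homogeneous Liouville equation. A classical solution is constant along
trajectories (`eq_zero_of_liouville`). A weak solution has a constant pairing with a test function
transported by the flow (`hasDerivAt_pairing`); transported test functions are only known to be
`C¹`, so the weak equation is first extended to such functions by mollification.

Existence in `C_γ` follows by approximating continuous data, locally uniformly on allowed points, by
`C¹` data. The classical equation is integrated by parts and passes to the limit
(`weak_equation_of_tendsto`), and geometric series bound the norm uniformly in time
(`NormLE.expansion`). -/

lemma exists_uniform_local_solution [CompleteSpace E] {v : ℝ → E → E} {K : ℝ≥0}
    (hv : ∀ t, LipschitzWith K (v t)) (hc : ∀ x, Continuous fun t => v t x) :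
    ∃ ε > (0 : ℝ), ∀ (t₀ : ℝ) (x : E), ∃ α : ℝ → E, α t₀ = x ∧
      ∀ t ∈ Ioo (t₀ - ε) (t₀ + ε), HasDerivAt α (v t (α t)) t := by
  have hK : (0 : ℝ) < 2 * (K + 1) := by positivity
  -- If `m` bounds the field at `x` on the time interval, the field is at most `K m + m` on the ball
  -- of radius `m` about `x`, and `(K m + m) ε = m / 2`. So `ε` depends neither on `t₀` nor on `x`.
  refine ⟨1 / (2 * (K + 1)), by positivity, fun t₀ x => ?_⟩
  set ε : ℝ := 1 / (2 * (K + 1)) with hε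
  have hε0 : 0 < ε := by positivity
  obtain ⟨m, hm⟩ := (isCompact_Icc (a := t₀ - ε) (b := t₀ + ε)).exists_bound_of_continuousOn
    (hc x).continuousOn
  have hm0 : 0 ≤ m := (norm_nonneg _).trans (hm t₀ ⟨by linarith, by linarith⟩)
  have hPL : IsPicardLindelof v (tmin := t₀ - ε) (tmax := t₀ + ε) ⟨t₀, by simp [hε0.le]⟩ x
      ⟨m, hm0⟩ 0 (K * ⟨m, hm0⟩ + ⟨m, hm0⟩) K := by
    refine ⟨fun t _ => (hv t).lipschitzOnWith, fun y _ => (hc y).continuousOn, ?_, ?_⟩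
    · intro t ht y hy
      have h1 := (hv t).dist_le_mul y x
      have h2 : dist y x ≤ m := hy
      have h3 := hm t ht
      rw [dist_eq_norm] at h1
      have h4 : ‖v t y‖ ≤ ‖v t y - v t x‖ + ‖v t x‖ := norm_le_norm_sub_add _ _
      have h5 : (K : ℝ) * dist y x ≤ K * m := by gcongr
      show ‖v t y‖ ≤ K * m + m
      linarith
    · have : ((K : ℝ) * m + m) * ε = m / 2 := by
        rw [hε]; field_simp
      simp only [add_sub_cancel_left, sub_sub_cancel, max_self, NNReal.coe_zero, sub_zero]
      show ((K : ℝ) * m + m) * ε ≤ m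
      linarith
  obtain ⟨α, h0, hα⟩ := hPL.exists_eq_forall_mem_Icc_hasDerivWithinAt₀
  exact ⟨α, h0, fun t ht => (hα t (Ioo_subset_Icc_self ht)).hasDerivAt (Icc_mem_nhds ht.1 ht.2)⟩

lemma eqOn_of_solutions {v : ℝ → E → E} {K : ℝ≥0}
    (hv : ∀ t, LipschitzWith K (v t)) {a b t₀ : ℝ} (ht₀ : t₀ ∈ Ioo a b) {f g : ℝ → E}
    (hf : ∀ t ∈ Ioo a b, HasDerivAt f (v t (f t)) t)
    (hg : ∀ t ∈ Ioo a b, HasDerivAt g (v t (g t)) t) (h : f t₀ = g t₀) :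
    EqOn f g (Ioo a b) :=
  ODE_solution_unique_of_mem_Ioo (s := fun _ => univ) (fun t _ => (hv t).lipschitzOnWith) ht₀
    (fun t ht => ⟨hf t ht, trivial⟩) (fun t ht => ⟨hg t ht, trivial⟩) h

/-- Local solutions are glued on at both ends; the gain `ε / 2` does not depend on the interval, so
finitely many extensions reach any time. -/
lemma extend_solution {v : ℝ → E → E} {K : ℝ≥0} (hv : ∀ t, LipschitzWith K (v t)) {ε : ℝ}
    (hloc : ∀ (t₀ : ℝ) (x : E), ∃ α : ℝ → E, α t₀ = x ∧
      ∀ t ∈ Ioo (t₀ - ε) (t₀ + ε), HasDerivAt α (v t (α t)) t)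
    {a b : ℝ} (hab : a < b) (hε : 0 < ε) {α : ℝ → E}
    (hα : ∀ t ∈ Ioo a b, HasDerivAt α (v t (α t)) t) :
    ∃ β : ℝ → E, (∀ t ∈ Ioo a b, β t = α t) ∧
      ∀ t ∈ Ioo (a - ε / 2) (b + ε / 2), HasDerivAt β (v t (β t)) t := by
  -- The bound `ε / 2` lets the local solutions started at `a + η` and `b - η` reach `ε / 2` beyond
  -- the ends; the bound `(b - a) / 2` keeps their starting points inside.
  set η : ℝ := min (ε / 2) ((b - a) / 2) with hη
  have hη0 : 0 < η := lt_min (by linarith) (by linarith)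
  have hη1 : η ≤ ε / 2 := min_le_left _ _
  have hη2 : η ≤ (b - a) / 2 := min_le_right _ _
  obtain ⟨β₁, h1, hβ₁⟩ := hloc (a + η) (α (a + η))
  obtain ⟨β₂, h2, hβ₂⟩ := hloc (b - η) (α (b - η))
  have e1 : EqOn β₁ α (Ioo a (min b (a + η + ε))) :=
    eqOn_of_solutions hv (t₀ := a + η) ⟨by linarith, lt_min (by linarith) (by linarith)⟩
      (fun t ht => hβ₁ t ⟨by linarith [ht.1], ht.2.trans_le (min_le_right _ _)⟩)
      (fun t ht => hα t ⟨ht.1, ht.2.trans_le (min_le_left _ _)⟩) h1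
  have e2 : EqOn β₂ α (Ioo (max a (b - η - ε)) b) :=
    eqOn_of_solutions hv (t₀ := b - η) ⟨max_lt (by linarith) (by linarith), by linarith⟩
      (fun t ht => hβ₂ t ⟨(le_max_right _ _).trans_lt ht.1, by linarith [ht.2]⟩)
      (fun t ht => hα t ⟨(le_max_left _ _).trans_lt ht.1, ht.2⟩) h2
  let β : ℝ → E := fun t => if t ≤ a then β₁ t else if t < b then α t else β₂ t
  have hβα : ∀ t ∈ Ioo a b, β t = α t := fun t ht => by
    simp [β, not_le.2 ht.1, ht.2]
  have hββ₁ : ∀ t ∈ Ioo (a - ε / 2) (min b (a + η + ε)), β t = β₁ t := fun t ht => by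
    by_cases h : t ≤ a
    · simp [β, h]
    · rw [hβα t ⟨not_le.1 h, ht.2.trans_le (min_le_left _ _)⟩, e1 ⟨not_le.1 h, ht.2⟩]
  have hββ₂ : ∀ t ∈ Ioo (max a (b - η - ε)) (b + ε / 2), β t = β₂ t := fun t ht => by
    have hat : a < t := (le_max_left _ _).trans_lt ht.1
    by_cases h : t < b
    · rw [hβα t ⟨hat, h⟩, e2 ⟨ht.1, h⟩]
    · simp [β, h, not_le.2 hat]
  refine ⟨β, hβα, fun t ht => ?_⟩
  have key : ∀ {γ : ℝ → E} {c d : ℝ}, t ∈ Ioo c d → (∀ s ∈ Ioo c d, β s = γ s) →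
      HasDerivAt γ (v t (γ t)) t → HasDerivAt β (v t (β t)) t := by
    intro γ c d hcd he hd
    rw [he t hcd]
    exact hd.congr_of_eventuallyEq (eventually_of_mem (Ioo_mem_nhds hcd.1 hcd.2) he)
  rcases le_or_gt t a with h | h
  · have hm : t ∈ Ioo (a - ε / 2) (min b (a + η + ε)) :=
      ⟨ht.1, lt_min (by linarith) (by linarith)⟩
    exact key hm hββ₁ (hβ₁ t ⟨by linarith [ht.1], by linarith⟩)
  · rcases lt_or_ge t b with h' | h'
    · exact key ⟨h, h'⟩ hβα (hα t ⟨h, h'⟩)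
    · have hm : t ∈ Ioo (max a (b - η - ε)) (b + ε / 2) :=
        ⟨max_lt h (by linarith), ht.2⟩
      exact key hm hββ₂ (hβ₂ t ⟨by linarith, by linarith [ht.2]⟩)

/-- Global solutions of an ordinary differential equation with a globally Lipschitz right hand
side. -/
theorem exists_global_solution [CompleteSpace E] {v : ℝ → E → E} {K : ℝ≥0}
    (hv : ∀ t, LipschitzWith K (v t)) (hc : ∀ x, Continuous fun t => v t x) (x : E) :
    ∃ α : ℝ → E, α 0 = x ∧ ∀ t, HasDerivAt α (v t (α t)) t := by
  obtain ⟨ε, hε, hloc⟩ := exists_uniform_local_solution hv hc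
  have hn : ∀ n : ℕ, ∃ α : ℝ → E, α 0 = x ∧
      ∀ t ∈ Ioo (-((n + 1) * (ε / 2))) ((n + 1) * (ε / 2)), HasDerivAt α (v t (α t)) t := by
    intro n
    induction n with
    | zero =>
      obtain ⟨α, h0, hα⟩ := hloc 0 x
      refine ⟨α, h0, fun t ht => hα t ?_⟩
      simp only [Nat.cast_zero, zero_add, one_mul] at ht
      exact ⟨by linarith [ht.1], by linarith [ht.2]⟩
    | succ n ih =>
      obtain ⟨α, h0, hα⟩ := ih
      have hp : 0 < ((n : ℝ) + 1) * (ε / 2) := by positivity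
      obtain ⟨β, hβ, hβ'⟩ := extend_solution hv hloc (by linarith) hε hα
      refine ⟨β, by rw [hβ 0 ⟨by linarith, hp⟩, h0], fun t ht => hβ' t ?_⟩
      push_cast at ht
      exact ⟨by linarith [ht.1], by linarith [ht.2]⟩
  choose α h0 hα using hn
  have hgt : ∀ t : ℝ, ∃ n : ℕ, |t| < (n + 1) * (ε / 2) := fun t => by
    obtain ⟨n, hn⟩ := exists_nat_gt (|t| / (ε / 2))
    refine ⟨n, ?_⟩
    rw [div_lt_iff₀ (by positivity)] at hn
    linarith
  choose N hN using hgt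
  -- By uniqueness the solutions on the growing intervals agree on the common part, so the choice of
  -- an index for each time does not matter.
  have heq : ∀ (m n : ℕ) (t : ℝ), |t| < (m + 1) * (ε / 2) → |t| < (n + 1) * (ε / 2) →
      α m t = α n t := by
    intro m n t h1 h2
    set c := min (((m : ℝ) + 1) * (ε / 2)) ((n + 1) * (ε / 2)) with hcdef
    have htc : |t| < c := lt_min h1 h2
    have hc0 : 0 < c := (abs_nonneg t).trans_lt htc
    have hc1 : c ≤ ((m : ℝ) + 1) * (ε / 2) := min_le_left _ _
    have hc2 : c ≤ ((n : ℝ) + 1) * (ε / 2) := min_le_right _ _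
    refine eqOn_of_solutions hv (a := -c) (b := c) (t₀ := 0) ⟨by linarith, hc0⟩
      (fun s hs => hα m s ⟨by linarith [hs.1], by linarith [hs.2]⟩)
      (fun s hs => hα n s ⟨by linarith [hs.1], by linarith [hs.2]⟩) (by rw [h0, h0]) ?_
    exact abs_lt.1 htc
  refine ⟨fun t => α (N t) t, h0 _, fun t => ?_⟩
  have hd := hα (N t) t (abs_lt.1 (hN t))
  refine hd.congr_of_eventuallyEq ?_
  have : ∀ᶠ s in 𝓝 t, |s| < (N t + 1) * (ε / 2) :=
    continuous_abs.continuousAt.eventually_lt continuousAt_const (hN t)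
  filter_upwards [this] with s hs using heq _ _ _ (hN s) hs

lemma norm_le_of_norm_deriv_le {g g' : ℝ → E} {K c T : ℝ}
    (hg : ∀ t, HasDerivAt g (g' t) t)
    (hb : ∀ t, |t| ≤ T → ‖g' t‖ ≤ K * ‖g t‖ + c) {t : ℝ} (ht : |t| ≤ T) :
    ‖g t‖ ≤ gronwallBound ‖g 0‖ K c |t| := by
  rcases le_total 0 t with h | h
  · have := norm_le_gronwallBound_of_norm_deriv_right_le (f := g) (f' := g') (a := 0) (b := t)
      (fun s _ => (hg s).continuousAt.continuousWithinAt) (fun s _ => (hg s).hasDerivWithinAt)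
      le_rfl (fun s hs => hb s (by
        rw [abs_of_nonneg hs.1]; rw [abs_of_nonneg h] at ht; linarith [hs.2])) t ⟨h, le_rfl⟩
    simpa [abs_of_nonneg h] using this
  · have hg2 : ∀ s, HasDerivAt (fun s => g (-s)) (-(g' (-s))) s := fun s => by
      simpa [Function.comp_def] using (hg (-s)).scomp s (hasDerivAt_neg s)
    have := norm_le_gronwallBound_of_norm_deriv_right_le (f := fun s => g (-s))
      (f' := fun s => -(g' (-s))) (a := 0) (b := -t) (δ := ‖g 0‖) (K := K) (ε := c)
      (fun s _ => (hg2 s).continuousAt.continuousWithinAt) (fun s _ => (hg2 s).hasDerivWithinAt)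
      (by simp) (fun s hs => by
        rw [norm_neg]
        exact hb (-s) (by
          rw [abs_neg, abs_of_nonneg hs.1]; rw [abs_of_nonpos h] at ht; linarith [hs.2]))
      (-t) ⟨by linarith, le_rfl⟩
    simpa [abs_of_nonpos h] using this

/-- Gronwall's bound with zero initial value, made linear in the forcing `c` with a factor depending
on `K` and `T` only: a small forcing has a proportionally small effect. -/
lemma norm_le_mul_of_norm_deriv_le {g g' : ℝ → E} {K c T : ℝ} (hK : 0 < K) (hc : 0 ≤ c)
    (hg : ∀ t, HasDerivAt g (g' t) t) (h0 : g 0 = 0)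
    (hb : ∀ t, |t| ≤ T → ‖g' t‖ ≤ K * ‖g t‖ + c) {t : ℝ} (ht : |t| ≤ T) :
    ‖g t‖ ≤ c * (Real.exp (K * T) / K) := by
  have h := norm_le_of_norm_deriv_le hg hb ht
  rw [h0, norm_zero, gronwallBound_of_K_ne_0 hK.ne'] at h
  have h1 : Real.exp (K * |t|) ≤ Real.exp (K * T) := by gcongr
  calc ‖g t‖ ≤ 0 * Real.exp (K * |t|) + c / K * (Real.exp (K * |t|) - 1) := h
    _ = c / K * (Real.exp (K * |t|) - 1) := by ring
    _ ≤ c / K * Real.exp (K * T) := by gcongr; linarith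
    _ = c * (Real.exp (K * T) / K) := by ring

end GlobalLipschitzODE

/-! ### Smooth dependence on the initial value -/

section SmoothFlow

variable {E : Type*} [NormedAddCommGroup E] [NormedSpace ℝ E] [CompleteSpace E]

/-- A globally Lipschitz, continuously differentiable vector field has a global flow, which is
continuously differentiable in time and initial value jointly. -/
theorem exists_contDiff_flow {f : E → E} {K : ℝ≥0} (hf : ContDiff ℝ 1 f)
    (hK : LipschitzWith K f) :
    ∃ φ : ℝ → E → E, (∀ x, φ 0 x = x) ∧ (∀ x t, HasDerivAt (fun s => φ s x) (f (φ t x)) t) ∧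
      ContDiff ℝ 1 fun z : ℝ × E => φ z.1 z.2 := by
  have hex : ∀ x, ∃ α : ℝ → E, α 0 = x ∧ ∀ t, HasDerivAt α (f (α t)) t := fun x =>
    exists_global_solution (v := fun _ => f) (fun _ => hK) (fun _ => continuous_const) x
  choose X hX0 hX using hex
  have hXc : ∀ x, Continuous (X x) := fun x =>
    continuous_iff_continuousAt.2 fun t => (hX x t).continuousAt
  have hdf : Differentiable ℝ f := hf.differentiable one_ne_zero
  have hcf : Continuous (fderiv ℝ f) := hf.continuous_fderiv one_ne_zero
  have hnf : ∀ x, ‖fderiv ℝ f x‖ ≤ K := fun x => norm_fderiv_le_of_lipschitz ℝ hK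
  -- the variational equation
  have hexM : ∀ x, ∃ M : ℝ → E →L[ℝ] E, M 0 = ContinuousLinearMap.id ℝ E ∧
      ∀ t, HasDerivAt M ((fderiv ℝ f (X x t)).comp (M t)) t := fun x => by
    refine exists_global_solution (K := K)
      (v := fun t (N : E →L[ℝ] E) => (fderiv ℝ f (X x t)).comp N) (fun t => ?_) (fun N => ?_) _
    · refine LipschitzWith.of_dist_le_mul fun N N' => ?_
      rw [dist_eq_norm, dist_eq_norm, ← ContinuousLinearMap.comp_sub]
      exact (ContinuousLinearMap.opNorm_comp_le _ _).trans (by gcongr; exact hnf _)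
    · exact (hcf.comp (hXc x)).clm_comp continuous_const
  choose M hM0 hM using hexM
  -- `K` may be zero, while the Gronwall bound divides by the Lipschitz constant.
  set L : ℝ := K + 1 with hL
  have hL0 : 0 < L := by positivity
  have hKL : (K : ℝ) ≤ L := by linarith
  -- Lipschitz dependence on the initial value
  have hlip : ∀ T x y t, |t| ≤ T → ‖X y t - X x t‖ ≤ Real.exp (L * T) * ‖y - x‖ := by
    intro T x y t ht
    have h := norm_le_of_norm_deriv_le (g := fun t => X y t - X x t)
      (g' := fun t => f (X y t) - f (X x t)) (K := L) (c := 0) (T := T)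
      (fun t => (hX y t).sub (hX x t)) (fun t _ => by
        have := hK.dist_le_mul (X y t) (X x t)
        rw [dist_eq_norm, dist_eq_norm] at this
        rw [add_zero]
        exact this.trans (by gcongr)) ht
    rw [gronwallBound_ε0, hX0, hX0] at h
    calc ‖X y t - X x t‖ ≤ ‖y - x‖ * Real.exp (L * |t|) := h
      _ ≤ ‖y - x‖ * Real.exp (L * T) := by gcongr
      _ = _ := mul_comm _ _
  have hMb : ∀ T x t, |t| ≤ T → ‖M x t‖ ≤ ‖ContinuousLinearMap.id ℝ E‖ * Real.exp (L * T) := by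
    intro T x t ht
    have h := norm_le_of_norm_deriv_le (g := M x) (K := L) (c := 0) (T := T) (hM x)
      (fun t _ => by
        rw [add_zero]
        exact (ContinuousLinearMap.opNorm_comp_le _ _).trans
          (by gcongr; exact (hnf _).trans hKL)) ht
    rw [gronwallBound_ε0, hM0] at h
    exact h.trans (by gcongr)
  -- uniform continuity of the derivative near a trajectory
  have hunif : ∀ (T : ℝ) x, ∀ η > 0, ∃ δ > 0, ∀ t, |t| ≤ T → ∀ z, ‖z - X x t‖ < δ →
      ‖fderiv ℝ f z - fderiv ℝ f (X x t)‖ ≤ η := by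
    intro T x η hη
    have hcomp : IsCompact (X x '' Icc (-T) T) := isCompact_Icc.image (hXc x)
    have := hcomp.uniformContinuousAt_of_continuousAt (fderiv ℝ f)
      (fun y _ => hcf.continuousAt) (dist_mem_uniformity hη)
    rw [Metric.mem_uniformity_dist] at this
    obtain ⟨δ, hδ, h⟩ := this
    refine ⟨δ, hδ, fun t ht z hz => ?_⟩
    have h1 : dist (X x t) z < δ := by rwa [dist_comm, dist_eq_norm]
    have h2 := h h1 (mem_image_of_mem _ (abs_le.1 ht))
    have h3 : dist (fderiv ℝ f (X x t)) (fderiv ℝ f z) < η := h2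
    rw [dist_comm, dist_eq_norm] at h3
    exact h3.le
  have hnear : ∀ (T : ℝ) x, ∀ δ > 0, ∀ᶠ y in 𝓝 x, ∀ t, |t| ≤ T → ‖X y t - X x t‖ < δ := by
    intro T x δ hδ
    have : ∀ᶠ y in 𝓝 x, Real.exp (L * T) * ‖y - x‖ < δ := by
      have hc : Continuous fun y => Real.exp (L * T) * ‖y - x‖ := by fun_prop
      exact hc.continuousAt.eventually_lt continuousAt_const (by simpa using hδ)
    filter_upwards [this] with y hy t ht using (hlip T x y t ht).trans_lt hy
  -- differentiability in the initial value
  have hder : ∀ t x, HasFDerivAt (fun y => X y t) (M x t) x := by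
    intro t x
    rw [hasFDerivAt_iff_isLittleO, Asymptotics.isLittleO_iff]
    intro c hc
    set T := |t|
    -- One factor comes from the Lipschitz dependence on the initial value, the other from
    -- Gronwall's bound; a linearization error with constant `c / C` thus produces a remainder with
    -- constant `c`.
    set C := Real.exp (L * T) * (Real.exp (L * T) / L) with hC
    have hC0 : 0 < C := by positivity
    obtain ⟨δ, hδ, hu⟩ := hunif T x (c / C) (by positivity)
    filter_upwards [hnear T x δ hδ] with y hy
    have key := norm_le_mul_of_norm_deriv_le (g := fun t => X y t - X x t - M x t (y - x))
      (g' := fun t => f (X y t) - f (X x t) - (fderiv ℝ f (X x t)) (M x t (y - x)))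
      (K := L) (c := c / C * (Real.exp (L * T) * ‖y - x‖)) (T := T) hL0 (by positivity)
      (fun s => by
        refine ((hX y s).sub (hX x s)).sub ?_
        have := (hM x s).clm_apply (hasDerivAt_const s (y - x))
        simpa using this)
      (by simp [hX0, hM0]) (fun s hs => ?_) (le_refl T)
    · calc ‖X y t - X x t - M x t (y - x)‖
          ≤ c / C * (Real.exp (L * T) * ‖y - x‖) * (Real.exp (L * T) / L) := key
        _ = c / C * C * ‖y - x‖ := by rw [hC]; ring
        _ = c * ‖y - x‖ := by rw [div_mul_cancel₀ _ hC0.ne']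
    · have h1 : ‖f (X y s) - f (X x s) - fderiv ℝ f (X x s) (X y s - X x s)‖
          ≤ c / C * ‖X y s - X x s‖ := by
        refine (convex_ball (X x s) δ).norm_image_sub_le_of_norm_fderiv_le'
          (fun z _ => hdf z) (fun z hz => hu s hs z ?_) (mem_ball_self hδ) ?_
        · rwa [← dist_eq_norm]
        · rw [mem_ball, dist_eq_norm]; exact hy s hs
      -- The remainder `X y - X x - M x (y - x)` satisfies the variational equation up to the
      -- linearization error `h1` of `f`.
      have h2 : f (X y s) - f (X x s) - fderiv ℝ f (X x s) (M x s (y - x)) =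
          fderiv ℝ f (X x s) (X y s - X x s - M x s (y - x)) +
          (f (X y s) - f (X x s) - fderiv ℝ f (X x s) (X y s - X x s)) := by
        simp only [map_sub]; abel
      rw [h2]
      refine (norm_add_le _ _).trans (add_le_add ?_ (h1.trans ?_))
      · exact ((fderiv ℝ f (X x s)).le_opNorm _).trans (by gcongr; exact (hnf _).trans hKL)
      · gcongr
        exact hlip T x y s hs
  -- continuity of the derivative
  have hMc : Continuous fun z : ℝ × E => M z.2 z.1 := by
    rw [continuous_iff_continuousAt]
    rintro ⟨t₀, x₀⟩
    rw [Metric.continuousAt_iff']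
    intro c hc
    set T := |t₀| + 1
    -- The summand 1 makes `C` positive even for a trivial space and the final estimate strict.
    set C := ‖ContinuousLinearMap.id ℝ E‖ * Real.exp (L * T) * (Real.exp (L * T) / L) + 1 with hC
    have hC0 : 0 < C := by positivity
    obtain ⟨δ, hδ, hu⟩ := hunif T x₀ (c / 2 / C) (by positivity)
    have e1 : ∀ᶠ z : ℝ × E in 𝓝 (t₀, x₀), ∀ t, |t| ≤ T → ‖X z.2 t - X x₀ t‖ < δ :=
      (continuous_snd.tendsto (t₀, x₀)).eventually (hnear T x₀ δ hδ)
    have e2 : ∀ᶠ z : ℝ × E in 𝓝 (t₀, x₀), |z.1| < T :=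
      (continuous_fst.abs).continuousAt.eventually_lt continuousAt_const (by simp [T])
    have e3 : ∀ᶠ z : ℝ × E in 𝓝 (t₀, x₀), dist (M x₀ z.1) (M x₀ t₀) < c / 2 := by
      have h : ContinuousAt (fun z : ℝ × E => M x₀ z.1) (t₀, x₀) :=
        ContinuousAt.comp (g := M x₀) (hM x₀ t₀).continuousAt continuousAt_fst
      exact Metric.continuousAt_iff'.1 h (c / 2) (by positivity)
    filter_upwards [e1, e2, e3] with z h1 h2 h3
    have key := norm_le_mul_of_norm_deriv_le (g := fun t => M z.2 t - M x₀ t)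
      (g' := fun t => (fderiv ℝ f (X z.2 t)).comp (M z.2 t) - (fderiv ℝ f (X x₀ t)).comp (M x₀ t))
      (K := L) (c := c / 2 / C * (‖ContinuousLinearMap.id ℝ E‖ * Real.exp (L * T))) (T := T) hL0
      (by positivity) (fun s => (hM z.2 s).sub (hM x₀ s)) (by simp [hM0]) (fun s hs => ?_) h2.le
    · rw [dist_eq_norm] at h3 ⊢
      have h4 : c / 2 / C * (‖ContinuousLinearMap.id ℝ E‖ * Real.exp (L * T)) *
          (Real.exp (L * T) / L) < c / 2 := by
        rw [mul_assoc, div_mul_eq_mul_div, div_lt_iff₀ hC0]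
        gcongr
        rw [hC]; linarith
      have h5 : M z.2 z.1 - M x₀ t₀ = (M z.2 z.1 - M x₀ z.1) + (M x₀ z.1 - M x₀ t₀) := by abel
      show ‖M z.2 z.1 - M x₀ t₀‖ < c
      rw [h5]
      refine (norm_add_le _ _).trans_lt ?_
      linarith
    · have h6 : (fderiv ℝ f (X z.2 s)).comp (M z.2 s) - (fderiv ℝ f (X x₀ s)).comp (M x₀ s) =
          (fderiv ℝ f (X z.2 s)).comp (M z.2 s - M x₀ s) +
          (fderiv ℝ f (X z.2 s) - fderiv ℝ f (X x₀ s)).comp (M x₀ s) := by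
        rw [ContinuousLinearMap.comp_sub, ContinuousLinearMap.sub_comp]; abel
      rw [h6]
      refine (norm_add_le _ _).trans (add_le_add ?_ ?_)
      · exact (ContinuousLinearMap.opNorm_comp_le _ _).trans (by gcongr; exact (hnf _).trans hKL)
      · refine (ContinuousLinearMap.opNorm_comp_le _ _).trans ?_
        gcongr
        · exact hu s hs _ (h1 s hs)
        · exact hMb T x₀ s hs
  have hXjc : Continuous fun z : ℝ × E => X z.2 z.1 := by
    rw [continuous_iff_continuousAt]
    rintro ⟨t₀, x₀⟩
    rw [Metric.continuousAt_iff']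
    intro c hc
    have e1 : ∀ᶠ z : ℝ × E in 𝓝 (t₀, x₀), ∀ t, |t| ≤ |t₀| + 1 → ‖X z.2 t - X x₀ t‖ < c / 2 :=
      (continuous_snd.tendsto (t₀, x₀)).eventually (hnear _ x₀ (c / 2) (by positivity))
    have e2 : ∀ᶠ z : ℝ × E in 𝓝 (t₀, x₀), |z.1| < |t₀| + 1 :=
      (continuous_fst.abs).continuousAt.eventually_lt continuousAt_const (by simp)
    have e3 : ∀ᶠ z : ℝ × E in 𝓝 (t₀, x₀), dist (X x₀ z.1) (X x₀ t₀) < c / 2 := by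
      have h : ContinuousAt (fun z : ℝ × E => X x₀ z.1) (t₀, x₀) :=
        ContinuousAt.comp (g := X x₀) (hX x₀ t₀).continuousAt continuousAt_fst
      exact Metric.continuousAt_iff'.1 h (c / 2) (by positivity)
    filter_upwards [e1, e2, e3] with z h1 h2 h3
    have h4 := h1 z.1 h2.le
    rw [← dist_eq_norm] at h4
    calc dist (X z.2 z.1) (X x₀ t₀) ≤ dist (X z.2 z.1) (X x₀ z.1) + dist (X x₀ z.1) (X x₀ t₀) :=
          dist_triangle _ _ _
      _ < c := by linarith
  refine ⟨fun t x => X x t, hX0, hX, ?_⟩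
  -- Joint differentiability follows from the continuity of the two partial derivatives, `f (X x t)`
  -- in time and `M x t` in the initial value.
  rw [contDiff_one_iff_hasFDerivAt]
  let D₁ : ℝ → E → ℝ →L[ℝ] E := fun t x => ContinuousLinearMap.toSpanSingleton ℝ (f (X x t))
  let D₂ : ℝ → E → E →L[ℝ] E := fun t x => M x t
  have hD₁ : Continuous fun z : ℝ × E => D₁ z.1 z.2 := by
    have h : Continuous fun y : E => ContinuousLinearMap.toSpanSingleton ℝ y :=
      (ContinuousLinearMap.toSpanSingletonCLE (𝕜 := ℝ) (E := E)).continuous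
    exact h.comp (hf.continuous.comp hXjc)
  refine ⟨fun z => (D₁ z.1 z.2).coprod (D₂ z.1 z.2), ?_, fun z => ?_⟩
  · have h : Continuous fun p : (ℝ →L[ℝ] E) × (E →L[ℝ] E) => p.1.coprod p.2 :=
      (ContinuousLinearMap.coprodEquivL (𝕜 := ℝ) (E := ℝ) (F := E) (G := E) ℝ).continuous
    exact h.comp (hD₁.prodMk hMc)
  · exact (hasStrictFDerivAt_uncurry_coprod (f := fun t x => X x t) (f₁ := D₁) (f₂ := D₂) (u := z)
      (Eventually.of_forall fun w => (hX w.2 w.1).hasFDerivAt)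
      (Eventually.of_forall fun w => hder w.1 w.2) hD₁.continuousAt hMc.continuousAt).hasFDerivAt

end SmoothFlow

end TopologicalParticles

end

noncomputable section

namespace TopologicalParticles

open Set Filter Topology Metric
open scoped NNReal

/-! ### Regularity, lower bound and cutoff of the potential -/

section Potential

variable {Φ : ℝ → ℝ} {σ R : ℝ}

/-- At allowed points the differences `q_j - q_{j+1}` are below `-σ`, whereas smoothness is assumed
above `σ`; evenness transfers it. -/
lemma IsPairPotential.contDiffAt (hΦ : IsPairPotential Φ σ R) {q : ℝ} (hq : σ < |q|) :
    ContDiffAt ℝ 2 Φ q := by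
  have h : ∀ q, σ < q → ContDiffAt ℝ 2 Φ q := fun q hq =>
    hΦ.smooth.contDiffAt (Ioi_mem_nhds hq)
  rcases lt_abs.1 hq with h1 | h1
  · exact h q h1
  · have h2 : Φ = Φ ∘ Neg.neg := by funext q; simp [hΦ.even]
    rw [h2]
    exact (h (-q) h1).comp q contDiff_neg.contDiffAt

lemma IsPairPotential.differentiableAt (hΦ : IsPairPotential Φ σ R) {q : ℝ} (hq : σ < |q|) :
    DifferentiableAt ℝ Φ q :=
  (hΦ.contDiffAt hq).differentiableAt two_ne_zero

/-- The potential is nonnegative near the core, zero beyond `R`, and bounded on the compact interval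
in between. -/
lemma IsPairPotential.exists_lower_bound (hΦ : IsPairPotential Φ σ R) :
    ∃ m, 0 ≤ m ∧ ∀ q, σ < |q| → -m ≤ Φ q := by
  obtain ⟨c, hc, hc'⟩ : ∃ c, σ < c ∧ ∀ q ∈ Ioo σ c, 0 ≤ Φ q := by
    have h := hΦ.hard_core.eventually_ge_atTop 0
    rw [eventually_iff, mem_nhdsGT_iff_exists_Ioo_subset] at h
    obtain ⟨c, hc, h⟩ := h
    exact ⟨c, hc, fun q hq => h hq⟩
  obtain ⟨m, hm⟩ := (isCompact_Icc (a := c) (b := R)).exists_bound_of_continuousOn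
    (f := Φ) (fun q hq => (hΦ.contDiffAt
      (hc.trans_le (hq.1.trans (le_abs_self q)))).continuousAt.continuousWithinAt)
  refine ⟨|m|, abs_nonneg _, fun q hq => ?_⟩
  have h : Φ q = Φ |q| := by
    rcases abs_choice q with h | h <;> rw [h]
    exact (hΦ.even q).symm
  rw [h]
  rcases lt_or_ge |q| c with h1 | h1
  · linarith [hc' _ ⟨hq, h1⟩, abs_nonneg m]
  · rcases lt_or_ge R |q| with h2 | h2
    · rw [hΦ.short_range _ (by rwa [abs_abs])]; linarith [abs_nonneg m]
    · have h3 := hm _ ⟨h1, h2⟩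
      rw [Real.norm_eq_abs] at h3
      linarith [neg_abs_le (Φ |q|), le_abs_self m]

/-- The potential can be modified near the core so that it becomes smooth on the whole line. -/
lemma IsPairPotential.exists_cutoff (hΦ : IsPairPotential Φ σ R) {δ : ℝ} (hδ : 0 < δ) :
    ∃ Ψ : ℝ → ℝ, ContDiff ℝ 2 Ψ ∧ HasCompactSupport Ψ ∧
      ∀ q, σ + δ ≤ |q| → Ψ =ᶠ[𝓝 q] Φ := by
  have hσ := hΦ.core_pos
  set a := σ + δ / 3 with ha
  set b := σ + 2 * δ / 3 with hb
  have hab : 0 < b ^ 2 - a ^ 2 := by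
    have : a < b := by rw [ha, hb]; linarith
    have : 0 < a := by positivity
    nlinarith
  -- The transition is a function of `q ^ 2`, hence smooth at 0; it vanishes for `|q| ≤ a`, which
  -- removes the arbitrary values of `Φ` in the core, and equals 1 for `|q| ≥ b`.
  let χ : ℝ → ℝ := fun q => Real.smoothTransition ((q ^ 2 - a ^ 2) / (b ^ 2 - a ^ 2))
  have hχ : ContDiff ℝ 2 χ := Real.smoothTransition.contDiff.comp (by fun_prop)
  refine ⟨fun q => χ q * Φ q, ?_, ?_, ?_⟩
  · rw [contDiff_iff_contDiffAt]
    intro q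
    rcases lt_or_ge |q| a with h | h
    · have : (fun q => χ q * Φ q) =ᶠ[𝓝 q] fun _ => 0 := by
        filter_upwards [continuous_abs.continuousAt.eventually_lt continuousAt_const h] with p hp
        have h1 : (p ^ 2 - a ^ 2) / (b ^ 2 - a ^ 2) ≤ 0 := by
          apply div_nonpos_of_nonpos_of_nonneg _ hab.le
          have := sq_lt_sq' (by linarith [abs_nonneg p]) hp
          rw [sq_abs] at this
          linarith
        simp [χ, Real.smoothTransition.zero_of_nonpos h1]
      exact contDiffAt_const.congr_of_eventuallyEq this
    · exact hχ.contDiffAt.mul (hΦ.contDiffAt (by linarith))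
  · refine HasCompactSupport.intro (isCompact_closedBall (0 : ℝ) R) fun q hq => ?_
    rw [mem_closedBall, dist_zero_right, Real.norm_eq_abs, not_le] at hq
    simp [hΦ.short_range q hq]
  · intro q hq
    have h : b < |q| := by linarith
    filter_upwards [(continuousAt_const (y := b)).eventually_lt continuous_abs.continuousAt h]
      with p hp
    have h1 : 1 ≤ (p ^ 2 - a ^ 2) / (b ^ 2 - a ^ 2) := by
      rw [le_div_iff₀ hab]
      have hb0 : 0 < b := by positivity
      have := pow_lt_pow_left₀ hp hb0.le two_ne_zero
      rw [sq_abs] at this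
      linarith
    simp [χ, Real.smoothTransition.one_of_one_le h1]

end Potential

/-! ### The Hamiltonian vector field, conservation of energy and the flow -/

section Field

variable {a b : ℤ}

/-- Sums over all labels replace the case distinctions at the ends of the block, so that the force
of `j` on `i` and that of `i` on `j` can be matched by exchanging the order of summation. -/
lemma dite_succ_eq_sum {M : Type*} [AddCommMonoid M] (i : ↥(Finset.Ico a b))
    (g : ↥(Finset.Ico a b) → M) :
    (if h : (i : ℤ) + 1 ∈ Finset.Ico a b then g ⟨(i : ℤ) + 1, h⟩ else 0) =
      ∑ j : ↥(Finset.Ico a b), if (j : ℤ) = i + 1 then g j else 0 := by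
  split_ifs with h
  · rw [Finset.sum_eq_single ⟨(i : ℤ) + 1, h⟩]
    · simp
    · intro j _ hj
      rw [if_neg]
      exact fun h' => hj (Subtype.ext h')
    · simp
  · rw [Finset.sum_eq_zero]
    intro j _
    rw [if_neg]
    exact fun h' => h (h' ▸ j.2)

lemma dite_pred_eq_sum {M : Type*} [AddCommMonoid M] (i : ↥(Finset.Ico a b))
    (g : ↥(Finset.Ico a b) → M) :
    (if h : (i : ℤ) - 1 ∈ Finset.Ico a b then g ⟨(i : ℤ) - 1, h⟩ else 0) =
      ∑ j : ↥(Finset.Ico a b), if (i : ℤ) = j + 1 then g j else 0 := by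
  split_ifs with h
  · rw [Finset.sum_eq_single ⟨(i : ℤ) - 1, h⟩]
    · simp
    · intro j _ hj
      rw [if_neg]
      exact fun h' => hj (Subtype.ext (by simp [h']))
    · simp
  · rw [Finset.sum_eq_zero]
    intro j _
    rw [if_neg]
    intro h'
    refine h ?_
    rw [h', add_sub_cancel_right]
    exact j.2

lemma force_eq_sum (Φ : ℝ → ℝ) (x : Phase a b) (i : ↥(Finset.Ico a b)) :
    force Φ x i = (∑ j : ↥(Finset.Ico a b), if (j : ℤ) = i + 1 then
        -deriv Φ ((x i).1 - (x j).1) else 0) +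
      ∑ j : ↥(Finset.Ico a b), if (i : ℤ) = j + 1 then deriv Φ ((x j).1 - (x i).1) else 0 := by
  unfold force
  rw [← dite_succ_eq_sum i (fun j => -deriv Φ ((x i).1 - (x j).1)),
    ← dite_pred_eq_sum i (fun j => deriv Φ ((x j).1 - (x i).1))]

/-- The Hamiltonian vector field. -/
def vectorField (Φ : ℝ → ℝ) (x : Phase a b) : Phase a b := fun i => ((x i).2, force Φ x i)

/-- The Hamilton function. -/
def energy (Φ : ℝ → ℝ) (x : Phase a b) : ℝ :=
  (∑ i, (x i).2 ^ 2 / 2) + ∑ i : ↥(Finset.Ico a b), ∑ j : ↥(Finset.Ico a b),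
    if (j : ℤ) = i + 1 then Φ ((x i).1 - (x j).1) else 0

lemma isOpen_allowed (σ : ℝ) (a b : ℤ) : IsOpen (Allowed σ a b) := by
  have : Allowed σ a b = ⋂ i : ↥(Finset.Ico a b), ⋂ j : ↥(Finset.Ico a b),
      {x | (j : ℤ) = (i : ℤ) + 1 → σ + (x i).1 < (x j).1} := by
    ext x; simp [Allowed]
  rw [this]
  refine isOpen_iInter_of_finite fun i => isOpen_iInter_of_finite fun j => ?_
  by_cases h : (j : ℤ) = (i : ℤ) + 1
  · simp only [h, forall_const]
    exact isOpen_lt (by fun_prop) (by fun_prop)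
  · simp [h]

lemma lt_abs_sub_of_mem_allowed {σ : ℝ} {x : Phase a b} (hx : x ∈ Allowed σ a b)
    {i j : ↥(Finset.Ico a b)} (h : (j : ℤ) = i + 1) : σ < |(x i).1 - (x j).1| := by
  have := hx i j h
  rw [abs_sub_comm]
  exact lt_abs.2 (Or.inl (by linarith))

lemma allowed_mono {σ τ : ℝ} (h : σ ≤ τ) : Allowed τ a b ⊆ Allowed σ a b :=
  fun x hx i j hij => by linarith [hx i j hij]

lemma hasDerivAt_phase_iff {X : ℝ → Phase a b} {v : Phase a b} {t : ℝ} :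
    HasDerivAt X v t ↔ ∀ i, HasDerivAt (fun τ => (X τ i).1) (v i).1 t ∧
      HasDerivAt (fun τ => (X τ i).2) (v i).2 t := by
  rw [hasDerivAt_pi]
  refine forall_congr' fun i => ⟨fun h => ⟨?_, ?_⟩, fun h => ?_⟩
  · exact (hasFDerivAt_fst.comp_hasDerivAt t h)
  · exact (hasFDerivAt_snd.comp_hasDerivAt t h)
  · exact h.1.prodMk h.2

lemma isTrajectory_iff {Φ : ℝ → ℝ} {σ : ℝ} {X : ℝ → Phase a b} :
    IsTrajectory Φ σ a b X ↔
      ∀ t, X t ∈ Allowed σ a b ∧ HasDerivAt X (vectorField Φ (X t)) t := by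
  constructor
  · exact fun h t => ⟨h.allowed t, hasDerivAt_phase_iff.2 fun i => ⟨h.position t i, h.momentum t i⟩⟩
  · exact fun h => ⟨fun t => (h t).1, fun t i => (hasDerivAt_phase_iff.1 (h t).2 i).1,
      fun t i => (hasDerivAt_phase_iff.1 (h t).2 i).2⟩

/-- The work of the forces cancels the change of the potential energy pair by pair. The
differentiability hypothesis is only along the trajectory, so that the lemma covers both `Φ` and its
cutoff. -/
lemma hasDerivAt_energy {Φ : ℝ → ℝ} {X : ℝ → Phase a b} {t : ℝ}
    (hX : HasDerivAt X (vectorField Φ (X t)) t)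
    (hd : ∀ i j : ↥(Finset.Ico a b), (j : ℤ) = i + 1 →
      DifferentiableAt ℝ Φ ((X t i).1 - (X t j).1)) :
    HasDerivAt (fun s => energy Φ (X s)) 0 t := by
  have hX' := hasDerivAt_phase_iff.1 hX
  have h1 : ∀ i, HasDerivAt (fun s => (X s i).2 ^ 2 / 2) ((X t i).2 * force Φ (X t) i) t := by
    intro i
    have := ((hX' i).2.pow 2).div_const 2
    convert! this using 1
    simp [vectorField]
    ring
  have h2 : ∀ i j : ↥(Finset.Ico a b), HasDerivAt
      (fun s => if (j : ℤ) = i + 1 then Φ ((X s i).1 - (X s j).1) else 0)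
      (if (j : ℤ) = i + 1 then deriv Φ ((X t i).1 - (X t j).1) * ((X t i).2 - (X t j).2) else 0)
      t := by
    intro i j
    split_ifs with h
    · exact (hd i j h).hasDerivAt.comp t ((hX' i).1.sub (hX' j).1)
    · exact hasDerivAt_const _ _
  have h3 := (HasDerivAt.fun_sum (u := Finset.univ) fun i _ => h1 i).add
    (HasDerivAt.fun_sum (u := Finset.univ) fun i _ =>
      HasDerivAt.fun_sum (u := Finset.univ) fun j _ => h2 i j)
  convert! h3 using 1
  have h4 : ∀ i, (X t i).2 * force Φ (X t) i =
      (∑ j : ↥(Finset.Ico a b), if (j : ℤ) = i + 1 then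
        -(deriv Φ ((X t i).1 - (X t j).1) * (X t i).2) else 0) +
      ∑ j : ↥(Finset.Ico a b), if (i : ℤ) = j + 1 then
        deriv Φ ((X t j).1 - (X t i).1) * (X t i).2 else 0 := by
    intro i
    rw [force_eq_sum, mul_add, Finset.mul_sum, Finset.mul_sum]
    congr 1 <;> refine Finset.sum_congr rfl fun j _ => ?_ <;> split_ifs <;> ring
  simp_rw [h4]
  rw [Finset.sum_add_distrib]
  -- After the exchange every sum runs over the pairs with `j = i + 1`.
  rw [Finset.sum_comm (f := fun i j : ↥(Finset.Ico a b) => if (i : ℤ) = j + 1 then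
        deriv Φ ((X t j).1 - (X t i).1) * (X t i).2 else 0)]
  rw [← Finset.sum_add_distrib, ← Finset.sum_add_distrib, Finset.sum_eq_zero]
  intro i _
  rw [← Finset.sum_add_distrib, ← Finset.sum_add_distrib, Finset.sum_eq_zero]
  intro j _
  split_ifs <;> ring

lemma contDiff_vectorField {Ψ : ℝ → ℝ} (hΨ : ContDiff ℝ 2 Ψ) :
    ContDiff ℝ 1 (vectorField Ψ : Phase a b → Phase a b) := by
  have hd : ContDiff ℝ 1 (deriv Ψ) := by
    have h := (contDiff_succ_iff_deriv (n := 1) (f := Ψ)).1 (by rw [one_add_one_eq_two]; exact hΨ)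
    exact h.2.2
  rw [contDiff_pi]
  intro i
  refine ContDiff.prodMk (by fun_prop) ?_
  simp_rw [force_eq_sum]
  refine ContDiff.add (ContDiff.sum fun j _ => ?_) (ContDiff.sum fun j _ => ?_)
  · split_ifs
    · exact (hd.comp (by fun_prop)).neg
    · exact contDiff_const
  · split_ifs
    · exact hd.comp (by fun_prop)
    · exact contDiff_const

lemma exists_lipschitzWith_sum {α ι : Type*} [PseudoMetricSpace α] (s : Finset ι) (f : ι → α → ℝ)
    (h : ∀ i ∈ s, ∃ K, LipschitzWith K (f i)) : ∃ K, LipschitzWith K fun x => ∑ i ∈ s, f i x := by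
  classical
  induction s using Finset.induction_on with
  | empty => exact ⟨0, by simp⟩
  | insert i s hi ih =>
    obtain ⟨K, hK⟩ := h i (Finset.mem_insert_self _ _)
    obtain ⟨K', hK'⟩ := ih fun j hj => h j (Finset.mem_insert_of_mem hj)
    refine ⟨K + K', ?_⟩
    simp_rw [Finset.sum_insert hi]
    exact hK.add hK'

/-- The field is linear in the momenta, and `Ψ'`, being `C¹` with compact support, is Lipschitz. -/
lemma exists_lipschitzWith_vectorField {Ψ : ℝ → ℝ} (hΨ : ContDiff ℝ 2 Ψ)
    (hs : HasCompactSupport Ψ) :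
    ∃ K, LipschitzWith K (vectorField Ψ : Phase a b → Phase a b) := by
  have hd : ContDiff ℝ 1 (deriv Ψ) := by
    have h := (contDiff_succ_iff_deriv (n := 1) (f := Ψ)).1 (by rw [one_add_one_eq_two]; exact hΨ)
    exact h.2.2
  obtain ⟨C, hC⟩ := hd.lipschitzWith_of_hasCompactSupport hs.deriv one_ne_zero
  have hsub : ∀ i j : ↥(Finset.Ico a b),
      LipschitzWith (C * (1 + 1)) fun x : Phase a b => deriv Ψ ((x i).1 - (x j).1) := by
    intro i j
    have h1 : ∀ i, LipschitzWith 1 fun x : Phase a b => (x i).1 := fun i => by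
      simpa [Function.comp_def] using
        LipschitzWith.prod_fst.comp (LipschitzWith.eval (α := fun _ => ℝ × ℝ) i)
    exact hC.comp ((h1 i).sub (h1 j))
  have hcomp : ∀ i : ↥(Finset.Ico a b), ∃ K,
      LipschitzWith K fun x : Phase a b => vectorField Ψ x i := by
    intro i
    have h1 : LipschitzWith 1 fun x : Phase a b => (x i).2 := by
      simpa [Function.comp_def] using
        LipschitzWith.prod_snd.comp (LipschitzWith.eval (α := fun _ => ℝ × ℝ) i)
    have h2 : ∃ K, LipschitzWith K fun x : Phase a b => force Ψ x i := by
      simp_rw [force_eq_sum]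
      obtain ⟨K, hK⟩ := exists_lipschitzWith_sum Finset.univ
        (fun (j : ↥(Finset.Ico a b)) (x : Phase a b) => if (j : ℤ) = i + 1 then
          -deriv Ψ ((x i).1 - (x j).1) else 0) (fun j _ => by
          split_ifs
          · exact ⟨_, (hsub i j).neg⟩
          · exact ⟨0, LipschitzWith.const 0⟩)
      obtain ⟨K', hK'⟩ := exists_lipschitzWith_sum Finset.univ
        (fun (j : ↥(Finset.Ico a b)) (x : Phase a b) => if (i : ℤ) = j + 1 then
          deriv Ψ ((x j).1 - (x i).1) else 0) (fun j _ => by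
          split_ifs
          · exact ⟨_, hsub j i⟩
          · exact ⟨0, LipschitzWith.const 0⟩)
      exact ⟨K + K', hK.add hK'⟩
    obtain ⟨K, hK⟩ := h2
    exact ⟨max 1 K, h1.prodMk hK⟩
  choose K hK using hcomp
  refine ⟨∑ i, K i, LipschitzWith.of_dist_le_mul fun x y => ?_⟩
  rw [dist_pi_le_iff (by positivity)]
  intro i
  refine ((hK i).dist_le_mul x y).trans ?_
  gcongr
  exact Finset.single_le_sum (f := K) (fun j _ => zero_le) (Finset.mem_univ i)

variable {Φ : ℝ → ℝ} {σ R : ℝ}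

lemma vectorField_congr {Ψ : ℝ → ℝ} {τ : ℝ} (h : ∀ q, τ ≤ |q| → Ψ =ᶠ[𝓝 q] Φ)
    {x : Phase a b} (hx : x ∈ Allowed τ a b) : vectorField Ψ x = vectorField Φ x := by
  funext i
  refine Prod.ext rfl ?_
  show force Ψ x i = force Φ x i
  rw [force_eq_sum, force_eq_sum]
  congr 1 <;> refine Finset.sum_congr rfl fun j _ => ?_ <;> split_ifs with hij
  · rw [(h _ (lt_abs_sub_of_mem_allowed hx hij).le).deriv_eq]
  · rfl
  · rw [(h _ (lt_abs_sub_of_mem_allowed hx hij).le).deriv_eq]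
  · rfl

lemma IsPairPotential.continuousAt_energy (hΦ : IsPairPotential Φ σ R) {x : Phase a b}
    (hx : x ∈ Allowed σ a b) : ContinuousAt (energy Φ) x := by
  unfold energy
  refine ContinuousAt.add
    (continuous_finsetSum _ fun i _ => (by fun_prop : Continuous fun x : Phase a b =>
      (x i).2 ^ 2 / 2)).continuousAt ?_
  refine tendsto_finsetSum _ fun i _ => tendsto_finsetSum _ fun j _ => ?_
  split_ifs with h
  · exact ContinuousAt.comp (g := Φ) (f := fun x : Phase a b => (x i).1 - (x j).1)
      (hΦ.contDiffAt (lt_abs_sub_of_mem_allowed hx h)).continuousAt (by fun_prop)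
  · exact tendsto_const_nhds

/-- Points of bounded energy keep a positive distance from the core. -/
lemma IsPairPotential.exists_gap (hΦ : IsPairPotential Φ σ R) (a b : ℤ) (e : ℝ) :
    ∃ δ > 0, ∀ x ∈ Allowed σ a b, energy Φ x < e → x ∈ Allowed (σ + δ) a b := by
  obtain ⟨m, hm0, hm⟩ := hΦ.exists_lower_bound
  set n : ℝ := (Fintype.card ↥(Finset.Ico a b) : ℝ)
  -- There are `n * n` pair terms, each at least `-m`; a single one above `e + n * (n * m)` would
  -- push the energy above `e`.
  obtain ⟨c, hc, hc'⟩ : ∃ c, σ < c ∧ ∀ q ∈ Ioo σ c, e + n * (n * m) < Φ q := by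
    have h := hΦ.hard_core.eventually_gt_atTop (e + n * (n * m))
    rw [eventually_iff, mem_nhdsGT_iff_exists_Ioo_subset] at h
    obtain ⟨c, hc, h⟩ := h
    exact ⟨c, hc, fun q hq => h hq⟩
  refine ⟨(c - σ) / 2, by linarith, fun x hx he i j hij => ?_⟩
  by_contra hcon
  push Not at hcon
  have hgap := hx i j hij
  have h1 := hc' ((x j).1 - (x i).1) ⟨by linarith, by linarith⟩
  rw [← hΦ.even, neg_sub] at h1
  let T : ↥(Finset.Ico a b) → ↥(Finset.Ico a b) → ℝ := fun i j =>
    if (j : ℤ) = i + 1 then Φ ((x i).1 - (x j).1) else 0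
  have hT : ∀ i j, 0 ≤ T i j + m := fun i j => by
    simp only [T]
    split_ifs with h
    · linarith [hm _ (lt_abs_sub_of_mem_allowed hx h)]
    · linarith
  have h2 : T i j + m ≤ ∑ i, ∑ j, (T i j + m) :=
    (Finset.single_le_sum (f := fun j => T i j + m) (fun j _ => hT i j)
      (Finset.mem_univ j)).trans
      (Finset.single_le_sum (f := fun i => ∑ j, (T i j + m))
        (fun i _ => Finset.sum_nonneg fun j _ => hT i j) (Finset.mem_univ i))
  have h3 : ∑ i, ∑ j, (T i j + m) = (∑ i, ∑ j, T i j) + n * (n * m) := by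
    simp [Finset.sum_add_distrib, n]
  have h4 : energy Φ x = (∑ i, (x i).2 ^ 2 / 2) + ∑ i, ∑ j, T i j := rfl
  have h5 : 0 ≤ ∑ i, (x i).2 ^ 2 / 2 := Finset.sum_nonneg fun i _ => by positivity
  have h6 : T i j = Φ ((x i).1 - (x j).1) := by simp [T, hij]
  linarith

lemma IsPairPotential.energy_eq (hΦ : IsPairPotential Φ σ R) {X : ℝ → Phase a b}
    (hX : IsTrajectory Φ σ a b X) (t : ℝ) : energy Φ (X t) = energy Φ (X 0) := by
  rw [isTrajectory_iff] at hX
  have h : ∀ t, HasDerivAt (fun s => energy Φ (X s)) 0 t := fun t =>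
    hasDerivAt_energy (hX t).2 fun i j hij =>
      hΦ.differentiableAt (lt_abs_sub_of_mem_allowed (hX t).1 hij)
  exact is_const_of_deriv_eq_zero (fun t => (h t).differentiableAt) (fun t => (h t).deriv) t 0

/-- Near an allowed point, the dynamics is a global flow of class `C¹`. -/
lemma IsPairPotential.exists_local_flow (hΦ : IsPairPotential Φ σ R) {x₀ : Phase a b}
    (hx₀ : x₀ ∈ Allowed σ a b) :
    ∃ φ : ℝ → Phase a b → Phase a b, (ContDiff ℝ 1 fun z : ℝ × Phase a b => φ z.1 z.2) ∧
      ∀ᶠ x in 𝓝 x₀, φ 0 x = x ∧ IsTrajectory Φ σ a b (fun t => φ t x) ∧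
        ∀ X, IsTrajectory Φ σ a b X → X 0 = x → X = fun t => φ t x := by
  -- The points of energy less than `e` form a neighbourhood of `x₀` within the allowed points, and
  -- one gap `δ` and one cutoff serve all of them.
  set e := energy Φ x₀ + 1
  obtain ⟨δ, hδ, hgap⟩ := hΦ.exists_gap a b e
  obtain ⟨Ψ, hΨ, hΨs, hΨΦ⟩ := hΦ.exists_cutoff hδ
  obtain ⟨K, hK⟩ := exists_lipschitzWith_vectorField (a := a) (b := b) hΨ hΨs
  obtain ⟨φ, hφ0, hφ, hφc⟩ := exists_contDiff_flow (contDiff_vectorField hΨ) hK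
  have hev : ∀ᶠ x in 𝓝 x₀, x ∈ Allowed σ a b ∧ energy Φ x < e :=
    Eventually.and ((isOpen_allowed σ a b).mem_nhds hx₀)
      ((hΦ.continuousAt_energy hx₀).eventually_lt continuousAt_const (by simp [e]))
  refine ⟨φ, hφc, ?_⟩
  filter_upwards [hev] with x hx
  have hcont : Continuous fun t => φ t x :=
    continuous_iff_continuousAt.2 fun t => (hφ x t).continuousAt
  have henΨ : ∀ t, energy Ψ (φ t x) = energy Ψ x := by
    have h : ∀ t, HasDerivAt (fun s => energy Ψ (φ s x)) 0 t := fun t =>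
      hasDerivAt_energy (hφ x t) fun i j _ => hΨ.differentiable two_ne_zero _
    intro t
    have := is_const_of_deriv_eq_zero (fun t => (h t).differentiableAt) (fun t => (h t).deriv) t 0
    simpa [hφ0] using this
  have hen : ∀ y : Phase a b, (∀ i j : ↥(Finset.Ico a b), (j : ℤ) = i + 1 →
      σ + δ + (y i).1 ≤ (y j).1) → energy Ψ y = energy Φ y := by
    intro y hy
    unfold energy
    congr 1
    refine Finset.sum_congr rfl fun i _ => Finset.sum_congr rfl fun j _ => ?_
    split_ifs with h
    · refine (hΨΦ _ ?_).eq_of_nhds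
      rw [abs_sub_comm]
      exact le_abs.2 (Or.inl (by linarith [hy i j h]))
    · rfl
  -- The times at which the gap exceeds `σ + δ` form a closed and open set. It is closed because the
  -- nonstrict inequality already makes the energies of `Ψ` and `Φ` agree, whereupon energy
  -- conservation and `hgap` restore the strict one.
  have hmem : ∀ t, φ t x ∈ Allowed (σ + δ) a b := by
    have hclosed : IsClosed {t | φ t x ∈ Allowed (σ + δ) a b} := by
      have : {t | φ t x ∈ Allowed (σ + δ) a b} = {t | ∀ i j : ↥(Finset.Ico a b),
          (j : ℤ) = i + 1 → σ + δ + (φ t x i).1 ≤ (φ t x j).1} := by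
        ext t
        refine ⟨fun h i j hij => (h i j hij).le, fun h => hgap _ ?_ ?_⟩
        · intro i j hij
          linarith [h i j hij]
        · rw [← hen _ h, henΨ, hen]
          · exact hx.2
          · exact fun i j hij => (hgap x hx.1 hx.2 i j hij).le
      rw [this]
      simp only [ofPred_forall]
      refine isClosed_iInter fun i => isClosed_iInter fun j => isClosed_iInter fun _ => ?_
      exact isClosed_le (by fun_prop) (by fun_prop)
    have hopen : IsOpen {t | φ t x ∈ Allowed (σ + δ) a b} :=
      (isOpen_allowed _ _ _).preimage hcont
    have := IsClopen.eq_univ ⟨hclosed, hopen⟩ ⟨0, by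
      rw [mem_ofPred_eq, hφ0]
      exact hgap x hx.1 hx.2⟩
    intro t
    have h : t ∈ {t | φ t x ∈ Allowed (σ + δ) a b} := this ▸ mem_univ t
    exact h
  refine ⟨hφ0 x, ?_, fun X hX hX0 => ?_⟩
  · rw [isTrajectory_iff]
    refine fun t => ⟨allowed_mono (by linarith) (hmem t), ?_⟩
    rw [← vectorField_congr hΨΦ (hmem t)]
    exact hφ x t
  -- By energy conservation any competing trajectory also stays away from the core, hence solves the
  -- equation of the cutoff potential.
  · have hXm : ∀ t, X t ∈ Allowed (σ + δ) a b := fun t =>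
      hgap _ (hX.allowed t) (by rw [hΦ.energy_eq hX, hX0]; exact hx.2)
    rw [isTrajectory_iff] at hX
    refine ODE_solution_unique_univ (v := fun _ => vectorField Ψ) (s := fun _ => univ) (K := K)
      (t₀ := 0) (fun _ => hK.lipschitzOnWith) (fun t => ⟨?_, trivial⟩)
      (fun t => ⟨hφ x t, trivial⟩) (by rw [hX0, hφ0])
    rw [vectorField_congr hΨΦ (hXm t)]
    exact (hX t).2

/-! The flow of the particles of a block. -/

/-- At allowed points a trajectory exists, so the default branch in the definition of `flow` does
not occur. -/
lemma IsPairPotential.isTrajectory_flow (hΦ : IsPairPotential Φ σ R) {x : Phase a b}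
    (hx : x ∈ Allowed σ a b) :
    IsTrajectory Φ σ a b (fun t => flow Φ σ a b t x) ∧ flow Φ σ a b 0 x = x := by
  obtain ⟨φ, -, hφ⟩ := hΦ.exists_local_flow hx
  obtain ⟨h0, h1, -⟩ := hφ.self_of_nhds
  have h : ∃ X : ℝ → Phase a b, IsTrajectory Φ σ a b X ∧ X 0 = x := ⟨_, h1, h0⟩
  unfold flow
  simp only [h, dif_pos]
  exact h.choose_spec

lemma IsPairPotential.eq_flow (hΦ : IsPairPotential Φ σ R) {X : ℝ → Phase a b}
    (hX : IsTrajectory Φ σ a b X) (t : ℝ) : X t = flow Φ σ a b t (X 0) := by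
  obtain ⟨φ, -, hφ⟩ := hΦ.exists_local_flow (hX.allowed 0)
  obtain ⟨-, -, h⟩ := hφ.self_of_nhds
  obtain ⟨h1, h2⟩ := hΦ.isTrajectory_flow (hX.allowed 0)
  have e1 := h X hX rfl
  have e2 := h _ h1 h2
  exact (congrFun e1 t).trans (congrFun e2 t).symm

lemma IsPairPotential.flow_mem (hΦ : IsPairPotential Φ σ R) {x : Phase a b}
    (hx : x ∈ Allowed σ a b) (t : ℝ) : flow Φ σ a b t x ∈ Allowed σ a b :=
  (hΦ.isTrajectory_flow hx).1.allowed t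

lemma IsPairPotential.flow_zero (hΦ : IsPairPotential Φ σ R) {x : Phase a b}
    (hx : x ∈ Allowed σ a b) : flow Φ σ a b 0 x = x :=
  (hΦ.isTrajectory_flow hx).2

lemma IsPairPotential.hasDerivAt_flow (hΦ : IsPairPotential Φ σ R) {x : Phase a b}
    (hx : x ∈ Allowed σ a b) (t : ℝ) :
    HasDerivAt (fun s => flow Φ σ a b s x) (vectorField Φ (flow Φ σ a b t x)) t :=
  (isTrajectory_iff.1 (hΦ.isTrajectory_flow hx).1 t).2

lemma IsPairPotential.flow_flow (hΦ : IsPairPotential Φ σ R) {x : Phase a b}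
    (hx : x ∈ Allowed σ a b) (s t : ℝ) :
    flow Φ σ a b s (flow Φ σ a b t x) = flow Φ σ a b (s + t) x := by
  have h : IsTrajectory Φ σ a b (fun s => flow Φ σ a b (s + t) x) := by
    rw [isTrajectory_iff]
    refine fun s => ⟨hΦ.flow_mem hx _, ?_⟩
    exact (hΦ.hasDerivAt_flow hx (s + t)).comp_add_const s t
  have := hΦ.eq_flow h s
  simp only [zero_add] at this
  exact this.symm

lemma IsPairPotential.contDiffOn_flow (hΦ : IsPairPotential Φ σ R) :
    ContDiffOn ℝ 1 (fun z : ℝ × Phase a b => flow Φ σ a b z.1 z.2)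
      (univ ×ˢ Allowed σ a b) := by
  rintro ⟨t, x⟩ ⟨-, hx⟩
  obtain ⟨φ, hc, hφ⟩ := hΦ.exists_local_flow hx
  refine ContDiffAt.contDiffWithinAt (hc.contDiffAt.congr_of_eventuallyEq ?_)
  filter_upwards [(continuous_snd.tendsto (t, x)).eventually
    (hφ.and ((isOpen_allowed σ a b).eventually_mem hx))] with z hz
  have h := hz.1.2.2 _ (hΦ.isTrajectory_flow hz.2).1 (hΦ.flow_zero hz.2)
  exact congrFun h z.1

end Field

end TopologicalParticles

end

noncomputable section

namespace TopologicalParticles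

open Finset

/-! ### Restriction to blocks and block dynamics -/

section Restrict

variable {a b c d e f : ℤ}

lemma restrict_apply (x : Phase a b) (i : ↥(Ico c d)) (h : (i : ℤ) ∈ Ico a b) :
    restrict c d x i = x ⟨i, h⟩ := by
  simp [restrict, mem_Ico.1 h]

@[simp]
lemma restrict_self (x : Phase a b) : restrict a b x = x := by
  funext i
  rw [restrict_apply x i i.2]

lemma restrict_restrict (x : Phase a b) (h₁ : c ≤ e) (h₂ : f ≤ d) :
    restrict e f (restrict c d x) = restrict e f x := by
  funext i
  have hi := mem_Ico.1 i.2
  rw [restrict_apply _ i (mem_Ico.2 ⟨by omega, by omega⟩)]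
  rfl

lemma restrict_mem_allowed {σ : ℝ} {x : Phase a b} (hx : x ∈ Allowed σ a b) (h₁ : a ≤ c)
    (h₂ : d ≤ b) : restrict c d x ∈ Allowed σ c d := by
  intro i j hij
  have hi := mem_Ico.1 i.2
  have hj := mem_Ico.1 j.2
  rw [restrict_apply x i (mem_Ico.2 ⟨by omega, by omega⟩),
    restrict_apply x j (mem_Ico.2 ⟨by omega, by omega⟩)]
  exact hx _ _ hij

variable (Φ : ℝ → ℝ) (σ t : ℝ)

lemma restrict_evolve_of_disjoint (x : Phase a b) (h : d ≤ e ∨ f ≤ c) :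
    restrict e f (evolve Φ σ a b c d t x) = restrict e f x := by
  funext i
  have hi := mem_Ico.1 i.2
  unfold restrict
  split_ifs with h'
  · unfold evolve
    rw [dif_neg]
    rw [mem_Ico]
    simp only
    omega
  · rfl

lemma restrict_evolve (x : Phase a b) (h₁ : c ≤ e) (h₂ : f ≤ d) (h₃ : a ≤ c) (h₄ : d ≤ b) :
    restrict e f (evolve Φ σ a b c d t x) = restrict e f (flow Φ σ c d t (restrict c d x)) := by
  funext i
  have hi := mem_Ico.1 i.2
  have hcd : (i : ℤ) ∈ Ico c d := mem_Ico.2 ⟨by omega, by omega⟩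
  rw [restrict_apply _ i (mem_Ico.2 ⟨by omega, by omega⟩), restrict_apply _ i hcd]
  unfold evolve
  rw [dif_pos hcd]

variable {Φ σ t}

/-- Since `S(t) = S^*(-t)` and `S^*` evaluates at time `-t`, the two signs cancel. -/
lemma group_apply (F : Phase a b → ℝ) {y : Phase a b} (h : restrict c d y ∈ Allowed σ c d) :
    group Φ σ a b c d t F y = F (evolve Φ σ a b c d t y) := by
  simp [group, groupStar, h]

end Restrict

/-! ### Alternating sums over compositions -/

section SignedSum

/-- A composition is a first block, of size `i + 1`, followed by a composition of what remains. -/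
lemma sum_composition_succ {M : Type*} [AddCommMonoid M] (n : ℕ) (F : List ℕ → M) :
    ∑ P : Composition (n + 1), F P.blocks =
      ∑ i ∈ range (n + 1), ∑ Q : Composition (n - i), F ((i + 1) :: Q.blocks) := by
  rw [Finset.sum_sigma']
  symm
  refine Finset.sum_bij (fun x hx => (⟨(x.1 + 1) :: x.2.blocks, ?_, ?_⟩ : Composition (n + 1)))
    ?_ ?_ ?_ ?_
  · intro i hi
    rcases List.mem_cons.1 hi with rfl | h
    · omega
    · exact x.2.blocks_pos h
  · have := x.2.blocks_sum
    have h2 := mem_range.1 (mem_sigma.1 hx).1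
    simp only [List.sum_cons, this]
    omega
  · exact fun _ _ => mem_univ _
  · rintro ⟨i, P⟩ hP ⟨j, Q⟩ hQ h
    simp only [Composition.mk.injEq, List.cons.injEq, add_left_inj] at h
    obtain ⟨rfl, h2⟩ := h
    have : P = Q := Composition.ext h2
    rw [this]
  · intro P _
    obtain ⟨l, hl, hs⟩ := P
    cases l with
    | nil => simp at hs
    | cons i l =>
      have hi : 0 < i := hl (by simp)
      simp only [List.sum_cons] at hs
      refine ⟨⟨i - 1, ⟨l, fun h => hl (by simp [h]), by omega⟩⟩, ?_, ?_⟩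
      · simp only [mem_sigma, mem_range, mem_univ, and_true]
        omega
      · refine Composition.ext ?_
        show (i - 1 + 1) :: l = i :: l
        rw [Nat.sub_add_cancel hi]
  · exact fun _ _ => rfl

variable {V : Type*} [AddCommGroup V] [Module ℝ V] (g : ℕ → ℕ → Module.End ℝ V)

/-- The product of operators of successive blocks of the given lengths, the first of which begins
at `a`. -/
def blockProd (a : ℕ) : List ℕ → Module.End ℝ V
  | [] => 1
  | b :: l => g a (a + b) * blockProd (a + b) l

/-- The alternating sum over all decompositions of `[a, a + n)` into successive blocks. -/
def signedSum (a n : ℕ) : Module.End ℝ V :=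
  ∑ P : Composition n, (-1 : ℝ) ^ P.blocks.length • blockProd g a P.blocks

lemma prod_ofFn_eq_blockProd (a : ℕ) (l : List ℕ) :
    (List.ofFn fun k : Fin l.length =>
      g (a + (l.take k).sum) (a + (l.take (k + 1)).sum)).prod = blockProd g a l := by
  induction l generalizing a with
  | nil => rfl
  | cons b l ih =>
    rw [blockProd, ← ih (a + b)]
    simp [List.ofFn_succ, add_assoc]

lemma signedSum_zero (a : ℕ) : signedSum g a 0 = 1 := by
  have hnil : ∀ P : Composition 0, P.blocks = [] := fun P => by
    rw [List.eq_nil_iff_forall_not_mem]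
    intro i hi
    have h1 := P.blocks_pos hi
    have h2 := List.le_sum_of_mem hi
    rw [P.blocks_sum] at h2
    omega
  have : Subsingleton (Composition 0) :=
    ⟨fun P Q => Composition.ext (by rw [hnil P, hnil Q])⟩
  rw [signedSum, Fintype.sum_subsingleton _ (⟨[], by simp, rfl⟩ : Composition 0)]
  simp [blockProd]

lemma signedSum_succ (a n : ℕ) :
    signedSum g a (n + 1) =
      -∑ i ∈ range (n + 1), g a (a + (i + 1)) * signedSum g (a + (i + 1)) (n - i) := by
  unfold signedSum
  rw [sum_composition_succ n fun l => (-1 : ℝ) ^ l.length • blockProd g a l,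
    ← Finset.sum_neg_distrib]
  refine Finset.sum_congr rfl fun i _ => ?_
  rw [Finset.mul_sum, ← Finset.sum_neg_distrib]
  refine Finset.sum_congr rfl fun Q _ => ?_
  rw [blockProd, List.length_cons, pow_succ, mul_neg_one, neg_smul, mul_smul_comm]

/-- The alternating number of compositions of `n`. -/
def altCount : ℕ → ℝ
  | 0 => 1
  | 1 => -1
  | _ => 0

/-- This is the recursion of `signedSum_succ` with every operator replaced by the identity. -/
lemma sum_altCount (n : ℕ) :
    ∑ i ∈ range (n + 1), altCount (n - i) = -altCount (n + 1) := by
  have h := Finset.sum_range_reflect altCount (n + 1)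
  simp only [Nat.add_sub_cancel] at h
  rw [h]
  cases n with
  | zero => simp [altCount]
  | succ n =>
    rw [Finset.sum_range_succ', Finset.sum_range_succ']
    simp [altCount]

end SignedSum

/-! ### Positions of the cluster elements among the particles -/

section Cut

variable {s₁ s₂ n₁ n₂ : ℕ}

lemma cut_of_le {m : ℕ} (h : m ≤ s₁ - n₁) :
    cut s₁ n₁ n₂ m = -(s₁ : ℤ) + m := by
  simp [cut, h]

lemma cut_of_lt {m : ℕ} (h : s₁ - n₁ < m) :
    cut s₁ n₁ n₂ m = -(s₁ : ℤ) + m + ((n₁ : ℤ) + n₂ - 1) := by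
  simp [cut, not_le.2 h]

/-- The step across the cluster has length `n₁ + n₂`; for an empty cluster it is zero, so
monotonicity is not strict. -/
lemma cut_mono {m m' : ℕ} (h : m ≤ m') :
    cut s₁ n₁ n₂ m ≤ cut s₁ n₁ n₂ m' := by
  unfold cut
  split_ifs <;> omega

lemma cut_total (h₁ : n₁ ≤ s₁) (h₂ : n₂ ≤ s₂) :
    cut s₁ n₁ n₂ (1 + (s₁ - n₁) + (s₂ - n₂)) = s₂ := by
  rw [cut_of_lt (by omega)]
  omega

end Cut

/-! ### Evaluation of the cumulants and of the expansion -/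

section Cumulant

variable {Φ : ℝ → ℝ} {σ : ℝ} {s₁ s₂ n₁ n₂ : ℕ} {t : ℝ}

/-- A function of the cluster `[-n₁, n₂)` evaluated at the point to which it is carried by the
dynamics of the block `[c, d)`. -/
def blockValue (Φ : ℝ → ℝ) (σ : ℝ) {n₁ n₂ : ℕ} (F : Phase (-(n₁ : ℤ)) (n₂ : ℤ) → ℝ) (t : ℝ)
    {a b : ℤ} (x : Phase a b) (c d : ℤ) : ℝ :=
  F (restrict (-(n₁ : ℤ)) n₂ (flow Φ σ c d t (restrict c d x)))

variable (Φ σ s₁ s₂ n₁ n₂ t) in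
/-- The groups of the blocks of clusters. -/
def clusterGroup (i j : ℕ) : Module.End ℝ (Phase (-(s₁ : ℤ)) (s₂ : ℤ) → ℝ) :=
  group Φ σ (-(s₁ : ℤ)) (s₂ : ℤ) (cut s₁ n₁ n₂ i) (cut s₁ n₁ n₂ j) t

lemma cumulant_eq_neg_signedSum :
    cumulant Φ σ s₁ s₂ n₁ n₂ t =
      -signedSum (clusterGroup Φ σ s₁ s₂ n₁ n₂ t) 0 (1 + (s₁ - n₁) + (s₂ - n₂)) := by
  unfold cumulant signedSum
  rw [← Finset.sum_neg_distrib]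
  refine Finset.sum_congr rfl fun P _ => ?_
  have h := prod_ofFn_eq_blockProd (clusterGroup Φ σ s₁ s₂ n₁ n₂ t) 0 P.blocks
  simp only [zero_add] at h
  have hpos : 0 < P.length := P.length_pos_of_pos (by omega)
  have hsign : (-1 : ℝ) ^ (P.length - 1) = -(-1) ^ P.blocks.length := by
    show (-1 : ℝ) ^ (P.length - 1) = -(-1) ^ P.length
    obtain ⟨m, hm⟩ := Nat.exists_eq_succ_of_ne_zero hpos.ne'
    rw [hm]
    simp [pow_succ]
  rw [← h, hsign]
  exact neg_smul (M := Module.End ℝ (Phase (-(s₁ : ℤ)) (s₂ : ℤ) → ℝ))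
    ((-1 : ℝ) ^ P.blocks.length) _

lemma restrict_cut_allowed {y : Phase (-(s₁ : ℤ)) (s₂ : ℤ)} (h₁ : n₁ ≤ s₁) (h₂ : n₂ ≤ s₂)
    {i j N : ℕ} (hN : N = 1 + (s₁ - n₁) + (s₂ - n₂)) (hj : j ≤ N)
    (hy : restrict (cut s₁ n₁ n₂ i) s₂ y ∈ Allowed σ (cut s₁ n₁ n₂ i) s₂) :
    restrict (cut s₁ n₁ n₂ i) (cut s₁ n₁ n₂ j) y ∈
      Allowed σ (cut s₁ n₁ n₂ i) (cut s₁ n₁ n₂ j) := by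
  have h : cut s₁ n₁ n₂ j ≤ s₂ := by
    have := cut_mono (s₁ := s₁) (n₁ := n₁) (n₂ := n₂) hj
    rwa [hN, cut_total h₁ h₂] at this
  have := restrict_mem_allowed hy (le_refl _) h
  rwa [restrict_restrict y le_rfl h] at this

/-- Blocks to the right of the cluster do not move it, so each product acts as the identity and only
the alternating count remains. Only the particles from `cut i` on are required to be allowed: the
blocks further left may already have moved, which can destroy the order of the whole configuration.
-/
lemma signedSum_right_of_cluster (h₁ : n₁ ≤ s₁) (h₂ : n₂ ≤ s₂) {N : ℕ}
    (hN : N = 1 + (s₁ - n₁) + (s₂ - n₂)) (F : Phase (-(n₁ : ℤ)) (n₂ : ℤ) → ℝ) (n : ℕ) :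
    ∀ (i : ℕ), i + n = N → s₁ - n₁ < i → ∀ y : Phase (-(s₁ : ℤ)) (s₂ : ℤ),
      restrict (cut s₁ n₁ n₂ i) s₂ y ∈ Allowed σ (cut s₁ n₁ n₂ i) s₂ →
      signedSum (clusterGroup Φ σ s₁ s₂ n₁ n₂ t) i n (lift (-(s₁ : ℤ)) s₂ F) y =
        altCount n * lift (-(s₁ : ℤ)) s₂ F y := by
  induction n using Nat.strong_induction_on with
  | _ n ih =>
  intro i hiN hi y hy
  cases n with
  | zero => simp [signedSum_zero, altCount]
  | succ n =>
    rw [signedSum_succ]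
    simp only [LinearMap.neg_apply, LinearMap.sum_apply, Module.End.mul_apply, Pi.neg_apply,
      Finset.sum_apply]
    have hterm : ∀ j ∈ range (n + 1), clusterGroup Φ σ s₁ s₂ n₁ n₂ t i (i + (j + 1))
        (signedSum (clusterGroup Φ σ s₁ s₂ n₁ n₂ t) (i + (j + 1)) (n - j)
          (lift (-(s₁ : ℤ)) s₂ F)) y = altCount (n - j) * lift (-(s₁ : ℤ)) s₂ F y := by
      intro j hj
      rw [mem_range] at hj
      rw [clusterGroup, group_apply _ (restrict_cut_allowed h₁ h₂ hN (by omega) hy)]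
      have hc : restrict (cut s₁ n₁ n₂ (i + (j + 1))) s₂ (evolve Φ σ (-(s₁ : ℤ)) s₂
          (cut s₁ n₁ n₂ i) (cut s₁ n₁ n₂ (i + (j + 1))) t y) =
          restrict (cut s₁ n₁ n₂ (i + (j + 1))) s₂ y :=
        restrict_evolve_of_disjoint _ _ _ _ (Or.inl le_rfl)
      rw [ih (n - j) (by omega) (i + (j + 1)) (by omega) (by omega)]
      · congr 1
        unfold lift
        rw [restrict_evolve_of_disjoint]
        right
        rw [cut_of_lt hi]
        omega
      · rw [hc]
        have hm : cut s₁ n₁ n₂ i ≤ cut s₁ n₁ n₂ (i + (j + 1)) := cut_mono (by omega)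
        have := restrict_mem_allowed hy hm le_rfl
        rwa [restrict_restrict y hm le_rfl] at this
    rw [Finset.sum_congr rfl hterm, ← Finset.sum_mul, sum_altCount]
    ring

/-- The contribution of the decompositions in which the first `i` elements are cut off. -/
def clusterTerm (Φ : ℝ → ℝ) (σ : ℝ) {s₁ s₂ n₁ n₂ : ℕ} (F : Phase (-(n₁ : ℤ)) (n₂ : ℤ) → ℝ) (t : ℝ)
    (y : Phase (-(s₁ : ℤ)) (s₂ : ℤ)) (i : ℕ) : ℝ :=
  blockValue Φ σ F t y (cut s₁ n₁ n₂ i) s₂ -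
    if n₂ < s₂ then blockValue Φ σ F t y (cut s₁ n₁ n₂ i) (s₂ - 1) else 0

lemma clusterTerm_congr {F : Phase (-(n₁ : ℤ)) (n₂ : ℤ) → ℝ} {y z : Phase (-(s₁ : ℤ)) (s₂ : ℤ)}
    {i : ℕ} (h : restrict (cut s₁ n₁ n₂ i) s₂ y = restrict (cut s₁ n₁ n₂ i) s₂ z) :
    clusterTerm Φ σ F t y i = clusterTerm Φ σ F t z i := by
  unfold clusterTerm blockValue
  have h' : restrict (cut s₁ n₁ n₂ i) (s₂ - 1) y = restrict (cut s₁ n₁ n₂ i) (s₂ - 1) z := by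
    rw [← restrict_restrict y le_rfl (show (s₂ : ℤ) - 1 ≤ s₂ by omega), h,
      restrict_restrict z le_rfl (show (s₂ : ℤ) - 1 ≤ s₂ by omega)]
  rw [h, h']

/-- Induction on the number of elements, splitting off the first block. If it ends before the
cluster, the induction hypothesis gives telescoping terms; if it contains the cluster, the rest
contributes only an `altCount`. -/
lemma signedSum_left_of_cluster (h₁ : n₁ ≤ s₁) (h₂ : n₂ ≤ s₂) {N : ℕ}
    (hN : N = 1 + (s₁ - n₁) + (s₂ - n₂)) (F : Phase (-(n₁ : ℤ)) (n₂ : ℤ) → ℝ) (n : ℕ) :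
    ∀ (i : ℕ), i + n = N → i ≤ s₁ - n₁ → ∀ y : Phase (-(s₁ : ℤ)) (s₂ : ℤ),
      restrict (cut s₁ n₁ n₂ i) s₂ y ∈ Allowed σ (cut s₁ n₁ n₂ i) s₂ →
      signedSum (clusterGroup Φ σ s₁ s₂ n₁ n₂ t) i n (lift (-(s₁ : ℤ)) s₂ F) y =
        (if i < s₁ - n₁ then clusterTerm Φ σ F t y (i + 1) else 0) - clusterTerm Φ σ F t y i := by
  induction n using Nat.strong_induction_on with
  | _ n ih =>
  intro i hiN hi y hy
  set k := s₁ - n₁ with hk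
  cases n with
  | zero => omega
  | succ n =>
    rw [signedSum_succ]
    simp only [LinearMap.neg_apply, LinearMap.sum_apply, Module.End.mul_apply, Pi.neg_apply,
      Finset.sum_apply]
    -- The first block consists of the elements `i, …, j - 1` and the cluster is element number `k`,
    -- so `j ≤ k` means that the cluster lies in a later block.
    let U : ℕ → ℝ := fun j => if j ≤ k then
        (if j < k then clusterTerm Φ σ F t y (j + 1) else 0) - clusterTerm Φ σ F t y j
      else altCount (N - j) * blockValue Φ σ F t y (cut s₁ n₁ n₂ i) (cut s₁ n₁ n₂ j)
    have hterm : ∀ j ∈ range (n + 1), clusterGroup Φ σ s₁ s₂ n₁ n₂ t i (i + (j + 1))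
        (signedSum (clusterGroup Φ σ s₁ s₂ n₁ n₂ t) (i + (j + 1)) (n - j)
          (lift (-(s₁ : ℤ)) s₂ F)) y = U (i + 1 + j) := by
      intro j hj
      rw [mem_range] at hj
      rw [clusterGroup, group_apply _ (restrict_cut_allowed h₁ h₂ hN (by omega) hy)]
      have hc : restrict (cut s₁ n₁ n₂ (i + (j + 1))) s₂ (evolve Φ σ (-(s₁ : ℤ)) s₂
          (cut s₁ n₁ n₂ i) (cut s₁ n₁ n₂ (i + (j + 1))) t y) =
          restrict (cut s₁ n₁ n₂ (i + (j + 1))) s₂ y :=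
        restrict_evolve_of_disjoint _ _ _ _ (Or.inl le_rfl)
      have hm : cut s₁ n₁ n₂ i ≤ cut s₁ n₁ n₂ (i + (j + 1)) := cut_mono (by omega)
      have hall := restrict_mem_allowed hy hm le_rfl
      rw [restrict_restrict y hm le_rfl, ← hc] at hall
      have hij : i + 1 + j = i + (j + 1) := by omega
      rw [hij]
      simp only [U]
      split_ifs with h h'
      · rw [ih (n - j) (by omega) (i + (j + 1)) (by omega) h _ hall, if_pos h',
          clusterTerm_congr hc]
        congr 1
        refine clusterTerm_congr ?_
        have hm' : cut s₁ n₁ n₂ (i + (j + 1)) ≤ cut s₁ n₁ n₂ (i + (j + 1) + 1) :=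
          cut_mono (by omega)
        exact restrict_evolve_of_disjoint _ _ _ _ (Or.inl hm')
      · rw [ih (n - j) (by omega) (i + (j + 1)) (by omega) h _ hall, if_neg h',
          clusterTerm_congr hc]
      · rw [signedSum_right_of_cluster h₁ h₂ hN F (n - j) (i + (j + 1)) (by omega) (by omega) _ hall]
        have e1 : n - j = N - (i + (j + 1)) := by omega
        rw [e1]
        congr 1
        unfold lift blockValue
        rw [restrict_evolve]
        · rw [cut_of_le hi]; omega
        · rw [cut_of_lt (by omega)]; omega
        · rw [cut_of_le hi]; omega
        · have := cut_mono (s₁ := s₁) (n₁ := n₁) (n₂ := n₂) (show i + (j + 1) ≤ N by omega)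
          rwa [hN, cut_total h₁ h₂] at this
    rw [Finset.sum_congr rfl hterm]
    have hsum : ∑ j ∈ range (n + 1), U (i + 1 + j) = ∑ j ∈ Ico (i + 1) (N + 1), U j := by
      rw [Finset.sum_Ico_eq_sum_range]
      congr 2
      omega
    rw [hsum, ← Finset.sum_Ico_consecutive U (show i + 1 ≤ k + 1 by omega)
      (show k + 1 ≤ N + 1 by omega)]
    -- The sum telescopes; `W` is set to zero beyond `k`, so only its value at `i + 1` remains.
    have hleft : ∑ j ∈ Ico (i + 1) (k + 1), U j =
        -(if i < k then clusterTerm Φ σ F t y (i + 1) else 0) := by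
      let W : ℕ → ℝ := fun j => if j ≤ k then clusterTerm Φ σ F t y j else 0
      have hUW : ∀ j ∈ Ico (i + 1) (k + 1), U j = W (j + 1) - W j := by
        intro j hj
        rw [mem_Ico] at hj
        have : j ≤ k := by omega
        simp only [U, W, if_pos this]
        rfl
      rw [Finset.sum_congr rfl hUW, Finset.sum_Ico_eq_sum_range]
      have := Finset.sum_range_sub (fun j => W (i + 1 + j)) (k + 1 - (i + 1))
      simp only [add_assoc] at this ⊢
      rw [this]
      have e2 : i + (1 + (k + 1 - (i + 1))) = k + 1 := by omega
      have e3 : ¬ k + 1 ≤ k := by omega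
      simp only [W, e2, e3, if_false, zero_sub, add_zero]
      rfl
    -- Only `j = N` and `j = N - 1` have a nonzero `altCount`, and the latter occurs exactly when
    -- some particle lies to the right of the cluster, that is, when `n₂ < s₂`.
    have hright : ∑ j ∈ Ico (k + 1) (N + 1), U j = clusterTerm Φ σ F t y i := by
      rw [Finset.sum_Ico_succ_top (by omega)]
      have hUN : U N = blockValue Φ σ F t y (cut s₁ n₁ n₂ i) s₂ := by
        have : ¬ N ≤ k := by omega
        simp only [U, this, if_false, Nat.sub_self, altCount, one_mul]
        rw [hN, cut_total h₁ h₂]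
      rw [hUN, clusterTerm]
      split_ifs with h
      · obtain ⟨N', rfl⟩ : ∃ N', N = N' + 1 := ⟨N - 1, by omega⟩
        rw [Finset.sum_Ico_succ_top (by omega), Finset.sum_eq_zero]
        · have h3 : ¬ N' ≤ k := by omega
          have h4 : cut s₁ n₁ n₂ N' = s₂ - 1 := by
            rw [cut_of_lt (by omega)]
            omega
          simp only [U, h3, if_false, Nat.add_sub_cancel_left, altCount, h4]
          ring
        · intro j hj
          rw [mem_Ico] at hj
          have h3 : ¬ j ≤ k := by omega
          obtain ⟨l, hl⟩ : ∃ l, N' + 1 - j = l + 2 := ⟨N' + 1 - j - 2, by omega⟩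
          simp only [U, h3, if_false, hl, altCount, zero_mul]
      · have h3 : N = k + 1 := by omega
        simp [h3]
    rw [hleft, hright]
    ring

/-- Cumulants acting on functions of the cluster, at allowed phase points. -/
lemma cumulant_lift_apply (h₁ : n₁ ≤ s₁) (h₂ : n₂ ≤ s₂) (F : Phase (-(n₁ : ℤ)) (n₂ : ℤ) → ℝ)
    {x : Phase (-(s₁ : ℤ)) (s₂ : ℤ)} (hx : x ∈ Allowed σ (-(s₁ : ℤ)) s₂) :
    cumulant Φ σ s₁ s₂ n₁ n₂ t (lift (-(s₁ : ℤ)) s₂ F) x =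
      (blockValue Φ σ F t x (-s₁) s₂ -
        if n₂ < s₂ then blockValue Φ σ F t x (-s₁) (s₂ - 1) else 0) -
      if n₁ < s₁ then (blockValue Φ σ F t x (-s₁ + 1) s₂ -
        if n₂ < s₂ then blockValue Φ σ F t x (-s₁ + 1) (s₂ - 1) else 0) else 0 := by
  have hc0 : cut s₁ n₁ n₂ 0 = -(s₁ : ℤ) := by simp [cut]
  rw [cumulant_eq_neg_signedSum]
  simp only [LinearMap.neg_apply, Pi.neg_apply]
  rw [signedSum_left_of_cluster h₁ h₂ rfl F _ 0 (by omega) (by omega) x (by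
    rw [hc0]; simpa using hx)]
  have hT0 : clusterTerm Φ σ F t x 0 = blockValue Φ σ F t x (-s₁) s₂ -
        if n₂ < s₂ then blockValue Φ σ F t x (-s₁) (s₂ - 1) else 0 := by
    rw [clusterTerm, hc0]
  rw [hT0, neg_sub]
  congr 1
  have : (0 < s₁ - n₁) = (n₁ < s₁) := by simp
  simp only [this]
  split_ifs with h h'
  · have hc1 : cut s₁ n₁ n₂ (0 + 1) = -(s₁ : ℤ) + 1 := by
      rw [cut_of_le (by omega)]; simp
    rw [clusterTerm, hc1, if_pos h']
  · have hc1 : cut s₁ n₁ n₂ (0 + 1) = -(s₁ : ℤ) + 1 := by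
      rw [cut_of_le (by omega)]; simp
    rw [clusterTerm, hc1, if_neg h']
  · rfl

/-- The sums of all members of a double sequence up to the given one, transported by the
Hamiltonian flow. -/
def transported (Φ : ℝ → ℝ) (σ : ℝ) (B₀ : DoubleSeq) (t : ℝ) : DoubleSeq := fun s₁ s₂ x =>
  ∑ n₁ ∈ range (s₁ + 1), ∑ n₂ ∈ range (s₂ + 1),
    B₀ n₁ n₂ (restrict (-(n₁ : ℤ)) n₂ (flow Φ σ (-(s₁ : ℤ)) s₂ t x))

lemma sum_range_ite_lt (s : ℕ) (h : ℕ → ℝ) :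
    (∑ n ∈ range (s + 1), if n < s then h n else 0) = ∑ n ∈ range s, h n := by
  rw [Finset.sum_range_succ, if_neg (lt_irrefl s), add_zero]
  exact Finset.sum_congr rfl fun n hn => if_pos (mem_range.1 hn)

/-- Each of the four terms of a cumulant is summed over the clusters inside its block; the
conditions `n₁ < s₁` and `n₂ < s₂` shorten the ranges to those of the sequences shifted by the
creation operators. -/
lemma expansion_eq (Φ : ℝ → ℝ) (σ : ℝ) (B₀ : DoubleSeq) (t : ℝ) (s₁ s₂ : ℕ)
    {x : Phase (-(s₁ : ℤ)) (s₂ : ℤ)} (hx : x ∈ Allowed σ (-(s₁ : ℤ)) s₂) :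
    expansion Φ σ B₀ t s₁ s₂ x =
      transported Φ σ B₀ t s₁ s₂ x - createLeft (transported Φ σ B₀ t) s₁ s₂ x
        - createRight (transported Φ σ B₀ t) s₁ s₂ x
        + createLeft (createRight (transported Φ σ B₀ t)) s₁ s₂ x := by
  let S : ℕ → ℕ → ℤ → ℤ → ℝ := fun n₁ n₂ c d => blockValue Φ σ (B₀ n₁ n₂) t x c d
  have hleft : createLeft (transported Φ σ B₀ t) s₁ s₂ x =
      ∑ n₁ ∈ range s₁, ∑ n₂ ∈ range (s₂ + 1), S n₁ n₂ (-s₁ + 1) s₂ := by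
    cases s₁ with
    | zero => simp [createLeft]
    | succ m =>
      have h : -((m + 1 : ℕ) : ℤ) + 1 = -m := by push_cast; ring
      rw [h]
      rfl
  have hright : createRight (transported Φ σ B₀ t) s₁ s₂ x =
      ∑ n₁ ∈ range (s₁ + 1), ∑ n₂ ∈ range s₂, S n₁ n₂ (-s₁) (s₂ - 1) := by
    cases s₂ with
    | zero => simp [createRight]
    | succ m =>
      have h : ((m + 1 : ℕ) : ℤ) - 1 = m := by push_cast; ring
      rw [h]
      rfl
  have hboth : createLeft (createRight (transported Φ σ B₀ t)) s₁ s₂ x =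
      ∑ n₁ ∈ range s₁, ∑ n₂ ∈ range s₂, S n₁ n₂ (-s₁ + 1) (s₂ - 1) := by
    cases s₁ with
    | zero => simp [createLeft]
    | succ l =>
      have hl : -((l + 1 : ℕ) : ℤ) + 1 = -l := by push_cast; ring
      cases s₂ with
      | zero => simp [createLeft, createRight, lift]
      | succ m =>
        have h : ((m + 1 : ℕ) : ℤ) - 1 = m := by push_cast; ring
        rw [h, hl]
        show transported Φ σ B₀ t l m (restrict _ _ (restrict _ _ x)) = _
        rw [restrict_restrict x le_rfl (by push_cast; omega)]
        rfl
  have hmain : transported Φ σ B₀ t s₁ s₂ x =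
      ∑ n₁ ∈ range (s₁ + 1), ∑ n₂ ∈ range (s₂ + 1), S n₁ n₂ (-s₁) s₂ := by
    simp only [S, blockValue, restrict_self]
    rfl
  rw [hleft, hright, hboth, hmain, expansion, Set.indicator_of_mem hx]
  have hcum : ∀ n₁ ∈ range (s₁ + 1), ∀ n₂ ∈ range (s₂ + 1),
      cumulant Φ σ s₁ s₂ n₁ n₂ t (lift (-(s₁ : ℤ)) s₂ (B₀ n₁ n₂)) x =
      S n₁ n₂ (-s₁) s₂ - (if n₂ < s₂ then S n₁ n₂ (-s₁) (s₂ - 1) else 0) -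
      ((if n₁ < s₁ then S n₁ n₂ (-s₁ + 1) s₂ else 0) -
        if n₁ < s₁ then (if n₂ < s₂ then S n₁ n₂ (-s₁ + 1) (s₂ - 1) else 0) else 0) := by
    intro n₁ h₁ n₂ h₂
    rw [mem_range] at h₁ h₂
    rw [cumulant_lift_apply (by omega) (by omega) _ hx]
    split_ifs <;> simp [S]
  rw [Finset.sum_congr rfl fun n₁ h₁ => Finset.sum_congr rfl fun n₂ h₂ => hcum n₁ h₁ n₂ h₂]
  simp only [Finset.sum_sub_distrib, sum_range_ite_lt]
  have h1 : ∑ n₁ ∈ range (s₁ + 1), ∑ n₂ ∈ range (s₂ + 1),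
      (if n₁ < s₁ then S n₁ n₂ (-s₁ + 1) s₂ else 0) =
      ∑ n₁ ∈ range s₁, ∑ n₂ ∈ range (s₂ + 1), S n₁ n₂ (-s₁ + 1) s₂ := by
    rw [← sum_range_ite_lt s₁]
    refine Finset.sum_congr rfl fun n₁ _ => ?_
    split_ifs <;> simp
  have h2 : ∑ n₁ ∈ range (s₁ + 1), ∑ n₂ ∈ range (s₂ + 1),
      (if n₁ < s₁ then (if n₂ < s₂ then S n₁ n₂ (-s₁ + 1) (s₂ - 1) else 0) else 0) =
      ∑ n₁ ∈ range s₁, ∑ n₂ ∈ range s₂, S n₁ n₂ (-s₁ + 1) (s₂ - 1) := by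
    rw [← sum_range_ite_lt s₁]
    refine Finset.sum_congr rfl fun n₁ _ => ?_
    split_ifs
    · exact sum_range_ite_lt s₂ _
    · simp
  rw [h1, h2]
  ring

end Cumulant

end TopologicalParticles

end

noncomputable section

namespace TopologicalParticles

open Set Filter Topology

/-! ### The Liouville operator on functions of a block -/

section Liouville

variable {a b c d : ℤ} {Φ : ℝ → ℝ}

lemma liouvilleStarInt_coe (f : Phase a b → ℝ) (x : Phase a b) (i : ↥(Finset.Ico a b)) :
    liouvilleStarInt Φ a b i f x = ∑ j : ↥(Finset.Ico a b), if (j : ℤ) = i + 1 then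
      deriv Φ ((x i).1 - (x j).1) * (dp i f x - dp j f x) else 0 := by
  rw [← dite_succ_eq_sum i fun j => deriv Φ ((x i).1 - (x j).1) * (dp i f x - dp j f x)]
  unfold liouvilleStarInt
  by_cases h : (i : ℤ) + 1 ∈ Finset.Ico a b
  · rw [dif_pos ⟨i.2, h⟩, dif_pos h]
  · rw [dif_neg (fun h' => h h'.2), dif_neg h]

lemma apply_eq_sum_dq_dp (f : Phase a b → ℝ) (x v : Phase a b) :
    fderiv ℝ f x v = ∑ i, ((v i).1 * dq i f x + (v i).2 * dp i f x) := by
  have hv : v = ∑ i, ((v i).1 • (Pi.single i ((1 : ℝ), (0 : ℝ)) : Phase a b) +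
      (v i).2 • (Pi.single i ((0 : ℝ), (1 : ℝ)) : Phase a b)) := by
    conv_lhs => rw [← Finset.univ_sum_single v]
    refine Finset.sum_congr rfl fun i _ => ?_
    rw [← Pi.single_smul, ← Pi.single_smul, ← Pi.single_add]
    simp
  conv_lhs => rw [hv]
  simp [map_sum, dq, dp]

/-- The Liouville operator is the derivative along the Hamiltonian vector field. -/
lemma liouville_eq_fderiv (f : Phase a b → ℝ) (x : Phase a b) :
    liouville Φ a b f x = fderiv ℝ f x (vectorField Φ x) := by
  rw [apply_eq_sum_dq_dp, Finset.sum_add_distrib]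
  unfold liouville liouvilleStar
  rw [neg_add, ← Finset.sum_neg_distrib]
  congr 1
  · simp [vectorField]
  · rw [← Finset.sum_coe_sort]
    simp_rw [liouvilleStarInt_coe, vectorField, force_eq_sum, add_mul, Finset.sum_mul]
    rw [Finset.sum_add_distrib]
    rw [Finset.sum_comm (f := fun i j : ↥(Finset.Ico a b) =>
      (if (i : ℤ) = j + 1 then deriv Φ ((x j).1 - (x i).1) else 0) * dp i f x)]
    rw [← Finset.sum_add_distrib, ← Finset.sum_neg_distrib]
    refine Finset.sum_congr rfl fun i _ => ?_
    rw [← Finset.sum_add_distrib, ← Finset.sum_neg_distrib]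
    refine Finset.sum_congr rfl fun j _ => ?_
    split_ifs <;> ring

/-- The restriction to a block as a continuous linear map. -/
def restrictCLM (a b c d : ℤ) : Phase a b →L[ℝ] Phase c d :=
  ContinuousLinearMap.pi fun i =>
    if h : (i : ℤ) ∈ Finset.Ico a b then ContinuousLinearMap.proj ⟨i, h⟩ else 0

lemma restrictCLM_apply (x : Phase a b) : restrictCLM a b c d x = restrict c d x := by
  funext i
  simp only [restrictCLM, restrict, ContinuousLinearMap.coe_pi']
  split_ifs <;> rfl

lemma lift_eq_comp (f : Phase c d → ℝ) : lift a b f = f ∘ restrictCLM a b c d := by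
  funext x
  simp [lift, restrictCLM_apply]

lemma fderiv_lift {f : Phase c d → ℝ} {x : Phase a b}
    (hf : DifferentiableAt ℝ f (restrict c d x)) (v : Phase a b) :
    fderiv ℝ (lift a b f) x v = fderiv ℝ f (restrict c d x) (restrict c d v) := by
  rw [← restrictCLM_apply x] at hf
  rw [lift_eq_comp, fderiv_comp x hf (restrictCLM a b c d).differentiableAt]
  simp [restrictCLM_apply]

lemma restrict_single_of_mem (i : ↥(Finset.Ico a b)) (h : (i : ℤ) ∈ Finset.Ico c d) (w : ℝ × ℝ) :
    restrict c d (Pi.single i w : Phase a b) = Pi.single ⟨i, h⟩ w := by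
  funext j
  unfold restrict
  by_cases hj : (j : ℤ) = i
  · have e : j = ⟨i, h⟩ := Subtype.ext hj
    subst e
    rw [dif_pos i.2]
    simp
  · have e : j ≠ ⟨i, h⟩ := fun e => hj (congrArg Subtype.val e)
    rw [Pi.single_eq_of_ne e]
    split_ifs with h'
    · exact Pi.single_eq_of_ne (fun e => hj (congrArg Subtype.val e)) _
    · rfl

lemma restrict_single_of_notMem (i : ↥(Finset.Ico a b)) (h : (i : ℤ) ∉ Finset.Ico c d)
    (w : ℝ × ℝ) : restrict c d (Pi.single i w : Phase a b) = 0 := by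
  funext j
  unfold restrict
  split_ifs with h'
  · exact Pi.single_eq_of_ne (fun e => h (by rw [← congrArg Subtype.val e]; exact j.2)) _
  · rfl

lemma dq_lift_of_mem {f : Phase c d → ℝ} {x : Phase a b}
    (hf : DifferentiableAt ℝ f (restrict c d x)) (i : ↥(Finset.Ico a b))
    (h : (i : ℤ) ∈ Finset.Ico c d) :
    dq i (lift a b f) x = dq ⟨i, h⟩ f (restrict c d x) := by
  rw [dq, fderiv_lift hf, restrict_single_of_mem i h, dq]

lemma dp_lift_of_mem {f : Phase c d → ℝ} {x : Phase a b}
    (hf : DifferentiableAt ℝ f (restrict c d x)) (i : ↥(Finset.Ico a b))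
    (h : (i : ℤ) ∈ Finset.Ico c d) :
    dp i (lift a b f) x = dp ⟨i, h⟩ f (restrict c d x) := by
  rw [dp, fderiv_lift hf, restrict_single_of_mem i h, dp]

lemma dq_lift_of_notMem {f : Phase c d → ℝ} {x : Phase a b}
    (hf : DifferentiableAt ℝ f (restrict c d x)) (i : ↥(Finset.Ico a b))
    (h : (i : ℤ) ∉ Finset.Ico c d) : dq i (lift a b f) x = 0 := by
  rw [dq, fderiv_lift hf, restrict_single_of_notMem i h, map_zero]

lemma dp_lift_of_notMem {f : Phase c d → ℝ} {x : Phase a b}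
    (hf : DifferentiableAt ℝ f (restrict c d x)) (i : ↥(Finset.Ico a b))
    (h : (i : ℤ) ∉ Finset.Ico c d) : dp i (lift a b f) x = 0 := by
  rw [dp, fderiv_lift hf, restrict_single_of_notMem i h, map_zero]

lemma liouvilleStarInt_lift_of_notMem {f : Phase c d → ℝ} {x : Phase a b}
    (hf : DifferentiableAt ℝ f (restrict c d x)) {j : ℤ} (h₁ : j ∉ Finset.Ico c d)
    (h₂ : j + 1 ∉ Finset.Ico c d) : liouvilleStarInt Φ a b j (lift a b f) x = 0 := by
  unfold liouvilleStarInt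
  split_ifs with h
  · rw [dp_lift_of_notMem hf _ h₁, dp_lift_of_notMem hf _ h₂]
    simp
  · rfl

lemma liouvilleStarInt_lift_of_mem {f : Phase c d → ℝ} {x : Phase a b}
    (hf : DifferentiableAt ℝ f (restrict c d x)) (hac : a ≤ c) (hdb : d ≤ b) {j : ℤ}
    (h₁ : c ≤ j) (h₂ : j + 1 < d) :
    liouvilleStarInt Φ a b j (lift a b f) x = liouvilleStarInt Φ c d j f (restrict c d x) := by
  have m₁ : j ∈ Finset.Ico c d := Finset.mem_Ico.2 ⟨h₁, by omega⟩
  have m₂ : j + 1 ∈ Finset.Ico c d := Finset.mem_Ico.2 ⟨by omega, h₂⟩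
  have m₃ : j ∈ Finset.Ico a b := Finset.mem_Ico.2 ⟨by omega, by omega⟩
  have m₄ : j + 1 ∈ Finset.Ico a b := Finset.mem_Ico.2 ⟨by omega, by omega⟩
  unfold liouvilleStarInt
  rw [dif_pos ⟨m₃, m₄⟩, dif_pos ⟨m₁, m₂⟩, dp_lift_of_mem hf _ m₁, dp_lift_of_mem hf _ m₂,
    restrict_apply x ⟨j, m₁⟩ m₃, restrict_apply x ⟨j + 1, m₂⟩ m₄]

lemma liouvilleStarInt_of_notMem {f : Phase a b → ℝ} {x : Phase a b} {j : ℤ}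
    (h : ¬ (a ≤ j ∧ j + 1 < b)) : liouvilleStarInt Φ a b j f x = 0 := by
  unfold liouvilleStarInt
  rw [dif_neg]
  rw [Finset.mem_Ico, Finset.mem_Ico]
  omega

lemma sum_Ico_eq_sum_Ico_of_support {G : ℤ → ℝ} {a b c d : ℤ}
    (h₁ : ∀ j, j ∉ Finset.Ico a b → G j = 0) (h₂ : ∀ j, j ∉ Finset.Ico c d → G j = 0) :
    ∑ j ∈ Finset.Ico a b, G j = ∑ j ∈ Finset.Ico c d, G j := by
  rw [← Finset.sum_subset (Finset.inter_subset_left (s₁ := Finset.Ico a b) (s₂ := Finset.Ico c d)),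
    ← Finset.sum_subset (Finset.inter_subset_right (s₁ := Finset.Ico a b) (s₂ := Finset.Ico c d))]
  · exact fun j hj hj' => h₁ j fun h => hj' (Finset.mem_inter.2 ⟨h, hj⟩)
  · exact fun j hj hj' => h₂ j fun h => hj' (Finset.mem_inter.2 ⟨hj, h⟩)

/-- The Liouville operator on functions of the particles of a block: besides the Liouville operator
of the block only the interactions with the two neighbours of the block remain. -/
lemma liouville_lift {f : Phase c d → ℝ} {x : Phase a b}
    (hf : DifferentiableAt ℝ f (restrict c d x)) (hac : a ≤ c) (hdb : d ≤ b) :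
    liouville Φ a b (lift a b f) x = liouville Φ c d f (restrict c d x)
      + liouvilleInt Φ a b (c - 1) (lift a b f) x + liouvilleInt Φ a b (d - 1) (lift a b f) x := by
  have hkin : ∑ i : ↥(Finset.Ico a b), -((x i).2 * dq i (lift a b f) x) =
      ∑ i : ↥(Finset.Ico c d), -((restrict c d x i).2 * dq i f (restrict c d x)) := by
    symm
    have hmem : ∀ i : ↥(Finset.Ico c d), (i : ℤ) ∈ Finset.Ico a b := fun i => by
      have := Finset.mem_Ico.1 i.2
      exact Finset.mem_Ico.2 ⟨by omega, by omega⟩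
    refine Finset.sum_of_injOn (fun i => (⟨i, hmem i⟩ : ↥(Finset.Ico a b))) ?_ ?_ ?_ ?_
    · intro i _ j _ h
      exact Subtype.ext (Subtype.mk.inj h)
    · exact fun _ _ => by simp
    · intro i _ hi
      rw [dq_lift_of_notMem hf i, mul_zero, neg_zero]
      intro h
      exact hi ⟨⟨i, h⟩, by simp, rfl⟩
    · intro i _
      rw [dq_lift_of_mem hf ⟨i, hmem i⟩ i.2, restrict_apply x i (hmem i)]
  have hint : ∑ j ∈ Finset.Ico a b, liouvilleStarInt Φ a b j (lift a b f) x =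
      (∑ j ∈ Finset.Ico c d, liouvilleStarInt Φ c d j f (restrict c d x))
        + liouvilleStarInt Φ a b (c - 1) (lift a b f) x
        + liouvilleStarInt Φ a b (d - 1) (lift a b f) x := by
    -- For an empty block the function is constant and all interaction terms vanish.
    rcases le_or_gt d c with h | h
    · have h0 : ∀ j, liouvilleStarInt Φ a b j (lift a b f) x = 0 := fun j =>
        liouvilleStarInt_lift_of_notMem hf (by rw [Finset.mem_Ico]; omega)
          (by rw [Finset.mem_Ico]; omega)
      simp [h0, Finset.Ico_eq_empty (not_lt.2 h)]
    -- Only pairs `(j, j + 1)` meeting the block contribute, that is, `c - 1 ≤ j < d`; the extreme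
    -- values of `j` are the two boundary pairs, which vanish when the neighbour is missing.
    · rw [sum_Ico_eq_sum_Ico_of_support (c := c - 1) (d := d)]
      · have e1 : Finset.Ico (c - 1) d = insert (c - 1) (insert (d - 1) (Finset.Ico c (d - 1))) := by
          ext j; simp only [Finset.mem_Ico, Finset.mem_insert]; omega
        have e2 : Finset.Ico c d = insert (d - 1) (Finset.Ico c (d - 1)) := by
          ext j; simp only [Finset.mem_Ico, Finset.mem_insert]; omega
        rw [e1, e2, Finset.sum_insert (by simp only [Finset.mem_Ico, Finset.mem_insert]; omega),
          Finset.sum_insert (by simp), Finset.sum_insert (by simp),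
          liouvilleStarInt_of_notMem (a := c) (b := d) (j := d - 1) (by omega)]
        have e3 : ∑ j ∈ Finset.Ico c (d - 1), liouvilleStarInt Φ a b j (lift a b f) x =
            ∑ j ∈ Finset.Ico c (d - 1), liouvilleStarInt Φ c d j f (restrict c d x) :=
          Finset.sum_congr rfl fun j hj => by
            rw [Finset.mem_Ico] at hj
            exact liouvilleStarInt_lift_of_mem hf hac hdb hj.1 (by omega)
        rw [e3]
        ring
      · intro j hj
        exact liouvilleStarInt_of_notMem (by rw [Finset.mem_Ico] at hj; omega)
      · intro j hj
        rw [Finset.mem_Ico] at hj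
        exact liouvilleStarInt_lift_of_notMem hf (by rw [Finset.mem_Ico]; omega)
          (by rw [Finset.mem_Ico]; omega)
  unfold liouville liouvilleInt liouvilleStar
  rw [hkin, hint]
  ring

end Liouville

/-! ### Creation operators, double differences and the generator of the hierarchy -/

section DoubleSequences

variable {σ : ℝ} {Φ : ℝ → ℝ}

/-- The pointwise double difference `(1 - 𝔞⁺₋)(1 - 𝔞⁺₊)`. -/
def doubleDiff (V : DoubleSeq) : DoubleSeq := fun s₁ s₂ x =>
  V s₁ s₂ x - createLeft V s₁ s₂ x - createRight V s₁ s₂ x + createLeft (createRight V) s₁ s₂ x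

lemma createRight_createLeft (V : DoubleSeq) :
    createRight (createLeft V) = createLeft (createRight V) := by
  funext s₁ s₂ x
  cases s₁ with
  | zero => cases s₂ <;> simp [createLeft, createRight, lift]
  | succ m =>
    cases s₂ with
    | zero => simp [createLeft, createRight, lift]
    | succ n =>
      show V m n (restrict _ _ (restrict _ _ x)) = V m n (restrict _ _ (restrict _ _ x))
      rw [restrict_restrict x (by push_cast; omega) le_rfl,
        restrict_restrict x le_rfl (by push_cast; omega)]

/-- Restrictions of allowed points are allowed, so identities valid at allowed points only are
inherited. -/
lemma createLeft_congr {V W : DoubleSeq}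
    (h : ∀ s₁ s₂ : ℕ, ∀ x ∈ Allowed σ (-(s₁ : ℤ)) s₂, V s₁ s₂ x = W s₁ s₂ x) (s₁ s₂ : ℕ) :
    ∀ x ∈ Allowed σ (-(s₁ : ℤ)) s₂, createLeft V s₁ s₂ x = createLeft W s₁ s₂ x := by
  intro x hx
  cases s₁ with
  | zero => rfl
  | succ m => exact h m s₂ _ (restrict_mem_allowed hx (by push_cast; omega) le_rfl)

lemma createRight_congr {V W : DoubleSeq}
    (h : ∀ s₁ s₂ : ℕ, ∀ x ∈ Allowed σ (-(s₁ : ℤ)) s₂, V s₁ s₂ x = W s₁ s₂ x) (s₁ s₂ : ℕ) :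
    ∀ x ∈ Allowed σ (-(s₁ : ℤ)) s₂, createRight V s₁ s₂ x = createRight W s₁ s₂ x := by
  intro x hx
  cases s₂ with
  | zero => rfl
  | succ m => exact h s₁ m _ (restrict_mem_allowed hx le_rfl (by push_cast; omega))

lemma createLeft_doubleDiff (V : DoubleSeq) :
    createLeft (doubleDiff V) = doubleDiff (createLeft V) := by
  funext s₁ s₂ x
  have h := congrFun (congrFun (congrArg createLeft (createRight_createLeft V)) s₁) s₂
  unfold doubleDiff
  rw [h]
  rw [createRight_createLeft]
  cases s₁ with
  | zero => simp [createLeft]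
  | succ m => rfl

lemma createRight_doubleDiff (V : DoubleSeq) :
    createRight (doubleDiff V) = doubleDiff (createRight V) := by
  funext s₁ s₂ x
  unfold doubleDiff
  rw [← createRight_createLeft (createRight V), ← createRight_createLeft V]
  cases s₂ with
  | zero => simp [createRight]
  | succ m => rfl

/-- Differentiability at all allowed phase points. -/
def IsDifferentiable (σ : ℝ) (V : DoubleSeq) : Prop :=
  ∀ s₁ s₂ : ℕ, ∀ x ∈ Allowed σ (-(s₁ : ℤ)) s₂, DifferentiableAt ℝ (V s₁ s₂) x

lemma differentiableAt_lift {a b c d : ℤ} {f : Phase c d → ℝ} {x : Phase a b}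
    (hf : DifferentiableAt ℝ f (restrict c d x)) : DifferentiableAt ℝ (lift a b f) x := by
  rw [← restrictCLM_apply x] at hf
  rw [lift_eq_comp]
  exact hf.comp x (restrictCLM a b c d).differentiableAt

lemma IsDifferentiable.createLeft {V : DoubleSeq} (hV : IsDifferentiable σ V) :
    IsDifferentiable σ (createLeft V) := by
  intro s₁ s₂ x hx
  cases s₁ with
  | zero => exact differentiableAt_const _
  | succ m =>
    exact differentiableAt_lift
      (hV m s₂ _ (restrict_mem_allowed hx (by push_cast; omega) le_rfl))

lemma IsDifferentiable.createRight {V : DoubleSeq} (hV : IsDifferentiable σ V) :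
    IsDifferentiable σ (createRight V) := by
  intro s₁ s₂ x hx
  cases s₂ with
  | zero => exact differentiableAt_const _
  | succ m =>
    exact differentiableAt_lift
      (hV s₁ m _ (restrict_mem_allowed hx le_rfl (by push_cast; omega)))

lemma fderiv_doubleDiff {V : DoubleSeq} (hV : IsDifferentiable σ V) {s₁ s₂ : ℕ}
    {x : Phase (-(s₁ : ℤ)) (s₂ : ℤ)} (hx : x ∈ Allowed σ (-(s₁ : ℤ)) s₂) :
    fderiv ℝ (doubleDiff V s₁ s₂) x = fderiv ℝ (V s₁ s₂) x - fderiv ℝ (createLeft V s₁ s₂) x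
      - fderiv ℝ (createRight V s₁ s₂) x + fderiv ℝ (createLeft (createRight V) s₁ s₂) x := by
  have h1 := (hV s₁ s₂ x hx).hasFDerivAt
  have h2 := (hV.createLeft s₁ s₂ x hx).hasFDerivAt
  have h3 := (hV.createRight s₁ s₂ x hx).hasFDerivAt
  have h4 := (hV.createRight.createLeft s₁ s₂ x hx).hasFDerivAt
  exact (((h1.sub h2).sub h3).add h4).fderiv

lemma liouville_doubleDiff {V : DoubleSeq} (hV : IsDifferentiable σ V) {s₁ s₂ : ℕ}
    {x : Phase (-(s₁ : ℤ)) (s₂ : ℤ)} (hx : x ∈ Allowed σ (-(s₁ : ℤ)) s₂) :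
    liouville Φ (-(s₁ : ℤ)) s₂ (doubleDiff V s₁ s₂) x =
      liouville Φ (-(s₁ : ℤ)) s₂ (V s₁ s₂) x - liouville Φ (-(s₁ : ℤ)) s₂ (createLeft V s₁ s₂) x
      - liouville Φ (-(s₁ : ℤ)) s₂ (createRight V s₁ s₂) x
      + liouville Φ (-(s₁ : ℤ)) s₂ (createLeft (createRight V) s₁ s₂) x := by
  simp only [liouville_eq_fderiv, fderiv_doubleDiff hV hx]
  rfl

lemma liouvilleInt_doubleDiff {V : DoubleSeq} (hV : IsDifferentiable σ V) {s₁ s₂ : ℕ}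
    {x : Phase (-(s₁ : ℤ)) (s₂ : ℤ)} (hx : x ∈ Allowed σ (-(s₁ : ℤ)) s₂) (j : ℤ) :
    liouvilleInt Φ (-(s₁ : ℤ)) s₂ j (doubleDiff V s₁ s₂) x =
      liouvilleInt Φ (-(s₁ : ℤ)) s₂ j (V s₁ s₂) x
      - liouvilleInt Φ (-(s₁ : ℤ)) s₂ j (createLeft V s₁ s₂) x
      - liouvilleInt Φ (-(s₁ : ℤ)) s₂ j (createRight V s₁ s₂) x
      + liouvilleInt Φ (-(s₁ : ℤ)) s₂ j (createLeft (createRight V) s₁ s₂) x := by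
  unfold liouvilleInt liouvilleStarInt dp
  split_ifs with h
  · rw [fderiv_doubleDiff hV hx]
    simp only [add_apply, sub_apply]
    ring
  · ring

lemma liouvilleStarInt_zero {a b : ℤ} (j : ℤ) (x : Phase a b) :
    liouvilleStarInt Φ a b j (fun _ => 0) x = 0 := by
  unfold liouvilleStarInt dp
  split_ifs <;> simp

lemma liouville_zero {a b : ℤ} (x : Phase a b) : liouville Φ a b (fun _ => 0) x = 0 := by
  rw [liouville_eq_fderiv]
  simp

/-- The function depends on neither of the two leftmost particles, whose momenta are the only ones
differentiated. -/
lemma liouvilleInt_createLeft_createLeft {V : DoubleSeq} (hV : IsDifferentiable σ V) {s₁ s₂ : ℕ}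
    {x : Phase (-(s₁ : ℤ)) (s₂ : ℤ)} (hx : x ∈ Allowed σ (-(s₁ : ℤ)) s₂) :
    liouvilleInt Φ (-(s₁ : ℤ)) s₂ (-s₁) (createLeft (createLeft V) s₁ s₂) x = 0 := by
  unfold liouvilleInt
  rw [neg_eq_zero]
  match s₁, x, hx with
  | 0, x, _ => exact liouvilleStarInt_zero _ x
  | 1, x, _ => exact liouvilleStarInt_zero _ x
  | m + 2, x, hx =>
    have h : createLeft (createLeft V) (m + 2) s₂ =
        lift (-((m + 2 : ℕ) : ℤ)) s₂ (V m s₂) := by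
      funext y
      show V m s₂ (restrict _ _ (restrict _ _ y)) = V m s₂ (restrict _ _ y)
      rw [restrict_restrict y (by push_cast; omega) le_rfl]
    rw [h]
    refine liouvilleStarInt_lift_of_notMem
      (hV m s₂ _ (restrict_mem_allowed hx (by push_cast; omega) le_rfl)) ?_ ?_ <;>
    · rw [Finset.mem_Ico]; push_cast; omega

lemma liouvilleInt_createRight_createRight {V : DoubleSeq} (hV : IsDifferentiable σ V)
    {s₁ s₂ : ℕ} {x : Phase (-(s₁ : ℤ)) (s₂ : ℤ)} (hx : x ∈ Allowed σ (-(s₁ : ℤ)) s₂) :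
    liouvilleInt Φ (-(s₁ : ℤ)) s₂ (s₂ - 2) (createRight (createRight V) s₁ s₂) x = 0 := by
  unfold liouvilleInt
  rw [neg_eq_zero]
  match s₂, x, hx with
  | 0, x, _ => exact liouvilleStarInt_zero _ x
  | 1, x, _ => exact liouvilleStarInt_zero _ x
  | m + 2, x, hx =>
    have h : createRight (createRight V) s₁ (m + 2) =
        lift (-(s₁ : ℤ)) ((m + 2 : ℕ) : ℤ) (V s₁ m) := by
      funext y
      show V s₁ m (restrict _ _ (restrict _ _ y)) = V s₁ m (restrict _ _ y)
      rw [restrict_restrict y le_rfl (by push_cast; omega)]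
    rw [h]
    refine liouvilleStarInt_lift_of_notMem
      (hV s₁ m _ (restrict_mem_allowed hx le_rfl (by push_cast; omega))) ?_ ?_ <;>
    · rw [Finset.mem_Ico]; push_cast; omega

/-- The double sequence of the functions `L_{s₁+s₂} V_{s₁+s₂}`. -/
def liouvilleSeq (Φ : ℝ → ℝ) (V : DoubleSeq) : DoubleSeq := fun s₁ s₂ =>
  liouville Φ (-(s₁ : ℤ)) s₂ (V s₁ s₂)

/-- Of the two boundary interactions of the block without the leftmost particle only the one on the
left survives: there is no particle beyond the right end. -/
lemma liouville_createLeft {V : DoubleSeq} (hV : IsDifferentiable σ V) {s₁ s₂ : ℕ}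
    {x : Phase (-(s₁ : ℤ)) (s₂ : ℤ)} (hx : x ∈ Allowed σ (-(s₁ : ℤ)) s₂) :
    liouville Φ (-(s₁ : ℤ)) s₂ (createLeft V s₁ s₂) x = createLeft (liouvilleSeq Φ V) s₁ s₂ x
      + liouvilleInt Φ (-(s₁ : ℤ)) s₂ (-s₁) (createLeft V s₁ s₂) x := by
  cases s₁ with
  | zero =>
    show liouville Φ _ _ (fun _ => 0) x = 0 + -liouvilleStarInt Φ _ _ _ (fun _ => 0) x
    rw [liouville_zero, liouvilleStarInt_zero]
    simp
  | succ m =>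
    have hm : -((m + 1 : ℕ) : ℤ) ≤ -(m : ℤ) := by push_cast; omega
    have h := liouville_lift (Φ := Φ) (hV m s₂ _ (restrict_mem_allowed hx hm le_rfl)) hm le_rfl
    have e1 : -(m : ℤ) - 1 = -((m + 1 : ℕ) : ℤ) := by push_cast; ring
    have e2 : liouvilleInt Φ (-((m + 1 : ℕ) : ℤ)) s₂ (s₂ - 1)
        (lift (-((m + 1 : ℕ) : ℤ)) s₂ (V m s₂)) x = 0 := by
      unfold liouvilleInt
      rw [liouvilleStarInt_of_notMem (by omega), neg_zero]
    rw [e1, e2, add_zero] at h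
    exact h

lemma liouville_createRight {V : DoubleSeq} (hV : IsDifferentiable σ V) {s₁ s₂ : ℕ}
    {x : Phase (-(s₁ : ℤ)) (s₂ : ℤ)} (hx : x ∈ Allowed σ (-(s₁ : ℤ)) s₂) :
    liouville Φ (-(s₁ : ℤ)) s₂ (createRight V s₁ s₂) x = createRight (liouvilleSeq Φ V) s₁ s₂ x
      + liouvilleInt Φ (-(s₁ : ℤ)) s₂ (s₂ - 2) (createRight V s₁ s₂) x := by
  cases s₂ with
  | zero =>
    show liouville Φ _ _ (fun _ => 0) x = 0 + -liouvilleStarInt Φ _ _ _ (fun _ => 0) x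
    rw [liouville_zero, liouvilleStarInt_zero]
    simp
  | succ m =>
    have hm : (m : ℤ) ≤ ((m + 1 : ℕ) : ℤ) := by push_cast; omega
    have h := liouville_lift (Φ := Φ) (hV s₁ m _ (restrict_mem_allowed hx le_rfl hm)) le_rfl hm
    have e1 : (m : ℤ) - 1 = ((m + 1 : ℕ) : ℤ) - 2 := by push_cast; ring
    have e2 : liouvilleInt Φ (-(s₁ : ℤ)) ((m + 1 : ℕ) : ℤ) (-s₁ - 1)
        (lift (-(s₁ : ℤ)) ((m + 1 : ℕ) : ℤ) (V s₁ m)) x = 0 := by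
      unfold liouvilleInt
      rw [liouvilleStarInt_of_notMem (by omega), neg_zero]
    rw [e1, e2, add_zero] at h
    exact h

/-- The generator of the hierarchy is conjugate, by the double difference, to the diagonal
generator with the Liouville operators as entries. -/
lemma hierarchy_doubleDiff {V : DoubleSeq} (hV : IsDifferentiable σ V) {s₁ s₂ : ℕ}
    {x : Phase (-(s₁ : ℤ)) (s₂ : ℤ)} (hx : x ∈ Allowed σ (-(s₁ : ℤ)) s₂) :
    liouville Φ (-(s₁ : ℤ)) s₂ (doubleDiff V s₁ s₂) x
      + liouvilleInt Φ (-(s₁ : ℤ)) s₂ (-s₁) (createLeft (doubleDiff V) s₁ s₂) x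
      + liouvilleInt Φ (-(s₁ : ℤ)) s₂ (s₂ - 2) (createRight (doubleDiff V) s₁ s₂) x =
      doubleDiff (liouvilleSeq Φ V) s₁ s₂ x := by
  have hb : liouville Φ (-(s₁ : ℤ)) s₂ (createLeft (createRight V) s₁ s₂) x =
      createLeft (createRight (liouvilleSeq Φ V)) s₁ s₂ x
      + liouvilleInt Φ (-(s₁ : ℤ)) s₂ (-s₁) (createLeft (createRight V) s₁ s₂) x
      + liouvilleInt Φ (-(s₁ : ℤ)) s₂ (s₂ - 2) (createLeft (createRight V) s₁ s₂) x := by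
    have h0 : ∀ (s₁ s₂ : ℕ) (x : Phase (-(s₁ : ℤ)) (s₂ : ℤ))
        {f : Phase (-(s₁ : ℤ)) (s₂ : ℤ) → ℝ}, f = (fun _ => 0) →
        liouville Φ (-(s₁ : ℤ)) s₂ f x = 0 + liouvilleInt Φ (-(s₁ : ℤ)) s₂ (-s₁) f x
          + liouvilleInt Φ (-(s₁ : ℤ)) s₂ (s₂ - 2) f x := by
      rintro s₁ s₂ x _ rfl
      unfold liouvilleInt
      rw [liouville_zero, liouvilleStarInt_zero, liouvilleStarInt_zero]
      simp
    match s₁, s₂, x, hx with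
    | 0, m, x, _ => exact h0 0 m x rfl
    | l + 1, 0, x, _ => exact h0 (l + 1) 0 x rfl
    | l + 1, m + 1, x, hx =>
      have hl : -((l + 1 : ℕ) : ℤ) ≤ -(l : ℤ) := by push_cast; omega
      have hm : (m : ℤ) ≤ ((m + 1 : ℕ) : ℤ) := by push_cast; omega
      have h := liouville_lift (Φ := Φ) (hV l m _ (restrict_mem_allowed hx hl hm)) hl hm
      have e1 : (m : ℤ) - 1 = ((m + 1 : ℕ) : ℤ) - 2 := by push_cast; ring
      have e2 : -(l : ℤ) - 1 = -((l + 1 : ℕ) : ℤ) := by push_cast; ring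
      have e3 : ∀ W : DoubleSeq, createLeft (createRight W) (l + 1) (m + 1) =
          lift (-((l + 1 : ℕ) : ℤ)) ((m + 1 : ℕ) : ℤ) (W l m) := by
        intro W
        funext y
        show W l m (restrict _ _ (restrict _ _ y)) = W l m (restrict _ _ y)
        rw [restrict_restrict y le_rfl hm]
      rw [e1, e2] at h
      rw [e3, e3]
      exact h
  have hr : liouvilleInt Φ (-(s₁ : ℤ)) s₂ (s₂ - 2)
      (createRight (createLeft (createRight V)) s₁ s₂) x = 0 := by
    rw [← createRight_createLeft V]
    exact liouvilleInt_createRight_createRight hV.createLeft hx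
  -- Terms with two equal creation operators are annihilated by the interaction at that end. What
  -- remains of the interactions with `𝔞⁺₋ V`, `𝔞⁺₊ V` and `𝔞⁺₋ 𝔞⁺₊ V` cancels the boundary terms
  -- produced by `L`.
  rw [createLeft_doubleDiff, createRight_doubleDiff, liouville_doubleDiff hV hx,
    liouvilleInt_doubleDiff hV.createLeft hx, liouvilleInt_doubleDiff hV.createRight hx,
    liouvilleInt_createLeft_createLeft hV hx, liouvilleInt_createRight_createRight hV hx,
    createRight_createLeft, liouvilleInt_createLeft_createLeft hV.createRight hx,
    ← createRight_createLeft (createRight V), hr,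
    liouville_createLeft hV hx, liouville_createRight hV hx, hb]
  have hd : liouvilleSeq Φ V s₁ s₂ x = liouville Φ (-(s₁ : ℤ)) s₂ (V s₁ s₂) x := rfl
  unfold doubleDiff
  rw [hd]
  ring

end DoubleSequences

end TopologicalParticles

end

noncomputable section

namespace TopologicalParticles

open Set Filter Topology

/-! ### Classical solutions: existence and uniqueness -/

section Classical

variable {Φ : ℝ → ℝ} {σ R : ℝ}

/-- The sums of all members of a double sequence up to the given one. -/
def cumulative (B₀ : DoubleSeq) : DoubleSeq := fun s₁ s₂ x =>
  ∑ n₁ ∈ Finset.range (s₁ + 1), ∑ n₂ ∈ Finset.range (s₂ + 1),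
    B₀ n₁ n₂ (restrict (-(n₁ : ℤ)) n₂ x)

lemma transported_eq (B₀ : DoubleSeq) (t : ℝ) (s₁ s₂ : ℕ) (x : Phase (-(s₁ : ℤ)) (s₂ : ℤ)) :
    transported Φ σ B₀ t s₁ s₂ x = cumulative B₀ s₁ s₂ (flow Φ σ (-(s₁ : ℤ)) s₂ t x) := rfl

/-- A mixed difference undoes a double summation: the creation operators shorten the ranges of the
sums by one, and only the corner term survives. -/
lemma doubleDiff_cumulative (B₀ : DoubleSeq) (s₁ s₂ : ℕ) (x : Phase (-(s₁ : ℤ)) (s₂ : ℤ)) :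
    doubleDiff (cumulative B₀) s₁ s₂ x = B₀ s₁ s₂ x := by
  let A : ℕ → ℕ → ℝ := fun n₁ n₂ => B₀ n₁ n₂ (restrict (-(n₁ : ℤ)) n₂ x)
  have hleft : createLeft (cumulative B₀) s₁ s₂ x =
      ∑ n₁ ∈ Finset.range s₁, ∑ n₂ ∈ Finset.range (s₂ + 1), A n₁ n₂ := by
    cases s₁ with
    | zero => simp [createLeft]
    | succ m =>
      show cumulative B₀ m s₂ (restrict _ _ x) = _
      unfold cumulative
      refine Finset.sum_congr rfl fun n₁ h₁ => Finset.sum_congr rfl fun n₂ h₂ => ?_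
      rw [Finset.mem_range] at h₁ h₂
      rw [restrict_restrict x (by omega) (by omega)]
  have hright : createRight (cumulative B₀) s₁ s₂ x =
      ∑ n₁ ∈ Finset.range (s₁ + 1), ∑ n₂ ∈ Finset.range s₂, A n₁ n₂ := by
    cases s₂ with
    | zero => simp [createRight]
    | succ m =>
      show cumulative B₀ s₁ m (restrict _ _ x) = _
      unfold cumulative
      refine Finset.sum_congr rfl fun n₁ h₁ => Finset.sum_congr rfl fun n₂ h₂ => ?_
      rw [Finset.mem_range] at h₁ h₂
      rw [restrict_restrict x (by omega) (by omega)]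
  have hboth : createLeft (createRight (cumulative B₀)) s₁ s₂ x =
      ∑ n₁ ∈ Finset.range s₁, ∑ n₂ ∈ Finset.range s₂, A n₁ n₂ := by
    cases s₁ with
    | zero => simp [createLeft]
    | succ l =>
      cases s₂ with
      | zero => simp [createLeft, createRight, lift]
      | succ m =>
        show cumulative B₀ l m (restrict _ _ (restrict _ _ x)) = _
        unfold cumulative
        refine Finset.sum_congr rfl fun n₁ h₁ => Finset.sum_congr rfl fun n₂ h₂ => ?_
        rw [Finset.mem_range] at h₁ h₂
        rw [restrict_restrict _ (by omega) (by omega), restrict_restrict x (by omega) (by omega)]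
  have hmain : cumulative B₀ s₁ s₂ x =
      ∑ n₁ ∈ Finset.range (s₁ + 1), ∑ n₂ ∈ Finset.range (s₂ + 1), A n₁ n₂ := rfl
  have hA : A s₁ s₂ = B₀ s₁ s₂ x := by simp [A]
  rw [doubleDiff, hleft, hright, hboth, hmain, ← hA,
    Finset.sum_range_succ (fun n₁ => ∑ n₂ ∈ Finset.range (s₂ + 1), A n₁ n₂),
    Finset.sum_range_succ (fun n₁ => ∑ n₂ ∈ Finset.range s₂, A n₁ n₂),
    Finset.sum_range_succ (fun n₂ => A s₁ n₂)]
  ring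

lemma expansion_eq_doubleDiff (Φ : ℝ → ℝ) (σ : ℝ) (B₀ : DoubleSeq) (t : ℝ) (s₁ s₂ : ℕ)
    {x : Phase (-(s₁ : ℤ)) (s₂ : ℤ)} (hx : x ∈ Allowed σ (-(s₁ : ℤ)) s₂) :
    expansion Φ σ B₀ t s₁ s₂ x = doubleDiff (transported Φ σ B₀ t) s₁ s₂ x :=
  expansion_eq Φ σ B₀ t s₁ s₂ hx

lemma expansion_of_notMem (B₀ : DoubleSeq) (t : ℝ) (s₁ s₂ : ℕ)
    {x : Phase (-(s₁ : ℤ)) (s₂ : ℤ)} (hx : x ∉ Allowed σ (-(s₁ : ℤ)) s₂) :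
    expansion Φ σ B₀ t s₁ s₂ x = 0 :=
  indicator_of_notMem hx _

lemma doubleDiff_congr {V W : DoubleSeq}
    (h : ∀ s₁ s₂ : ℕ, ∀ x ∈ Allowed σ (-(s₁ : ℤ)) s₂, V s₁ s₂ x = W s₁ s₂ x) (s₁ s₂ : ℕ) :
    ∀ x ∈ Allowed σ (-(s₁ : ℤ)) s₂, doubleDiff V s₁ s₂ x = doubleDiff W s₁ s₂ x := by
  intro x hx
  unfold doubleDiff
  rw [h s₁ s₂ x hx, createLeft_congr h s₁ s₂ x hx, createRight_congr h s₁ s₂ x hx,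
    createLeft_congr (createRight_congr h) s₁ s₂ x hx]

lemma IsPairPotential.expansion_zero (hΦ : IsPairPotential Φ σ R) {B₀ : DoubleSeq}
    (h : ∀ s₁ s₂ : ℕ, ∀ x, x ∉ Allowed σ (-(s₁ : ℤ)) s₂ → B₀ s₁ s₂ x = 0) :
    expansion Φ σ B₀ 0 = B₀ := by
  funext s₁ s₂ x
  by_cases hx : x ∈ Allowed σ (-(s₁ : ℤ)) s₂
  · rw [expansion_eq_doubleDiff Φ σ B₀ 0 s₁ s₂ hx, ← doubleDiff_cumulative B₀ s₁ s₂ x]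
    refine doubleDiff_congr (σ := σ) (fun s₁ s₂ y hy => ?_) s₁ s₂ x hx
    rw [transported_eq, hΦ.flow_zero hy]
  · rw [expansion_of_notMem _ _ _ _ hx, h _ _ _ hx]

/-- Continuous differentiability at all times and all allowed phase points. -/
def IsSmoothFamily (σ : ℝ) (V : ℝ → DoubleSeq) : Prop :=
  ∀ s₁ s₂ : ℕ, ContDiffOn ℝ 1 (fun z : ℝ × Phase (-(s₁ : ℤ)) (s₂ : ℤ) => V z.1 s₁ s₂ z.2)
    (univ ×ˢ Allowed σ (-(s₁ : ℤ)) s₂)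

lemma isOpen_univ_prod_allowed (σ : ℝ) (a b : ℤ) :
    IsOpen ((univ : Set ℝ) ×ˢ Allowed σ a b) :=
  isOpen_univ.prod (isOpen_allowed σ a b)

lemma contDiffOn_lift {a b c d : ℤ} {F : ℝ → Phase c d → ℝ}
    (hF : ContDiffOn ℝ 1 (fun z : ℝ × Phase c d => F z.1 z.2) (univ ×ˢ Allowed σ c d))
    (h₁ : a ≤ c) (h₂ : d ≤ b) :
    ContDiffOn ℝ 1 (fun z : ℝ × Phase a b => lift a b (F z.1) z.2) (univ ×ˢ Allowed σ a b) := by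
  have h : ContDiff ℝ 1 fun z : ℝ × Phase a b => (z.1, restrictCLM a b c d z.2) := by fun_prop
  have := hF.comp (s := univ ×ˢ Allowed σ a b) h.contDiffOn (fun z hz => ⟨trivial, by
    rw [restrictCLM_apply]
    exact restrict_mem_allowed hz.2 h₁ h₂⟩)
  refine this.congr fun z _ => ?_
  simp [lift, restrictCLM_apply]

lemma IsSmoothFamily.createLeft {V : ℝ → DoubleSeq} (hV : IsSmoothFamily σ V) :
    IsSmoothFamily σ fun t => createLeft (V t) := by
  intro s₁ s₂
  cases s₁ with
  | zero => exact contDiffOn_const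
  | succ m =>
    have h : -((m + 1 : ℕ) : ℤ) ≤ -(m : ℤ) := by push_cast; omega
    exact contDiffOn_lift (F := fun t => V t m s₂) (hV m s₂) h le_rfl

lemma IsSmoothFamily.createRight {V : ℝ → DoubleSeq} (hV : IsSmoothFamily σ V) :
    IsSmoothFamily σ fun t => createRight (V t) := by
  intro s₁ s₂
  cases s₂ with
  | zero => exact contDiffOn_const
  | succ m =>
    have h : (m : ℤ) ≤ ((m + 1 : ℕ) : ℤ) := by push_cast; omega
    exact contDiffOn_lift (F := fun t => V t s₁ m) (hV s₁ m) le_rfl h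

lemma IsSmoothFamily.isDifferentiable {V : ℝ → DoubleSeq} (hV : IsSmoothFamily σ V) (t : ℝ) :
    IsDifferentiable σ (V t) := by
  intro s₁ s₂ x hx
  have h := ((hV s₁ s₂).contDiffAt
    ((isOpen_univ_prod_allowed σ _ _).mem_nhds (x := (t, x)) ⟨trivial, hx⟩)).differentiableAt
    one_ne_zero
  exact h.comp x (f := fun y => (t, y)) (by fun_prop)

lemma IsSmoothFamily.doubleDiff {V : ℝ → DoubleSeq} (hV : IsSmoothFamily σ V) :
    IsSmoothFamily σ fun t => doubleDiff (V t) := fun s₁ s₂ =>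
  (((hV s₁ s₂).sub (hV.createLeft s₁ s₂)).sub (hV.createRight s₁ s₂)).add
    (hV.createRight.createLeft s₁ s₂)

lemma contDiffOn_cumulative {B₀ : DoubleSeq}
    (hB : ∀ s₁ s₂ : ℕ, ContDiffOn ℝ 1 (B₀ s₁ s₂) (Allowed σ (-(s₁ : ℤ)) s₂)) (s₁ s₂ : ℕ) :
    ContDiffOn ℝ 1 (cumulative B₀ s₁ s₂) (Allowed σ (-(s₁ : ℤ)) s₂) := by
  refine ContDiffOn.sum fun n₁ h₁ => ContDiffOn.sum fun n₂ h₂ => ?_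
  rw [Finset.mem_range] at h₁ h₂
  have := (hB n₁ n₂).comp (s := Allowed σ (-(s₁ : ℤ)) s₂)
    (restrictCLM (-(s₁ : ℤ)) s₂ (-(n₁ : ℤ)) n₂).contDiff.contDiffOn (fun x hx => by
      rw [restrictCLM_apply]
      exact restrict_mem_allowed hx (by omega) (by omega))
  refine this.congr fun x _ => ?_
  simp [restrictCLM_apply]

lemma IsPairPotential.isSmoothFamily_transported (hΦ : IsPairPotential Φ σ R) {B₀ : DoubleSeq}
    (hB : ∀ s₁ s₂ : ℕ, ContDiffOn ℝ 1 (B₀ s₁ s₂) (Allowed σ (-(s₁ : ℤ)) s₂)) :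
    IsSmoothFamily σ (transported Φ σ B₀) := fun s₁ s₂ =>
  (contDiffOn_cumulative hB s₁ s₂).comp hΦ.contDiffOn_flow fun _ hz => hΦ.flow_mem hz.2 _

lemma IsPairPotential.hasDerivAt_transported (hΦ : IsPairPotential Φ σ R) {B₀ : DoubleSeq}
    (hB : ∀ s₁ s₂ : ℕ, ContDiffOn ℝ 1 (B₀ s₁ s₂) (Allowed σ (-(s₁ : ℤ)) s₂)) (t : ℝ)
    (s₁ s₂ : ℕ) {x : Phase (-(s₁ : ℤ)) (s₂ : ℤ)} (hx : x ∈ Allowed σ (-(s₁ : ℤ)) s₂) :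
    HasDerivAt (fun τ => transported Φ σ B₀ τ s₁ s₂ x)
      (liouvilleSeq Φ (transported Φ σ B₀ t) s₁ s₂ x) t := by
  have hd := (hΦ.isSmoothFamily_transported hB).isDifferentiable t s₁ s₂ x hx
  have hfl : HasDerivAt (fun τ => flow Φ σ (-(s₁ : ℤ)) s₂ (τ - t) x) (vectorField Φ x) t := by
    have h := hΦ.hasDerivAt_flow hx 0
    rw [hΦ.flow_zero hx] at h
    have h' : HasDerivAt (fun s => flow Φ σ (-(s₁ : ℤ)) s₂ s x) (vectorField Φ x) (t - t) := by
      rwa [sub_self]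
    exact h'.comp_sub_const t t
  -- The group property puts the variation of `τ` into a flow over the short time `τ - t` starting
  -- at `x`, so the time derivative is the derivative of `V(t)` along the vector field at `x`.
  have e : (fun τ => transported Φ σ B₀ τ s₁ s₂ x) = fun τ =>
      transported Φ σ B₀ t s₁ s₂ (flow Φ σ (-(s₁ : ℤ)) s₂ (τ - t) x) := by
    funext τ
    rw [transported_eq, transported_eq, hΦ.flow_flow hx]
    congr 2
    ring
  rw [e, liouvilleSeq, liouville_eq_fderiv]
  have hx' : flow Φ σ (-(s₁ : ℤ)) s₂ (t - t) x = x := by rw [sub_self, hΦ.flow_zero hx]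
  exact HasFDerivAt.comp_hasDerivAt t (by rw [hx']; exact hd.hasFDerivAt) hfl

lemma hasDerivAt_createLeft {V : ℝ → DoubleSeq} {D : DoubleSeq} {t : ℝ}
    (h : ∀ s₁ s₂ : ℕ, ∀ x ∈ Allowed σ (-(s₁ : ℤ)) s₂,
      HasDerivAt (fun τ => V τ s₁ s₂ x) (D s₁ s₂ x) t) (s₁ s₂ : ℕ) :
    ∀ x ∈ Allowed σ (-(s₁ : ℤ)) s₂,
      HasDerivAt (fun τ => createLeft (V τ) s₁ s₂ x) (createLeft D s₁ s₂ x) t := by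
  intro x hx
  cases s₁ with
  | zero => exact hasDerivAt_const _ _
  | succ m => exact h m s₂ _ (restrict_mem_allowed hx (by push_cast; omega) le_rfl)

lemma hasDerivAt_createRight {V : ℝ → DoubleSeq} {D : DoubleSeq} {t : ℝ}
    (h : ∀ s₁ s₂ : ℕ, ∀ x ∈ Allowed σ (-(s₁ : ℤ)) s₂,
      HasDerivAt (fun τ => V τ s₁ s₂ x) (D s₁ s₂ x) t) (s₁ s₂ : ℕ) :
    ∀ x ∈ Allowed σ (-(s₁ : ℤ)) s₂,
      HasDerivAt (fun τ => createRight (V τ) s₁ s₂ x) (createRight D s₁ s₂ x) t := by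
  intro x hx
  cases s₂ with
  | zero => exact hasDerivAt_const _ _
  | succ m => exact h s₁ m _ (restrict_mem_allowed hx le_rfl (by push_cast; omega))

lemma liouville_congr {a b : ℤ} {f g : Phase a b → ℝ} (h : ∀ x ∈ Allowed σ a b, f x = g x)
    {x : Phase a b} (hx : x ∈ Allowed σ a b) : liouville Φ a b f x = liouville Φ a b g x := by
  have he : f =ᶠ[𝓝 x] g := eventually_of_mem ((isOpen_allowed σ a b).mem_nhds hx) h
  rw [liouville_eq_fderiv, liouville_eq_fderiv, he.fderiv_eq]

lemma liouvilleStarInt_congr {a b : ℤ} {f g : Phase a b → ℝ} (h : ∀ x ∈ Allowed σ a b, f x = g x)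
    {x : Phase a b} (hx : x ∈ Allowed σ a b) (j : ℤ) :
    liouvilleStarInt Φ a b j f x = liouvilleStarInt Φ a b j g x := by
  have he : f =ᶠ[𝓝 x] g := eventually_of_mem ((isOpen_allowed σ a b).mem_nhds hx) h
  unfold liouvilleStarInt dp
  rw [he.fderiv_eq]

/-- The expansion of continuously differentiable initial data is a classical solution. -/
theorem IsPairPotential.isClassicalSolution_expansion (hΦ : IsPairPotential Φ σ R)
    {B₀ : DoubleSeq}
    (hB : ∀ s₁ s₂ : ℕ, ContDiffOn ℝ 1 (B₀ s₁ s₂) (Allowed σ (-(s₁ : ℤ)) s₂))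
    (h0 : ∀ s₁ s₂ : ℕ, ∀ x, x ∉ Allowed σ (-(s₁ : ℤ)) s₂ → B₀ s₁ s₂ x = 0) :
    IsClassicalSolution Φ σ B₀ (expansion Φ σ B₀) := by
  have hV := hΦ.isSmoothFamily_transported hB
  refine ⟨fun t s₁ s₂ x hx => expansion_of_notMem _ _ _ _ hx, fun s₁ s₂ => ?_,
    fun t s₁ s₂ x hx => ?_, hΦ.expansion_zero h0⟩
  · exact (hV.doubleDiff s₁ s₂).congr fun z hz => expansion_eq_doubleDiff Φ σ B₀ z.1 s₁ s₂ hz.2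
  · have hE := expansion_eq_doubleDiff Φ σ B₀ t
    have hh := hierarchy_doubleDiff (Φ := Φ) (hV.isDifferentiable t) hx
    have hd : ∀ s₁ s₂ : ℕ, ∀ x ∈ Allowed σ (-(s₁ : ℤ)) s₂,
        HasDerivAt (fun τ => transported Φ σ B₀ τ s₁ s₂ x)
          (liouvilleSeq Φ (transported Φ σ B₀ t) s₁ s₂ x) t :=
      fun s₁ s₂ x hx => hΦ.hasDerivAt_transported hB t s₁ s₂ hx
    rw [liouville_congr (fun y hy => hE s₁ s₂ hy) hx]
    unfold liouvilleInt at hh ⊢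
    -- The set of allowed points is open, so the differential operators only see the values there,
    -- where `expansion` is the double difference.
    rw [liouvilleStarInt_congr (createLeft_congr (fun s₁ s₂ y hy => hE s₁ s₂ hy) s₁ s₂) hx,
      liouvilleStarInt_congr (createRight_congr (fun s₁ s₂ y hy => hE s₁ s₂ hy) s₁ s₂) hx, hh]
    have e : (fun τ => expansion Φ σ B₀ τ s₁ s₂ x) =
        fun τ => doubleDiff (transported Φ σ B₀ τ) s₁ s₂ x :=
      funext fun τ => expansion_eq_doubleDiff Φ σ B₀ τ s₁ s₂ hx
    rw [e]
    exact (((hd s₁ s₂ x hx).sub (hasDerivAt_createLeft hd s₁ s₂ x hx)).sub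
      (hasDerivAt_createRight hd s₁ s₂ x hx)).add
      (hasDerivAt_createLeft (hasDerivAt_createRight hd) s₁ s₂ x hx)

/-- A continuously differentiable solution of the Liouville equation with zero initial data
vanishes. -/
lemma IsPairPotential.eq_zero_of_liouville (hΦ : IsPairPotential Φ σ R) {a b : ℤ}
    {h : ℝ → Phase a b → ℝ}
    (hs : ContDiffOn ℝ 1 (fun z : ℝ × Phase a b => h z.1 z.2) (univ ×ˢ Allowed σ a b))
    (he : ∀ t, ∀ x ∈ Allowed σ a b, HasDerivAt (fun τ => h τ x) (liouville Φ a b (h t) x) t)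
    (h0 : ∀ x ∈ Allowed σ a b, h 0 x = 0) (t : ℝ) {x : Phase a b} (hx : x ∈ Allowed σ a b) :
    h t x = 0 := by
  -- Along this curve the equation holds in the form of a constant value: at `τ = t` it is `h t x`,
  -- at `τ = 0` it is an initial value.
  have hder : ∀ τ, HasDerivAt (fun τ => h τ (flow Φ σ a b (t - τ) x)) 0 τ := by
    intro τ
    set y := flow Φ σ a b (t - τ) x
    have hy : y ∈ Allowed σ a b := hΦ.flow_mem hx _
    have hF : HasFDerivAt (fun z : ℝ × Phase a b => h z.1 z.2)
        (fderiv ℝ (fun z : ℝ × Phase a b => h z.1 z.2) (τ, y)) (τ, y) :=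
      ((hs.contDiffAt ((isOpen_univ_prod_allowed σ a b).mem_nhds
        (x := (τ, y)) ⟨trivial, hy⟩)).differentiableAt one_ne_zero).hasFDerivAt
    set F := fderiv ℝ (fun z : ℝ × Phase a b => h z.1 z.2) (τ, y)
    have h1 : F (1, 0) = liouville Φ a b (h τ) y := by
      have := hF.comp_hasDerivAt (f := fun s => (s, y)) τ
        ((hasDerivAt_id τ).prodMk (hasDerivAt_const τ y))
      exact this.unique (he τ y hy)
    have h2 : F (0, vectorField Φ y) = liouville Φ a b (h τ) y := by
      have h3 : HasFDerivAt (h τ) (F.comp ((0 : Phase a b →L[ℝ] ℝ).prod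
          (ContinuousLinearMap.id ℝ (Phase a b)))) y :=
        hF.comp (f := fun y => (τ, y)) y ((hasFDerivAt_const τ y).prodMk (hasFDerivAt_id y))
      rw [liouville_eq_fderiv, h3.fderiv]
      simp
    have hfl : HasDerivAt (fun τ => flow Φ σ a b (t - τ) x) (-vectorField Φ y) τ :=
      (hΦ.hasDerivAt_flow hx (t - τ)).comp_const_sub t τ
    have h4 := hF.comp_hasDerivAt (f := fun s => (s, flow Φ σ a b (t - s) x)) τ
      ((hasDerivAt_id τ).prodMk hfl)
    have h5 : F (1, -vectorField Φ y) = 0 := by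
      have : ((1 : ℝ), -vectorField Φ y) = (1, 0) - (0, vectorField Φ y) := by simp
      rw [this, map_sub, h1, h2, sub_self]
    rw [h5] at h4
    exact h4
  have := is_const_of_deriv_eq_zero (fun τ => (hder τ).differentiableAt)
    (fun τ => (hder τ).deriv) t 0
  simp only [sub_self, sub_zero] at this
  rw [hΦ.flow_zero hx] at this
  rw [this, h0 _ (hΦ.flow_mem hx t)]

lemma createLeft_congr_of_lt {V W : DoubleSeq} {s₁ s₂ : ℕ}
    (h : ∀ n₁ n₂, n₁ + n₂ < s₁ + s₂ → V n₁ n₂ = W n₁ n₂) :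
    createLeft V s₁ s₂ = createLeft W s₁ s₂ := by
  cases s₁ with
  | zero => rfl
  | succ m => rw [createLeft, createLeft, h m s₂ (by omega)]

lemma createRight_congr_of_lt {V W : DoubleSeq} {s₁ s₂ : ℕ}
    (h : ∀ n₁ n₂, n₁ + n₂ < s₁ + s₂ → V n₁ n₂ = W n₁ n₂) :
    createRight V s₁ s₂ = createRight W s₁ s₂ := by
  cases s₂ with
  | zero => rfl
  | succ m => rw [createRight, createRight, h s₁ m (by omega)]

/-- Induction on `s₁ + s₂`: the source terms involve one particle less, hence coincide, and the
difference solves the homogeneous Liouville equation. -/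
theorem IsPairPotential.classicalSolution_unique (hΦ : IsPairPotential Φ σ R) {B₀ : DoubleSeq}
    {B C : ℝ → DoubleSeq} (hB : IsClassicalSolution Φ σ B₀ B)
    (hC : IsClassicalSolution Φ σ B₀ C) : B = C := by
  have key : ∀ n s₁ s₂ : ℕ, s₁ + s₂ = n → ∀ t, B t s₁ s₂ = C t s₁ s₂ := by
    intro n
    induction n using Nat.strong_induction_on with
    | _ n ih =>
    intro s₁ s₂ hn t
    have hlow : ∀ t n₁ n₂, n₁ + n₂ < s₁ + s₂ → B t n₁ n₂ = C t n₁ n₂ := fun t n₁ n₂ h =>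
      ih (n₁ + n₂) (by omega) n₁ n₂ rfl t
    funext x
    by_cases hx : x ∈ Allowed σ (-(s₁ : ℤ)) s₂
    · have := hΦ.eq_zero_of_liouville (h := fun t x => B t s₁ s₂ x - C t s₁ s₂ x)
        ((hB.smooth s₁ s₂).sub (hC.smooth s₁ s₂)) (fun t x hx => ?_)
        (fun x _ => by rw [hB.initial, hC.initial, sub_self]) t hx
      · linarith
      · have h1 := hB.equation t s₁ s₂ x hx
        have h2 := hC.equation t s₁ s₂ x hx
        rw [createLeft_congr_of_lt (hlow t), createRight_congr_of_lt (hlow t)] at h1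
        convert! h1.sub h2 using 1
        have d1 : DifferentiableAt ℝ (B t s₁ s₂) x :=
          IsSmoothFamily.isDifferentiable hB.smooth t s₁ s₂ x hx
        have d2 : DifferentiableAt ℝ (C t s₁ s₂) x :=
          IsSmoothFamily.isDifferentiable hC.smooth t s₁ s₂ x hx
        have h3 : liouville Φ (-(s₁ : ℤ)) s₂ (fun x => B t s₁ s₂ x - C t s₁ s₂ x) x =
            liouville Φ (-(s₁ : ℤ)) s₂ (B t s₁ s₂) x
              - liouville Φ (-(s₁ : ℤ)) s₂ (C t s₁ s₂) x := by
          simp only [liouville_eq_fderiv]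
          rw [fderiv_fun_sub d1 d2]
          rfl
        rw [h3]
        ring
    · rw [hB.zero_forbidden t s₁ s₂ x hx, hC.zero_forbidden t s₁ s₂ x hx]
  funext t s₁ s₂
  exact key _ s₁ s₂ rfl t

end Classical

end TopologicalParticles

end

noncomputable section

namespace TopologicalParticles

open Set Filter Topology MeasureTheory

/-! ### Functions of compact support in an open set and integration by parts -/

section CompactSupport

variable {E : Type*} [NormedAddCommGroup E] {U : Set E}

/-- Continuous functions vanishing outside of a compact subset of `U`. -/
def CcOn (U : Set E) (ψ : E → ℝ) : Prop :=
  Continuous ψ ∧ ∃ K, IsCompact K ∧ K ⊆ U ∧ ∀ x, x ∉ K → ψ x = 0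

lemma CcOn.continuous {ψ : E → ℝ} (h : CcOn U ψ) : Continuous ψ := h.1

lemma CcOn.hasCompactSupport {ψ : E → ℝ} (h : CcOn U ψ) : HasCompactSupport ψ := by
  obtain ⟨-, K, hK, -, h0⟩ := h
  exact HasCompactSupport.intro hK h0

lemma CcOn.tsupport_subset {ψ : E → ℝ} (h : CcOn U ψ) : tsupport ψ ⊆ U := by
  obtain ⟨-, K, hK, hKU, h0⟩ := h
  refine (closure_minimal ?_ hK.isClosed).trans hKU
  intro x hx
  by_contra hxK
  exact hx (h0 x hxK)

lemma CcOn.of_tsupport {ψ : E → ℝ} (h : Continuous ψ) (hc : HasCompactSupport ψ)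
    (hs : tsupport ψ ⊆ U) : CcOn U ψ :=
  ⟨h, tsupport ψ, hc, hs, fun _ hx => image_eq_zero_of_notMem_tsupport hx⟩

lemma CcOn.zero : CcOn U (fun _ => 0) :=
  ⟨continuous_const, ∅, isCompact_empty, empty_subset _, fun _ _ => rfl⟩

lemma CcOn.add {ψ χ : E → ℝ} (hψ : CcOn U ψ) (hχ : CcOn U χ) : CcOn U fun x => ψ x + χ x := by
  obtain ⟨hc, K, hK, hKU, h0⟩ := hψ
  obtain ⟨hc', K', hK', hKU', h0'⟩ := hχ
  refine ⟨hc.add hc', K ∪ K', hK.union hK', union_subset hKU hKU', fun x hx => ?_⟩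
  rw [mem_union, not_or] at hx
  show ψ x + χ x = 0
  rw [h0 x hx.1, h0' x hx.2, add_zero]

lemma CcOn.neg {ψ : E → ℝ} (hψ : CcOn U ψ) : CcOn U fun x => -ψ x := by
  obtain ⟨hc, K, hK, hKU, h0⟩ := hψ
  exact ⟨hc.neg, K, hK, hKU, fun x hx => neg_eq_zero.2 (h0 x hx)⟩

lemma CcOn.sub {ψ χ : E → ℝ} (hψ : CcOn U ψ) (hχ : CcOn U χ) : CcOn U fun x => ψ x - χ x := by
  simpa [sub_eq_add_neg] using hψ.add hχ.neg

lemma CcOn.sum {ι : Type*} (s : Finset ι) {ψ : ι → E → ℝ} (h : ∀ i ∈ s, CcOn U (ψ i)) :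
    CcOn U fun x => ∑ i ∈ s, ψ i x := by
  classical
  induction s using Finset.induction_on with
  | empty => simpa using CcOn.zero
  | insert i s hi ih =>
    simp_rw [Finset.sum_insert hi]
    exact (h i (Finset.mem_insert_self _ _)).add
      (ih fun j hj => h j (Finset.mem_insert_of_mem hj))

/-- Off the compact set the product is locally zero, so continuity of `f` on `U` suffices; this
admits coefficients such as `Φ'`, which are not controlled at the core. -/
lemma CcOn.mul_left {ψ f : E → ℝ} (hU : IsOpen U) (hψ : CcOn U ψ) (hf : ContinuousOn f U) :
    CcOn U fun x => f x * ψ x := by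
  obtain ⟨hc, K, hK, hKU, h0⟩ := hψ
  refine ⟨continuous_iff_continuousAt.2 fun x => ?_, K, hK, hKU, fun x hx => by simp [h0 x hx]⟩
  by_cases hx : x ∈ K
  · exact (hf.continuousAt (hU.mem_nhds (hKU hx))).mul hc.continuousAt
  · have : (fun x => f x * ψ x) =ᶠ[𝓝 x] fun _ => 0 := by
      filter_upwards [hK.isClosed.isOpen_compl.mem_nhds hx] with y hy
      rw [h0 y hy, mul_zero]
    exact continuousAt_const.congr this.symm

lemma CcOn.integrable [MeasurableSpace E] [OpensMeasurableSpace E] {μ : Measure E}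
    [IsFiniteMeasureOnCompacts μ] {ψ : E → ℝ} (h : CcOn U ψ) : Integrable ψ μ :=
  h.continuous.integrable_of_hasCompactSupport h.hasCompactSupport

lemma CcOn.fderiv_apply [NormedSpace ℝ E] {ψ : E → ℝ} (h : CcOn U ψ) (hd : ContDiff ℝ 1 ψ)
    (v : E) : CcOn U fun x => fderiv ℝ ψ x v := by
  have hc : Continuous fun x => fderiv ℝ ψ x v :=
    (hd.continuous_fderiv one_ne_zero).clm_apply continuous_const
  refine ⟨hc, tsupport ψ, h.hasCompactSupport, h.tsupport_subset, fun x hx => ?_⟩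
  have : fderiv ℝ ψ x = 0 := by
    by_contra h'
    exact hx (support_fderiv_subset ℝ h')
  show fderiv ℝ ψ x v = 0
  rw [this]
  rfl

/-- Integration by parts against a function of compact support, with a coefficient that is
constant in the direction of the derivative. -/
lemma integral_mul_fderiv_mul [NormedSpace ℝ E] [FiniteDimensional ℝ E] [MeasurableSpace E]
    [BorelSpace E] {μ : Measure E} [μ.IsAddHaarMeasure] (hU : IsOpen U) {c f φ : E → ℝ} (hc : ContDiffOn ℝ 1 c U)
    (hf : ContDiffOn ℝ 1 f U) (hφ : CcOn U φ) (hφd : ContDiff ℝ 1 φ) (v : E)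
    (hcv : ∀ x ∈ U, fderiv ℝ c x v = 0) :
    ∫ x, c x * fderiv ℝ f x v * φ x ∂μ = -∫ x, f x * (c x * fderiv ℝ φ x v) ∂μ := by
  have hg : ContDiffOn ℝ 1 (fun x => c x * f x) U := hc.mul hf
  have hdiff : ∀ {g : E → ℝ}, ContDiffOn ℝ 1 g U → ∀ x ∈ U, DifferentiableAt ℝ g x :=
    fun hg x hx => (hg.contDiffAt (hU.mem_nhds hx)).differentiableAt one_ne_zero
  have hgd : ∀ x ∈ U, fderiv ℝ (fun x => c x * f x) x v = c x * fderiv ℝ f x v := by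
    intro x hx
    rw [fderiv_fun_mul (hdiff hc x hx) (hdiff hf x hx)]
    simp [hcv x hx]
  have hgd' : ContinuousOn (fun x => fderiv ℝ (fun x => c x * f x) x v) U :=
    (hg.continuousOn_fderiv_of_isOpen hU le_rfl).clm_apply continuousOn_const
  have key := integral_mul_fderiv_eq_neg_fderiv_mul_of_integrable (μ := μ)
    (f := fun x => c x * f x) (g := φ) (v := v)
    (hφ.mul_left hU hgd').integrable
    ((hφ.fderiv_apply hφd v).mul_left hU hg.continuousOn).integrable
    (hφ.mul_left hU hg.continuousOn).integrable
    (fun x hx => hdiff hg x (hφ.tsupport_subset hx))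
    (fun x _ => hφd.differentiable one_ne_zero x)
  have e1 : ∫ x, c x * fderiv ℝ f x v * φ x ∂μ =
      ∫ x, fderiv ℝ (fun x => c x * f x) x v * φ x ∂μ := by
    refine integral_congr_ae (Eventually.of_forall fun x => ?_)
    by_cases hx : x ∈ U
    · simp only [hgd x hx]
    · have : φ x = 0 := image_eq_zero_of_notMem_tsupport fun h => hx (hφ.tsupport_subset h)
      simp [this]
  rw [e1, ← neg_eq_iff_eq_neg, ← key]
  refine integral_congr_ae (Eventually.of_forall fun x => ?_)
  show c x * f x * fderiv ℝ φ x v = f x * (c x * fderiv ℝ φ x v)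
  ring

lemma fderiv_apply_eq_zero_of_const [NormedSpace ℝ E] {c : E → ℝ} {x v : E}
    (h : ∀ s : ℝ, c (x + s • v) = c x) : fderiv ℝ c x v = 0 := by
  by_cases hc : DifferentiableAt ℝ c x
  · rw [← hc.lineDeriv_eq_fderiv, lineDeriv]
    simp [h]
  · rw [fderiv_zero_of_not_differentiableAt hc]
    rfl

/-- Differentiation under the integral sign, against a function of compact support. -/
lemma hasDerivAt_integral_mul [NormedSpace ℝ E] [MeasurableSpace E] [BorelSpace E]
    {μ : Measure E} [IsFiniteMeasureOnCompacts μ] (hU : IsOpen U) {H D : ℝ → E → ℝ}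
    (hH : ContDiffOn ℝ 1 (fun z : ℝ × E => H z.1 z.2) (univ ×ˢ U))
    (hD : ∀ t, ∀ x ∈ U, HasDerivAt (fun τ => H τ x) (D t x) t) {φ : E → ℝ} (hφ : CcOn U φ)
    (t : ℝ) : HasDerivAt (fun τ => ∫ x, H τ x * φ x ∂μ) (∫ x, D t x * φ x ∂μ) t := by
  have hUo : IsOpen ((univ : Set ℝ) ×ˢ U) := isOpen_univ.prod hU
  have hHd : ∀ τ, ∀ x ∈ U, D τ x = fderiv ℝ (fun z : ℝ × E => H z.1 z.2) (τ, x) (1, 0) := by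
    intro τ x hx
    have hF := ((hH.contDiffAt (hUo.mem_nhds (x := (τ, x)) ⟨trivial, hx⟩)).differentiableAt
      one_ne_zero).hasFDerivAt
    have := hF.comp_hasDerivAt (f := fun s => (s, x)) τ
      ((hasDerivAt_id τ).prodMk (hasDerivAt_const τ x))
    exact (hD τ x hx).unique this
  have hDc : ContinuousOn (fun z : ℝ × E => D z.1 z.2) (univ ×ˢ U) := by
    have h : ContinuousOn (fun z : ℝ × E =>
        fderiv ℝ (fun z : ℝ × E => H z.1 z.2) z ((1 : ℝ), (0 : E))) (univ ×ˢ U) :=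
      (hH.continuousOn_fderiv_of_isOpen hUo le_rfl).clm_apply continuousOn_const
    exact h.congr fun z hz => hHd z.1 z.2 hz.2
  have hsl : ∀ τ, ContinuousOn (H τ) U := fun τ =>
    hH.continuousOn.comp (f := fun x => (τ, x)) (by fun_prop) fun x hx => ⟨trivial, hx⟩
  have hsl' : ∀ τ, ContinuousOn (D τ) U := fun τ =>
    hDc.comp (f := fun x => (τ, x)) (by fun_prop) fun x hx => ⟨trivial, hx⟩
  -- The dominating function is `C * |φ|`, with `C` a bound of the time derivative on the compact
  -- set `[t - 1, t + 1] × supp φ`.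
  obtain ⟨C, hC⟩ := ((isCompact_Icc (a := t - 1) (b := t + 1)).prod
    hφ.hasCompactSupport.isCompact).exists_bound_of_continuousOn
    (hDc.mono (prod_mono (subset_univ _) hφ.tsupport_subset))
  refine (hasDerivAt_integral_of_dominated_loc_of_deriv_le (F := fun τ x => H τ x * φ x)
    (F' := fun τ x => D τ x * φ x) (bound := fun x => C * |φ x|)
    (Ioo_mem_nhds (show t - 1 < t by linarith) (show t < t + 1 by linarith))
    (Eventually.of_forall fun τ => (hφ.mul_left hU (hsl τ)).continuous.aestronglyMeasurable)
    (hφ.mul_left hU (hsl t)).integrable (hφ.mul_left hU (hsl' t)).continuous.aestronglyMeasurable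
    (Eventually.of_forall fun x τ hτ => ?_) ?_ (Eventually.of_forall fun x τ _ => ?_)).2
  · by_cases hx : x ∈ tsupport φ
    · rw [norm_mul, Real.norm_eq_abs (φ x)]
      gcongr
      exact hC (τ, x) ⟨Ioo_subset_Icc_self hτ, hx⟩
    · simp [image_eq_zero_of_notMem_tsupport hx]
  · exact hφ.integrable.abs.const_mul C
  · by_cases hx : x ∈ U
    · exact (hD τ x hx).mul_const (φ x)
    · have : φ x = 0 := image_eq_zero_of_notMem_tsupport fun h => hx (hφ.tsupport_subset h)
      simp only [this, mul_zero]
      exact hasDerivAt_const _ _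

end CompactSupport

/-! ### Adjoint Liouville operators and the weak form of the hierarchy -/

section Adjoint

variable {a b : ℤ} {Φ : ℝ → ℝ} {σ R : ℝ}

lemma IsTest.ccOn {φ : Phase a b → ℝ} (h : IsTest σ a b φ) : CcOn (Allowed σ a b) φ :=
  CcOn.of_tsupport h.1.continuous h.2.1 h.2.2

lemma IsTest.contDiff_one {φ : Phase a b → ℝ} (h : IsTest σ a b φ) : ContDiff ℝ 1 φ :=
  h.1.of_le (by exact_mod_cast le_top)

lemma IsPairPotential.contDiffAt_deriv (hΦ : IsPairPotential Φ σ R) {q : ℝ} (hq : σ < |q|) :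
    ContDiffAt ℝ 1 (deriv Φ) q := by
  have h := (hΦ.contDiffAt hq).fderiv_right (m := 1) (by rw [one_add_one_eq_two])
  have e : deriv Φ = fun q => fderiv ℝ Φ q 1 := rfl
  rw [e]
  exact h.clm_apply contDiffAt_const

lemma IsPairPotential.contDiffOn_coefficient (hΦ : IsPairPotential Φ σ R)
    {i j : ↥(Finset.Ico a b)} (hij : (j : ℤ) = i + 1) :
    ContDiffOn ℝ 1 (fun x : Phase a b => deriv Φ ((x i).1 - (x j).1)) (Allowed σ a b) := by
  intro x hx
  refine ContDiffAt.contDiffWithinAt ?_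
  exact ContDiffAt.comp (g := deriv Φ) x
    (hΦ.contDiffAt_deriv (lt_abs_sub_of_mem_allowed hx hij)) (by fun_prop)

lemma IsPairPotential.ccOn_liouvilleStarInt (hΦ : IsPairPotential Φ σ R) {φ : Phase a b → ℝ}
    (hφ : CcOn (Allowed σ a b) φ) (hd : ContDiff ℝ 1 φ) (j : ℤ) :
    CcOn (Allowed σ a b) (liouvilleStarInt Φ a b j φ) := by
  unfold liouvilleStarInt
  split_ifs with h
  · exact ((hφ.fderiv_apply hd _).sub (hφ.fderiv_apply hd _)).mul_left (isOpen_allowed σ a b)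
      (hΦ.contDiffOn_coefficient (i := ⟨j, h.1⟩) (j := ⟨j + 1, h.2⟩) rfl).continuousOn
  · exact CcOn.zero

lemma IsPairPotential.ccOn_liouvilleStar (hΦ : IsPairPotential Φ σ R) {φ : Phase a b → ℝ}
    (hφ : CcOn (Allowed σ a b) φ) (hd : ContDiff ℝ 1 φ) :
    CcOn (Allowed σ a b) (liouvilleStar Φ a b φ) := by
  refine CcOn.add (CcOn.sum _ fun i _ => CcOn.neg ?_)
    (CcOn.sum _ fun j _ => hΦ.ccOn_liouvilleStarInt hφ hd j)
  exact (hφ.fderiv_apply hd _).mul_left (isOpen_allowed σ a b) (by fun_prop)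

/-- The coefficient depends on positions only and the derivatives are in momenta, so integration by
parts produces no further term. -/
lemma IsPairPotential.integral_liouvilleInt_mul (hΦ : IsPairPotential Φ σ R)
    {f φ : Phase a b → ℝ} (hf : ContDiffOn ℝ 1 f (Allowed σ a b)) (hφ : CcOn (Allowed σ a b) φ)
    (hd : ContDiff ℝ 1 φ) (j : ℤ) :
    Integrable (fun x => liouvilleInt Φ a b j f x * φ x) ∧
      ∫ x, liouvilleInt Φ a b j f x * φ x = ∫ x, f x * liouvilleStarInt Φ a b j φ x := by
  have hU := isOpen_allowed σ a b
  unfold liouvilleInt liouvilleStarInt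
  split_ifs with h
  · have hc := hΦ.contDiffOn_coefficient (a := a) (b := b) (i := ⟨j, h.1⟩) (j := ⟨j + 1, h.2⟩) rfl
    set c : Phase a b → ℝ := fun x => deriv Φ ((x ⟨j, h.1⟩).1 - (x ⟨j + 1, h.2⟩).1) with hcdef
    have hcv : ∀ i : ↥(Finset.Ico a b), ∀ x ∈ Allowed σ a b,
        fderiv ℝ c x (Pi.single i ((0 : ℝ), (1 : ℝ))) = 0 := by
      intro i x _
      refine fderiv_apply_eq_zero_of_const fun s => ?_
      have h1 : ∀ k, ((x + s • (Pi.single i ((0 : ℝ), (1 : ℝ)) : Phase a b)) k).1 = (x k).1 := by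
        intro k
        by_cases hk : k = i
        · subst hk; simp
        · simp [Pi.single_eq_of_ne hk]
      simp only [hcdef, h1]
    have hi : ∀ i : ↥(Finset.Ico a b), Integrable (fun x => c x * dp i f x * φ x) := fun i => by
      have h1 : ContinuousOn (fun x => c x * dp i f x) (Allowed σ a b) :=
        hc.continuousOn.mul
          ((hf.continuousOn_fderiv_of_isOpen hU le_rfl).clm_apply continuousOn_const)
      exact (hφ.mul_left hU h1).integrable
    have hi' : ∀ i : ↥(Finset.Ico a b), Integrable (fun x => f x * (c x * dp i φ x)) := fun i =>
      (((hφ.fderiv_apply hd _).mul_left hU hc.continuousOn).mul_left hU hf.continuousOn).integrable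
    have hibp : ∀ i : ↥(Finset.Ico a b), ∫ x, c x * dp i f x * φ x =
        -∫ x, f x * (c x * dp i φ x) := fun i =>
      integral_mul_fderiv_mul hU hc hf hφ hd _ (hcv i)
    have e1 : ∀ x, -(c x * (dp ⟨j, h.1⟩ f x - dp ⟨j + 1, h.2⟩ f x)) * φ x =
        c x * dp ⟨j + 1, h.2⟩ f x * φ x - c x * dp ⟨j, h.1⟩ f x * φ x := fun x => by ring
    have e2 : ∀ x, f x * (c x * (dp ⟨j, h.1⟩ φ x - dp ⟨j + 1, h.2⟩ φ x)) =
        f x * (c x * dp ⟨j, h.1⟩ φ x) - f x * (c x * dp ⟨j + 1, h.2⟩ φ x) := fun x => by ring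
    have E1 : (fun x => -(deriv Φ ((x ⟨j, h.1⟩).1 - (x ⟨j + 1, h.2⟩).1) *
        (dp ⟨j, h.1⟩ f x - dp ⟨j + 1, h.2⟩ f x)) * φ x) =
        fun x => c x * dp ⟨j + 1, h.2⟩ f x * φ x - c x * dp ⟨j, h.1⟩ f x * φ x := funext e1
    have E2 : (fun x => f x * (deriv Φ ((x ⟨j, h.1⟩).1 - (x ⟨j + 1, h.2⟩).1) *
        (dp ⟨j, h.1⟩ φ x - dp ⟨j + 1, h.2⟩ φ x))) = fun x =>
        f x * (c x * dp ⟨j, h.1⟩ φ x) - f x * (c x * dp ⟨j + 1, h.2⟩ φ x) := funext e2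
    rw [E1, E2]
    refine ⟨(hi _).sub (hi _), ?_⟩
    rw [integral_sub (hi _) (hi _), integral_sub (hi' _) (hi' _), hibp, hibp]
    ring
  · simp

/-- The Hamiltonian vector field has no divergence: `p_i` multiplies a derivative in `q_i`, and the
forces multiply derivatives in the momenta. -/
lemma IsPairPotential.integral_liouville_mul (hΦ : IsPairPotential Φ σ R)
    {f φ : Phase a b → ℝ} (hf : ContDiffOn ℝ 1 f (Allowed σ a b)) (hφ : CcOn (Allowed σ a b) φ)
    (hd : ContDiff ℝ 1 φ) :
    Integrable (fun x => liouville Φ a b f x * φ x) ∧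
      ∫ x, liouville Φ a b f x * φ x = ∫ x, f x * liouvilleStar Φ a b φ x := by
  have hU := isOpen_allowed σ a b
  have hp : ∀ i : ↥(Finset.Ico a b), ContDiff ℝ 1 fun x : Phase a b => (x i).2 := fun i => by
    fun_prop
  have hi : ∀ i : ↥(Finset.Ico a b), Integrable (fun x => (x i).2 * dq i f x * φ x) := fun i => by
    have h1 : ContinuousOn (fun x => (x i).2 * dq i f x) (Allowed σ a b) :=
      (hp i).continuous.continuousOn.mul
        ((hf.continuousOn_fderiv_of_isOpen hU le_rfl).clm_apply continuousOn_const)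
    exact (hφ.mul_left hU h1).integrable
  have hi' : ∀ i : ↥(Finset.Ico a b), Integrable (fun x => f x * ((x i).2 * dq i φ x)) :=
    fun i => (((hφ.fderiv_apply hd _).mul_left hU (hp i).continuous.continuousOn).mul_left hU
      hf.continuousOn).integrable
  have hibp : ∀ i : ↥(Finset.Ico a b), ∫ x, (x i).2 * dq i f x * φ x =
      -∫ x, f x * ((x i).2 * dq i φ x) := fun i => by
    refine integral_mul_fderiv_mul hU (hp i).contDiffOn hf hφ hd _ fun x _ => ?_
    exact fderiv_apply_eq_zero_of_const fun s => by simp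
  have hj := fun j => hΦ.integral_liouvilleInt_mul hf hφ hd j
  have hj' : ∀ j, Integrable (fun x => f x * liouvilleStarInt Φ a b j φ x) := fun j =>
    ((hΦ.ccOn_liouvilleStarInt hφ hd j).mul_left hU hf.continuousOn).integrable
  have e1 : ∀ x, liouville Φ a b f x * φ x = (∑ i, (x i).2 * dq i f x * φ x) +
      ∑ j ∈ Finset.Ico a b, liouvilleInt Φ a b j f x * φ x := by
    intro x
    unfold liouville liouvilleStar liouvilleInt
    rw [← Finset.sum_mul, ← Finset.sum_mul, ← add_mul, Finset.sum_neg_distrib,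
      Finset.sum_neg_distrib]
    ring
  have e2 : ∀ x, f x * liouvilleStar Φ a b φ x = (∑ i, -(f x * ((x i).2 * dq i φ x))) +
      ∑ j ∈ Finset.Ico a b, f x * liouvilleStarInt Φ a b j φ x := by
    intro x
    unfold liouvilleStar
    rw [mul_add, Finset.mul_sum, Finset.mul_sum]
    simp
  simp_rw [e1, e2]
  have I1 : Integrable (fun x => ∑ i, (x i).2 * dq i f x * φ x) :=
    integrable_finsetSum _ fun i _ => hi i
  have I2 : Integrable (fun x => ∑ j ∈ Finset.Ico a b, liouvilleInt Φ a b j f x * φ x) :=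
    integrable_finsetSum _ fun j _ => (hj j).1
  have hn : ∀ i, Integrable (fun x => -(f x * ((x i).2 * dq i φ x))) := fun i => (hi' i).neg
  refine ⟨I1.add I2, ?_⟩
  rw [integral_add I1 I2, integral_add (integrable_finsetSum _ fun i _ => hn i)
    (integrable_finsetSum _ fun j _ => hj' j), integral_finsetSum _ fun i _ => hi i,
    integral_finsetSum _ fun j _ => (hj j).1, integral_finsetSum _ fun i _ => hn i,
    integral_finsetSum _ fun j _ => hj' j]
  congr 1
  · refine Finset.sum_congr rfl fun i _ => ?_
    rw [hibp, integral_neg]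
  · exact Finset.sum_congr rfl fun j _ => (hj j).2

/-- Classical solutions satisfy the weak form of the equations. -/
theorem IsPairPotential.weak_equation_of_classical (hΦ : IsPairPotential Φ σ R) {B₀ : DoubleSeq}
    {B : ℝ → DoubleSeq} (hB : IsClassicalSolution Φ σ B₀ B) (s₁ s₂ : ℕ)
    {φ : Phase (-(s₁ : ℤ)) (s₂ : ℤ) → ℝ} (hφ : CcOn (Allowed σ (-(s₁ : ℤ)) s₂) φ)
    (hd : ContDiff ℝ 1 φ) (t : ℝ) :
    HasDerivAt (fun τ => ∫ x, B τ s₁ s₂ x * φ x)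
      (∫ x, (B t s₁ s₂ x * liouvilleStar Φ (-(s₁ : ℤ)) s₂ φ x
        + createLeft (B t) s₁ s₂ x * liouvilleStarInt Φ (-(s₁ : ℤ)) s₂ (-(s₁ : ℤ)) φ x
        + createRight (B t) s₁ s₂ x * liouvilleStarInt Φ (-(s₁ : ℤ)) s₂ ((s₂ : ℤ) - 2) φ x)) t := by
  have hU := isOpen_allowed σ (-(s₁ : ℤ)) s₂
  have hslice : ∀ {V : ℝ → DoubleSeq}, IsSmoothFamily σ V →
      ContDiffOn ℝ 1 (V t s₁ s₂) (Allowed σ (-(s₁ : ℤ)) s₂) := fun hV =>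
    (hV s₁ s₂).comp (f := fun x => (t, x)) (by fun_prop) fun x hx => ⟨trivial, hx⟩
  have hs : IsSmoothFamily σ B := hB.smooth
  have h := hasDerivAt_integral_mul (μ := volume) hU (hB.smooth s₁ s₂)
    (fun t x hx => hB.equation t s₁ s₂ x hx) hφ t
  convert! h using 1
  simp_rw [add_mul]
  have h1 := hΦ.integral_liouville_mul (hslice hs) hφ hd
  have h2 := hΦ.integral_liouvilleInt_mul (hslice hs.createLeft) hφ hd (-(s₁ : ℤ))
  have h3 := hΦ.integral_liouvilleInt_mul (hslice hs.createRight) hφ hd ((s₂ : ℤ) - 2)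
  have i1 := ((hΦ.ccOn_liouvilleStar hφ hd).mul_left hU
    (hslice hs).continuousOn).integrable (μ := volume)
  have i2 := ((hΦ.ccOn_liouvilleStarInt hφ hd (-(s₁ : ℤ))).mul_left hU
    (hslice hs.createLeft).continuousOn).integrable (μ := volume)
  have i3 := ((hΦ.ccOn_liouvilleStarInt hφ hd ((s₂ : ℤ) - 2)).mul_left hU
    (hslice hs.createRight).continuousOn).integrable (μ := volume)
  have i12 : Integrable fun x => B t s₁ s₂ x * liouvilleStar Φ (-(s₁ : ℤ)) s₂ φ x
      + createLeft (B t) s₁ s₂ x * liouvilleStarInt Φ (-(s₁ : ℤ)) s₂ (-(s₁ : ℤ)) φ x :=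
    i1.add i2
  have h12 : Integrable fun x => liouville Φ (-(s₁ : ℤ)) s₂ (B t s₁ s₂) x * φ x +
      liouvilleInt Φ (-(s₁ : ℤ)) s₂ (-(s₁ : ℤ)) (createLeft (B t) s₁ s₂) x * φ x := h1.1.add h2.1
  rw [integral_add i12 i3, integral_add i1 i2, integral_add h12 h3.1,
    integral_add h1.1 h2.1, h1.2, h2.2, h3.2]

end Adjoint

end TopologicalParticles

end

noncomputable section

namespace TopologicalParticles

open Set Filter Topology MeasureTheory

/-! ### Smooth approximation on open sets and limits of integrals -/

section Approximation

variable {E : Type*} [NormedAddCommGroup E]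

lemma exists_continuous_pos_on {U : Set E} (hU : IsOpen U) :
    ∃ δ : E → ℝ, Continuous δ ∧ (∀ x ∈ U, 0 < δ x) ∧ ∀ x, x ∉ U → δ x = 0 := by
  by_cases h : Uᶜ.Nonempty
  · refine ⟨fun x => Metric.infDist x Uᶜ, Metric.continuous_infDist_pt _, fun x hx => ?_,
      fun x hx => Metric.infDist_zero_of_mem hx⟩
    exact (hU.isClosed_compl.notMem_iff_infDist_pos h).1 fun h' => h' hx
  -- The distance to an empty complement would be zero by convention.
  · refine ⟨fun _ => 1, continuous_const, fun _ _ => one_pos, fun x hx => ?_⟩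
    exact absurd ⟨x, hx⟩ h

/-- Continuous functions on an open set are locally uniform limits of smooth functions. -/
lemma exists_contDiff_tendstoLocallyUniformlyOn [NormedSpace ℝ E] [FiniteDimensional ℝ E]
    {U : Set E} (hU : IsOpen U) {f : E → ℝ} (hf : ContinuousOn f U) :
    ∃ g : ℕ → E → ℝ, (∀ k, ContDiff ℝ 1 (g k)) ∧ TendstoLocallyUniformlyOn g f atTop U := by
  obtain ⟨δ, hδ, hpos, hzero⟩ := exists_continuous_pos_on hU
  -- A cutoff that is 0 where `k δ ≤ 1` and 1 where `k δ ≥ 2`: multiplied by it, `f` becomes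
  -- continuous on the whole space and can be approximated uniformly.
  set χ : ℕ → E → ℝ := fun k x => min 1 (max 0 (k * δ x - 1)) with hχ
  have hχc : ∀ k, Continuous (χ k) := fun k => by fun_prop
  have hprod : ∀ k, Continuous fun x => χ k x * f x := by
    intro k
    refine continuous_iff_continuousAt.2 fun x => ?_
    by_cases hx : x ∈ U
    · exact (hχc k).continuousAt.mul (hf.continuousAt (hU.mem_nhds hx))
    · have h1 : ∀ᶠ y in 𝓝 x, (k : ℝ) * δ y < 1 :=
        (continuous_const.mul hδ).continuousAt.eventually_lt continuousAt_const
          (by simp [hzero x hx])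
      refine continuousAt_const.congr (f := fun _ => (0 : ℝ)) ?_
      filter_upwards [h1] with y hy
      have : χ k y = 0 := by
        simp only [hχ]
        rw [max_eq_left (by linarith), min_eq_right zero_le_one]
      rw [this, zero_mul]
  have happ : ∀ k : ℕ, ∃ g : E → ℝ, ContDiff ℝ 1 g ∧
      ∀ x, dist (g x) (χ k x * f x) < 1 / ((k : ℝ) + 1) := fun k => by
    obtain ⟨g, h1, h2, -⟩ := (hprod k).exists_contDiff_approx 1
      (ε := fun _ => 1 / ((k : ℝ) + 1)) continuous_const fun _ => by positivity
    exact ⟨g, h1, h2⟩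
  choose g hg hgd using happ
  refine ⟨g, hg, Metric.tendstoLocallyUniformlyOn_iff.2 fun ε hε x hx => ?_⟩
  have hx' := hpos x hx
  -- On this neighbourhood `k ≥ 4 / δ x` implies `k δ y ≥ 2`, so the cutoff is 1.
  refine ⟨{y | δ x / 2 < δ y}, mem_nhdsWithin_of_mem_nhds
    (continuousAt_const.eventually_lt hδ.continuousAt (by linarith)), ?_⟩
  have h1 : ∀ᶠ k : ℕ in atTop, 1 / ((k : ℝ) + 1) < ε :=
    tendsto_one_div_add_atTop_nhds_zero_nat.eventually_lt_const hε
  have h2 : ∀ᶠ k : ℕ in atTop, 4 / δ x ≤ k := tendsto_natCast_atTop_atTop.eventually_ge_atTop _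
  filter_upwards [h1, h2] with k hk1 hk2 y hy
  have hy' : δ x / 2 < δ y := hy
  have : χ k y = 1 := by
    have h3 : 2 ≤ (k : ℝ) * δ y := by
      rw [div_le_iff₀ hx'] at hk2
      have : (0 : ℝ) ≤ k := k.cast_nonneg
      nlinarith
    simp only [hχ]
    rw [min_eq_left (le_max_of_le_right (by linarith))]
  have h4 := hgd k y
  rw [this, one_mul] at h4
  rw [dist_comm]
  exact h4.trans hk1

variable [MeasurableSpace E] [BorelSpace E] {μ : Measure E} [IsFiniteMeasureOnCompacts μ]
  [WeaklyLocallyCompactSpace E] {U : Set E}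

lemma tendstoUniformlyOn_integral_mul (hU : IsOpen U) {V : ℕ → ℝ → E → ℝ} {W : ℝ → E → ℝ}
    (hV : ∀ k t, ContinuousOn (V k t) U) (hW : ∀ t, ContinuousOn (W t) U)
    (h : TendstoLocallyUniformlyOn (fun k (z : ℝ × E) => V k z.1 z.2) (fun z => W z.1 z.2)
      atTop (univ ×ˢ U)) {ψ : E → ℝ} (hψ : CcOn U ψ) (T : ℝ) :
    TendstoUniformlyOn (fun k t => ∫ x, V k t x * ψ x ∂μ) (fun t => ∫ x, W t x * ψ x ∂μ) atTop
      (Ioo (-T) T) := by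
  have : LocallyCompactSpace E := inferInstance
  rw [tendstoLocallyUniformlyOn_iff_forall_isCompact (isOpen_univ.prod hU)] at h
  have hK := h (Icc (-T) T ×ˢ tsupport ψ)
    (prod_mono (subset_univ _) hψ.tsupport_subset)
    (isCompact_Icc.prod hψ.hasCompactSupport.isCompact)
  rw [Metric.tendstoUniformlyOn_iff] at hK ⊢
  intro ε hε
  set C := ∫ x, |ψ x| ∂μ
  have hC : 0 ≤ C := integral_nonneg fun x => abs_nonneg _
  filter_upwards [hK (ε / (C + 1)) (by positivity)] with k hk t ht
  have hi1 := (hψ.mul_left hU (hW t)).integrable (μ := μ)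
  have hi2 := (hψ.mul_left hU (hV k t)).integrable (μ := μ)
  rw [dist_eq_norm, ← integral_sub hi1 hi2]
  calc ‖∫ x, (W t x * ψ x - V k t x * ψ x) ∂μ‖ ≤ ∫ x, ε / (C + 1) * |ψ x| ∂μ := by
        refine norm_integral_le_of_norm_le (hψ.integrable.abs.const_mul _)
          (Eventually.of_forall fun x => ?_)
        by_cases hx : x ∈ tsupport ψ
        · rw [← sub_mul, norm_mul, Real.norm_eq_abs (ψ x)]
          gcongr
          have := hk (t, x) ⟨Ioo_subset_Icc_self ht, hx⟩
          rw [dist_eq_norm] at this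
          exact this.le
        · simp [image_eq_zero_of_notMem_tsupport hx]
    _ = ε / (C + 1) * C := integral_const_mul _ _
    _ < ε := by
        rw [div_mul_eq_mul_div, div_lt_iff₀ (by positivity)]
        nlinarith

end Approximation

/-! ### Locally uniform limits of solutions -/

section LocallyUniform

variable {Φ : ℝ → ℝ} {σ R : ℝ} {V : ℕ → ℝ → DoubleSeq} {W : ℝ → DoubleSeq}

lemma tendstoLocallyUniformlyOn_const {α : Type*} [TopologicalSpace α] (s : Set α)
    (f : α → ℝ) : TendstoLocallyUniformlyOn (fun _ : ℕ => f) f atTop s := fun _ hu _ _ =>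
  ⟨univ, univ_mem, Eventually.of_forall fun _ _ _ => refl_mem_uniformity hu⟩

lemma tendstoLocallyUniformlyOn_finsetSum {α ι : Type*} [TopologicalSpace α] {s : Set α}
    {F : ι → ℕ → α → ℝ} {f : ι → α → ℝ} (J : Finset ι)
    (h : ∀ i ∈ J, TendstoLocallyUniformlyOn (F i) (f i) atTop s) :
    TendstoLocallyUniformlyOn (fun k x => ∑ i ∈ J, F i k x) (fun x => ∑ i ∈ J, f i x) atTop s := by
  classical
  induction J using Finset.induction_on with
  | empty =>
    simp only [Finset.sum_empty]
    exact tendstoLocallyUniformlyOn_const _ _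
  | insert i J hi ih =>
    simp only [Finset.sum_insert hi]
    exact (h i (Finset.mem_insert_self _ _)).add
      (ih fun j hj => h j (Finset.mem_insert_of_mem hj))

/-- Convergence, locally uniform in time and in allowed phase points. -/
def TendstoFamily (σ : ℝ) (V : ℕ → ℝ → DoubleSeq) (W : ℝ → DoubleSeq) : Prop :=
  ∀ s₁ s₂ : ℕ, TendstoLocallyUniformlyOn
    (fun k (z : ℝ × Phase (-(s₁ : ℤ)) (s₂ : ℤ)) => V k z.1 s₁ s₂ z.2)
    (fun z => W z.1 s₁ s₂ z.2) atTop (univ ×ˢ Allowed σ (-(s₁ : ℤ)) s₂)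

lemma continuous_restrict (a b c d : ℤ) : Continuous (restrict c d : Phase a b → Phase c d) := by
  have : (restrict c d : Phase a b → Phase c d) = restrictCLM a b c d :=
    funext fun x => (restrictCLM_apply x).symm
  rw [this]
  exact (restrictCLM a b c d).continuous

lemma TendstoFamily.createLeft (h : TendstoFamily σ V W) :
    TendstoFamily σ (fun k t => createLeft (V k t)) fun t => createLeft (W t) := by
  intro s₁ s₂
  cases s₁ with
  | zero => exact tendstoLocallyUniformlyOn_const _ _
  | succ m =>
    have hc : -((m + 1 : ℕ) : ℤ) ≤ -(m : ℤ) := by push_cast; omega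
    exact (h m s₂).comp (fun z : ℝ × Phase (-((m + 1 : ℕ) : ℤ)) (s₂ : ℤ) => (z.1, restrict _ _ z.2))
      (fun z hz => ⟨trivial, restrict_mem_allowed hz.2 hc le_rfl⟩)
      (continuous_fst.prodMk ((continuous_restrict _ _ _ _).comp continuous_snd)).continuousOn

lemma TendstoFamily.createRight (h : TendstoFamily σ V W) :
    TendstoFamily σ (fun k t => createRight (V k t)) fun t => createRight (W t) := by
  intro s₁ s₂
  cases s₂ with
  | zero => exact tendstoLocallyUniformlyOn_const _ _
  | succ m =>
    have hc : (m : ℤ) ≤ ((m + 1 : ℕ) : ℤ) := by push_cast; omega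
    exact (h s₁ m).comp (fun z : ℝ × Phase (-(s₁ : ℤ)) ((m + 1 : ℕ) : ℤ) => (z.1, restrict _ _ z.2))
      (fun z hz => ⟨trivial, restrict_mem_allowed hz.2 le_rfl hc⟩)
      (continuous_fst.prodMk ((continuous_restrict _ _ _ _).comp continuous_snd)).continuousOn

lemma TendstoFamily.doubleDiff (h : TendstoFamily σ V W) :
    TendstoFamily σ (fun k t => doubleDiff (V k t)) fun t => doubleDiff (W t) := fun s₁ s₂ =>
  (((h s₁ s₂).sub (h.createLeft s₁ s₂)).sub (h.createRight s₁ s₂)).add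
    (h.createRight.createLeft s₁ s₂)

lemma IsPairPotential.tendstoFamily_transported (hΦ : IsPairPotential Φ σ R)
    {b : ℕ → DoubleSeq} {B₀ : DoubleSeq}
    (h : ∀ s₁ s₂ : ℕ, TendstoLocallyUniformlyOn (fun k => b k s₁ s₂) (B₀ s₁ s₂) atTop
      (Allowed σ (-(s₁ : ℤ)) s₂)) :
    TendstoFamily σ (fun k => transported Φ σ (b k)) (transported Φ σ B₀) := by
  intro s₁ s₂
  have hc : TendstoLocallyUniformlyOn (fun k => cumulative (b k) s₁ s₂) (cumulative B₀ s₁ s₂)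
      atTop (Allowed σ (-(s₁ : ℤ)) s₂) := by
    unfold cumulative
    refine tendstoLocallyUniformlyOn_finsetSum _ fun n₁ h₁ =>
      tendstoLocallyUniformlyOn_finsetSum _ fun n₂ h₂ => ?_
    rw [Finset.mem_range] at h₁ h₂
    have h1 : -(s₁ : ℤ) ≤ -(n₁ : ℤ) := by omega
    have h2 : (n₂ : ℤ) ≤ s₂ := by omega
    exact (h n₁ n₂).comp (restrict (-(n₁ : ℤ)) (n₂ : ℤ))
      (fun x hx => restrict_mem_allowed hx h1 h2)
      (continuous_restrict _ _ _ _).continuousOn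
  have h := hc.comp (t := univ ×ˢ Allowed σ (-(s₁ : ℤ)) s₂)
    (fun z : ℝ × Phase (-(s₁ : ℤ)) (s₂ : ℤ) => flow Φ σ (-(s₁ : ℤ)) s₂ z.1 z.2)
    (fun z hz => hΦ.flow_mem hz.2 z.1) hΦ.contDiffOn_flow.continuousOn
  simp only [transported_eq]
  exact h

lemma IsPairPotential.tendstoFamily_expansion (hΦ : IsPairPotential Φ σ R)
    {b : ℕ → DoubleSeq} {B₀ : DoubleSeq}
    (h : ∀ s₁ s₂ : ℕ, TendstoLocallyUniformlyOn (fun k => b k s₁ s₂) (B₀ s₁ s₂) atTop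
      (Allowed σ (-(s₁ : ℤ)) s₂)) :
    TendstoFamily σ (fun k => expansion Φ σ (b k)) (expansion Φ σ B₀) := fun s₁ s₂ =>
  (((hΦ.tendstoFamily_transported h).doubleDiff s₁ s₂).congr fun k z hz =>
    (expansion_eq_doubleDiff Φ σ (b k) z.1 s₁ s₂ hz.2).symm).congr_right fun z hz =>
    (expansion_eq_doubleDiff Φ σ B₀ z.1 s₁ s₂ hz.2).symm

lemma TendstoFamily.continuousOn (h : TendstoFamily σ V W) (hV : ∀ k, IsSmoothFamily σ (V k))
    (t : ℝ) (s₁ s₂ : ℕ) : ContinuousOn (W t s₁ s₂) (Allowed σ (-(s₁ : ℤ)) s₂) := by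
  have h1 := (h s₁ s₂).continuousOn (Frequently.of_forall fun k => (hV k s₁ s₂).continuousOn)
  exact h1.comp (f := fun x => (t, x)) (by fun_prop) fun x hx => ⟨trivial, hx⟩

lemma IsSmoothFamily.continuousOn {V : ℝ → DoubleSeq} (hV : IsSmoothFamily σ V)
    (t : ℝ) (s₁ s₂ : ℕ) : ContinuousOn (V t s₁ s₂) (Allowed σ (-(s₁ : ℤ)) s₂) :=
  (hV s₁ s₂).continuousOn.comp (f := fun x => (t, x)) (by fun_prop) fun x hx => ⟨trivial, hx⟩

/-- Locally uniform limits of classical solutions satisfy the weak form of the equations. -/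
theorem IsPairPotential.weak_equation_of_tendsto (hΦ : IsPairPotential Φ σ R) {b : ℕ → DoubleSeq}
    (hV : ∀ k, IsClassicalSolution Φ σ (b k) (V k)) (h : TendstoFamily σ V W) (s₁ s₂ : ℕ)
    {φ : Phase (-(s₁ : ℤ)) (s₂ : ℤ) → ℝ} (hφ : CcOn (Allowed σ (-(s₁ : ℤ)) s₂) φ)
    (hd : ContDiff ℝ 1 φ) (t : ℝ) :
    HasDerivAt (fun τ => ∫ x, W τ s₁ s₂ x * φ x)
      (∫ x, (W t s₁ s₂ x * liouvilleStar Φ (-(s₁ : ℤ)) s₂ φ x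
        + createLeft (W t) s₁ s₂ x * liouvilleStarInt Φ (-(s₁ : ℤ)) s₂ (-(s₁ : ℤ)) φ x
        + createRight (W t) s₁ s₂ x * liouvilleStarInt Φ (-(s₁ : ℤ)) s₂ ((s₂ : ℤ) - 2) φ x)) t := by
  have hU := isOpen_allowed σ (-(s₁ : ℤ)) s₂
  have hs : ∀ k, IsSmoothFamily σ (V k) := fun k => (hV k).smooth
  have c1 := hΦ.ccOn_liouvilleStar hφ hd
  have c2 := hΦ.ccOn_liouvilleStarInt hφ hd (-(s₁ : ℤ))
  have c3 := hΦ.ccOn_liouvilleStarInt hφ hd ((s₂ : ℤ) - 2)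
  have split : ∀ b₁ b₂ b₃ : Phase (-(s₁ : ℤ)) (s₂ : ℤ) → ℝ,
      ContinuousOn b₁ (Allowed σ (-(s₁ : ℤ)) s₂) → ContinuousOn b₂ (Allowed σ (-(s₁ : ℤ)) s₂) →
      ContinuousOn b₃ (Allowed σ (-(s₁ : ℤ)) s₂) →
      ∫ x, (b₁ x * liouvilleStar Φ (-(s₁ : ℤ)) s₂ φ x
        + b₂ x * liouvilleStarInt Φ (-(s₁ : ℤ)) s₂ (-(s₁ : ℤ)) φ x
        + b₃ x * liouvilleStarInt Φ (-(s₁ : ℤ)) s₂ ((s₂ : ℤ) - 2) φ x) =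
      (∫ x, b₁ x * liouvilleStar Φ (-(s₁ : ℤ)) s₂ φ x)
        + (∫ x, b₂ x * liouvilleStarInt Φ (-(s₁ : ℤ)) s₂ (-(s₁ : ℤ)) φ x)
        + ∫ x, b₃ x * liouvilleStarInt Φ (-(s₁ : ℤ)) s₂ ((s₂ : ℤ) - 2) φ x := by
    intro b₁ b₂ b₃ h1 h2 h3
    have i1 := (c1.mul_left hU h1).integrable (μ := volume)
    have i2 := (c2.mul_left hU h2).integrable (μ := volume)
    have i3 := (c3.mul_left hU h3).integrable (μ := volume)
    have i12 : Integrable fun x => b₁ x * liouvilleStar Φ (-(s₁ : ℤ)) s₂ φ x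
        + b₂ x * liouvilleStarInt Φ (-(s₁ : ℤ)) s₂ (-(s₁ : ℤ)) φ x := i1.add i2
    rw [integral_add i12 i3, integral_add i1 i2]
  set T := |t| + 1
  have ht : t ∈ Ioo (-T) T := by
    rw [mem_Ioo, ← abs_lt]
    exact lt_add_one _
  have hL := h.createLeft
  have hR := h.createRight
  have sL : ∀ k, IsSmoothFamily σ fun t => TopologicalParticles.createLeft (V k t) :=
    fun k => (hs k).createLeft
  have sR : ∀ k, IsSmoothFamily σ fun t => TopologicalParticles.createRight (V k t) :=
    fun k => (hs k).createRight
  have u0 := tendstoUniformlyOn_integral_mul (μ := volume) hU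
    (fun k τ => (hs k).continuousOn τ s₁ s₂) (fun τ => h.continuousOn hs τ s₁ s₂)
    (h s₁ s₂) hφ T
  have u1 := tendstoUniformlyOn_integral_mul (μ := volume) hU
    (fun k τ => (hs k).continuousOn τ s₁ s₂) (fun τ => h.continuousOn hs τ s₁ s₂)
    (h s₁ s₂) c1 T
  have u2 := tendstoUniformlyOn_integral_mul (μ := volume) hU
    (fun k τ => (sL k).continuousOn τ s₁ s₂) (fun τ => hL.continuousOn sL τ s₁ s₂)
    (hL s₁ s₂) c2 T
  have u3 := tendstoUniformlyOn_integral_mul (μ := volume) hU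
    (fun k τ => (sR k).continuousOn τ s₁ s₂) (fun τ => hR.continuousOn sR τ s₁ s₂)
    (hR s₁ s₂) c3 T
  -- The derivatives of the pairings converge uniformly on `(-T, T)` and the pairings themselves
  -- pointwise, so the limit may be differentiated.
  have key := hasDerivAt_of_tendstoUniformlyOn isOpen_Ioo ((u1.add u2).add u3)
    (f := fun k τ => ∫ x, V k τ s₁ s₂ x * φ x) (g := fun τ => ∫ x, W τ s₁ s₂ x * φ x)
    (Eventually.of_forall fun k τ _ => ?_) (fun τ hτ => u0.tendsto_at hτ) ht
  · rw [split _ _ _ (h.continuousOn hs t s₁ s₂) (hL.continuousOn sL t s₁ s₂)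
      (hR.continuousOn sR t s₁ s₂)]
    exact key
  · have e := hΦ.weak_equation_of_classical (hV k) s₁ s₂ hφ hd τ
    rw [split _ _ _ ((hs k).continuousOn τ s₁ s₂) ((sL k).continuousOn τ s₁ s₂)
      ((sR k).continuousOn τ s₁ s₂)] at e
    exact e

end LocallyUniform

/-! ### Estimates in `C_γ` and existence of generalized solutions -/

section Norm

variable {Φ : ℝ → ℝ} {σ R γ M : ℝ} {b : DoubleSeq}

lemma NormLE.nonneg (hγ : 0 < γ) (h : NormLE γ b M) : 0 ≤ M :=
  (mul_nonneg (pow_nonneg hγ.le _) (abs_nonneg _)).trans (h 0 0 0)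

lemma NormLE.createLeft (hγ : 0 < γ) (hγ1 : γ < 1) (h : NormLE γ b M) :
    NormLE γ (createLeft b) M := by
  intro s₁ s₂ x
  cases s₁ with
  | zero => simpa [TopologicalParticles.createLeft] using h.nonneg hγ
  | succ m =>
    refine le_trans ?_ (h m s₂ (restrict _ _ x))
    exact mul_le_mul_of_nonneg_right
      (pow_le_pow_of_le_one hγ.le hγ1.le (by omega)) (abs_nonneg _)

lemma NormLE.createRight (hγ : 0 < γ) (hγ1 : γ < 1) (h : NormLE γ b M) :
    NormLE γ (createRight b) M := by
  intro s₁ s₂ x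
  cases s₂ with
  | zero => simpa [TopologicalParticles.createRight] using h.nonneg hγ
  | succ m =>
    refine le_trans ?_ (h s₁ m (restrict _ _ x))
    exact mul_le_mul_of_nonneg_right
      (pow_le_pow_of_le_one hγ.le hγ1.le (by omega)) (abs_nonneg _)

lemma NormLE.doubleDiff (hγ : 0 < γ) (hγ1 : γ < 1) (h : NormLE γ b M) :
    NormLE γ (doubleDiff b) (4 * M) := by
  intro s₁ s₂ x
  have h1 := h s₁ s₂ x
  have h2 := h.createLeft hγ hγ1 s₁ s₂ x
  have h3 := h.createRight hγ hγ1 s₁ s₂ x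
  have h4 := (h.createRight hγ hγ1).createLeft hγ hγ1 s₁ s₂ x
  unfold TopologicalParticles.doubleDiff
  set A := TopologicalParticles.createLeft b s₁ s₂ x
  set B := TopologicalParticles.createRight b s₁ s₂ x
  set C := TopologicalParticles.createLeft (TopologicalParticles.createRight b) s₁ s₂ x
  have h5 : |b s₁ s₂ x - A - B + C| ≤ |b s₁ s₂ x| + |A| + |B| + |C| :=
    (abs_add_le _ _).trans (add_le_add_left ((abs_sub _ _).trans
      (add_le_add_left (abs_sub _ _) _)) _)
  have h6 := mul_le_mul_of_nonneg_left h5 (pow_nonneg hγ.le (s₁ + s₂))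
  linarith

lemma sum_pow_sub_le (hγ : 0 < γ) (hγ1 : γ < 1) (s : ℕ) :
    ∑ n ∈ Finset.range (s + 1), γ ^ (s - n) ≤ (1 - γ)⁻¹ := by
  have h := Finset.sum_range_reflect (fun n => γ ^ n) (s + 1)
  simp only [Nat.add_sub_cancel] at h
  rw [h, ← tsum_geometric_of_lt_one hγ.le hγ1]
  exact (summable_geometric_of_lt_one hγ.le hγ1).sum_le_tsum _ fun n _ => pow_nonneg hγ.le n

/-- Write `γ ^ (s₁ + s₂)` as `γ ^ (s₁ - n₁) * γ ^ (s₂ - n₂) * γ ^ (n₁ + n₂)`: the last factor is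
absorbed by the norm and the other two give geometric sums. -/
lemma NormLE.cumulative (hγ : 0 < γ) (hγ1 : γ < 1) (h : NormLE γ b M) :
    NormLE γ (cumulative b) ((1 - γ)⁻¹ * (1 - γ)⁻¹ * M) := by
  intro s₁ s₂ x
  have hM := h.nonneg hγ
  unfold TopologicalParticles.cumulative
  calc γ ^ (s₁ + s₂) * |∑ n₁ ∈ Finset.range (s₁ + 1), ∑ n₂ ∈ Finset.range (s₂ + 1),
        b n₁ n₂ (restrict (-(n₁ : ℤ)) n₂ x)|
      ≤ γ ^ (s₁ + s₂) * ∑ n₁ ∈ Finset.range (s₁ + 1), ∑ n₂ ∈ Finset.range (s₂ + 1),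
        |b n₁ n₂ (restrict (-(n₁ : ℤ)) n₂ x)| := by
        refine mul_le_mul_of_nonneg_left ?_ (pow_nonneg hγ.le _)
        exact (Finset.abs_sum_le_sum_abs _ _).trans
          (Finset.sum_le_sum fun _ _ => Finset.abs_sum_le_sum_abs _ _)
    _ ≤ ∑ n₁ ∈ Finset.range (s₁ + 1), ∑ n₂ ∈ Finset.range (s₂ + 1),
        γ ^ (s₁ - n₁) * γ ^ (s₂ - n₂) * M := by
        rw [Finset.mul_sum]
        refine Finset.sum_le_sum fun n₁ h₁ => ?_
        rw [Finset.mul_sum]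
        refine Finset.sum_le_sum fun n₂ h₂ => ?_
        rw [Finset.mem_range] at h₁ h₂
        have e : γ ^ (s₁ + s₂) = γ ^ (s₁ - n₁) * γ ^ (s₂ - n₂) * γ ^ (n₁ + n₂) := by
          rw [← pow_add, ← pow_add]
          congr 1
          omega
        rw [e, mul_assoc]
        exact mul_le_mul_of_nonneg_left (h _ _ _)
          (mul_nonneg (pow_nonneg hγ.le _) (pow_nonneg hγ.le _))
    _ = (∑ n₁ ∈ Finset.range (s₁ + 1), γ ^ (s₁ - n₁)) *
        (∑ n₂ ∈ Finset.range (s₂ + 1), γ ^ (s₂ - n₂)) * M := by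
        rw [Finset.sum_mul_sum, Finset.sum_mul]
        exact Finset.sum_congr rfl fun _ _ => (Finset.sum_mul _ _ _).symm
    _ ≤ (1 - γ)⁻¹ * (1 - γ)⁻¹ * M := by
        have h1 := sum_pow_sub_le hγ hγ1 s₁
        have h2 := sum_pow_sub_le hγ hγ1 s₂
        have h3 : 0 ≤ (1 - γ)⁻¹ := inv_nonneg.2 (by linarith)
        have h4 : 0 ≤ ∑ n₂ ∈ Finset.range (s₂ + 1), γ ^ (s₂ - n₂) :=
          Finset.sum_nonneg fun _ _ => pow_nonneg hγ.le _
        gcongr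

/-- Composition with the flow does not increase suprema, which makes the bound independent of time;
the factor 4 counts the terms of the double difference. -/
lemma NormLE.expansion (hγ : 0 < γ) (hγ1 : γ < 1) (h : NormLE γ b M) (t : ℝ) :
    NormLE γ (expansion Φ σ b t) (4 * ((1 - γ)⁻¹ * (1 - γ)⁻¹ * M)) := by
  have h1 : NormLE γ (transported Φ σ b t) ((1 - γ)⁻¹ * (1 - γ)⁻¹ * M) := fun s₁ s₂ x =>
    h.cumulative hγ hγ1 s₁ s₂ (flow Φ σ (-(s₁ : ℤ)) s₂ t x)
  have h2 := h1.doubleDiff hγ hγ1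
  intro s₁ s₂ x
  by_cases hx : x ∈ Allowed σ (-(s₁ : ℤ)) s₂
  · rw [expansion_eq_doubleDiff Φ σ b t s₁ s₂ hx]
    exact h2 s₁ s₂ x
  · rw [expansion_of_notMem _ _ _ _ hx, abs_zero, mul_zero]
    exact h2.nonneg hγ

lemma NormLE.abs_le (hγ : 0 < γ) (h : NormLE γ b M) (s₁ s₂ : ℕ)
    (x : Phase (-(s₁ : ℤ)) (s₂ : ℤ)) : |b s₁ s₂ x| ≤ M / γ ^ (s₁ + s₂) := by
  rw [le_div_iff₀ (pow_pos hγ _), mul_comm]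
  exact h s₁ s₂ x

/-- The expansion of initial data in `C_γ` is a generalized solution. -/
theorem IsPairPotential.isGeneralizedSolution_expansion (hΦ : IsPairPotential Φ σ R)
    (hγ : 0 < γ) (hγ1 : γ < 1) {B₀ : DoubleSeq} (hB : MemCGamma σ γ B₀) :
    IsGeneralizedSolution Φ σ γ B₀ (expansion Φ σ B₀) := by
  obtain ⟨hB, M, hM⟩ := hB
  have happ : ∀ s₁ s₂ : ℕ, ∃ g : ℕ → Phase (-(s₁ : ℤ)) (s₂ : ℤ) → ℝ, (∀ k, ContDiff ℝ 1 (g k)) ∧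
      TendstoLocallyUniformlyOn g (B₀ s₁ s₂) atTop (Allowed σ (-(s₁ : ℤ)) s₂) := fun s₁ s₂ =>
    exists_contDiff_tendstoLocallyUniformlyOn (isOpen_allowed σ _ _) (hB s₁ s₂).1
  choose g hg hgB using happ
  -- No norm bound for these approximations is needed: the weak equation only uses locally uniform
  -- convergence, and the estimates are made for `B₀` itself.
  set b : ℕ → DoubleSeq := fun k s₁ s₂ => indicator (Allowed σ (-(s₁ : ℤ)) s₂) (g s₁ s₂ k)
  have hsol : ∀ k, IsClassicalSolution Φ σ (b k) (expansion Φ σ (b k)) := fun k =>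
    hΦ.isClassicalSolution_expansion
      (fun s₁ s₂ => (hg s₁ s₂ k).contDiffOn.congr fun x hx => indicator_of_mem hx _)
      fun s₁ s₂ x hx => indicator_of_notMem hx _
  have hlim : TendstoFamily σ (fun k => expansion Φ σ (b k)) (expansion Φ σ B₀) :=
    hΦ.tendstoFamily_expansion fun s₁ s₂ =>
      (hgB s₁ s₂).congr fun k x hx => (indicator_of_mem hx _).symm
  have hnorm := fun t => hM.expansion (Φ := Φ) (σ := σ) hγ hγ1 t
  refine ⟨fun t => ⟨fun s₁ s₂ => ⟨hlim.continuousOn (fun k => (hsol k).smooth) t s₁ s₂,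
    fun x hx => expansion_of_notMem _ _ _ _ hx, _, fun x => (hnorm t).abs_le hγ s₁ s₂ x⟩,
    _, hnorm t⟩, fun T => ⟨_, fun t _ => hnorm t⟩, fun s₁ s₂ φ hφ t => ?_,
    hΦ.expansion_zero fun s₁ s₂ => (hB s₁ s₂).2.1⟩
  exact hΦ.weak_equation_of_tendsto hsol hlim s₁ s₂ hφ.ccOn hφ.contDiff_one t

end Norm

end TopologicalParticles

end

noncomputable section

namespace TopologicalParticles

open Set Filter Topology MeasureTheory
open scoped Convolution

/-! ### Mollification and uniform limits of pairings -/

section Mollification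

variable {E : Type*} [NormedAddCommGroup E] {U : Set E}

lemma fderiv_eq_zero_of_notMem [NormedSpace ℝ E] {K : Set E} (hK : IsClosed K) {ψ : E → ℝ}
    (h : ∀ x, x ∉ K → ψ x = 0) {x : E} (hx : x ∉ K) : fderiv ℝ ψ x = 0 := by
  have : ψ =ᶠ[𝓝 x] fun _ => 0 := by
    filter_upwards [hK.isOpen_compl.mem_nhds hx] with y hy using h y hy
  rw [this.fderiv_eq]
  simp

/-- Approximation of functions with compact support by smooth functions, together with the
derivatives. -/
lemma CcOn.exists_contDiff_approx [NormedSpace ℝ E] [FiniteDimensional ℝ E] (hU : IsOpen U)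
    {φ : E → ℝ} (hφ : CcOn U φ) :
    ∃ K, IsCompact K ∧ K ⊆ U ∧ (∀ x, x ∉ K → φ x = 0) ∧ ∀ ε > 0, ∃ ψ : E → ℝ,
      ContDiff ℝ ((⊤ : ℕ∞) : WithTop ℕ∞) ψ ∧ (∀ x, x ∉ K → ψ x = 0) ∧ (∀ x, |ψ x - φ x| ≤ ε) ∧
        (ContDiff ℝ 1 φ → ∀ x, ‖fderiv ℝ ψ x - fderiv ℝ φ x‖ ≤ ε) := by
  have hcs := hφ.hasCompactSupport
  obtain ⟨hc, K₀, hK₀, hK₀U, h0⟩ := hφ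
  obtain ⟨δ, hδ, hδU⟩ := hK₀.exists_cthickening_subset_open hU hK₀U
  have : ProperSpace E := FiniteDimensional.proper ℝ E
  refine ⟨Metric.cthickening δ K₀, hK₀.cthickening, hδU,
    fun x hx => h0 x fun h => hx (Metric.self_subset_cthickening _ h), fun ε hε => ?_⟩
  borelize E
  let μ : Measure E := Measure.addHaar
  obtain ⟨η, hη, hφη⟩ := Metric.uniformContinuous_iff.1
    (hcs.uniformContinuous_of_continuous hc) ε hε
  -- Differentiability is asked for only in the last clause, so that the lemma also serves functions
  -- that are merely continuous.
  obtain ⟨η', hη', hdη⟩ : ∃ η' > 0, ContDiff ℝ 1 φ → ∀ x y, dist x y < η' →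
      dist (fderiv ℝ φ x) (fderiv ℝ φ y) < ε := by
    by_cases hd : ContDiff ℝ 1 φ
    · obtain ⟨η', h1, h2⟩ := Metric.uniformContinuous_iff.1
        ((hcs.fderiv ℝ).uniformContinuous_of_continuous (hd.continuous_fderiv one_ne_zero)) ε hε
      exact ⟨η', h1, fun _ x y h => h2 h⟩
    · exact ⟨1, one_pos, fun h => absurd h hd⟩
  set r := min δ (min η η')
  have hr : 0 < r := lt_min hδ (lt_min hη hη')
  let β : ContDiffBump (0 : E) := ⟨r / 2, r, by positivity, by linarith⟩
  have hβ : β.rOut = r := rfl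
  refine ⟨β.normed μ ⋆[ContinuousLinearMap.lsmul ℝ ℝ, μ] φ, ?_, fun x hx => ?_, fun x => ?_,
    fun hd x => ?_⟩
  · exact β.hasCompactSupport_normed.contDiff_convolution_left _ β.contDiff_normed
      hc.locallyIntegrable
  · by_contra h
    obtain ⟨y, hy, z, hz, rfl⟩ := Set.mem_add.1 (support_convolution_subset_swap _ h)
    rw [β.support_normed_eq, mem_ball_zero_iff, hβ] at hz
    refine hx (Metric.mem_cthickening_of_dist_le _ y _ _ ?_ ?_)
    · by_contra h'
      exact hy (h0 y h')
    · rw [dist_eq_norm, add_sub_cancel_left]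
      exact hz.le.trans (min_le_left _ _)
  · rw [← Real.dist_eq]
    refine ContDiffBump.dist_normed_convolution_le hc.aestronglyMeasurable fun y hy => ?_
    rw [hβ] at hy
    exact (hφη (hy.trans_le ((min_le_right _ _).trans (min_le_left _ _)))).le
  · have h1 := hcs.hasFDerivAt_convolution_right (μ := μ) (ContinuousLinearMap.lsmul ℝ ℝ)
      (f := β.normed μ) β.continuous_normed.locallyIntegrable hd x
    have e : (β.normed μ ⋆[(ContinuousLinearMap.lsmul ℝ ℝ).precompR E, μ] fderiv ℝ φ) x =
        (β.normed μ ⋆[ContinuousLinearMap.lsmul ℝ ℝ, μ] fderiv ℝ φ) x := by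
      unfold convolution
      refine integral_congr_ae (Eventually.of_forall fun y => ?_)
      ext v
      simp [ContinuousLinearMap.precompR_apply]
    rw [h1.fderiv, e, ← dist_eq_norm]
    refine ContDiffBump.dist_normed_convolution_le
      (hd.continuous_fderiv one_ne_zero).aestronglyMeasurable fun y hy => ?_
    rw [hβ] at hy
    exact (hdη hd _ _ (hy.trans_le ((min_le_right _ _).trans (min_le_right _ _)))).le

/-- Uniform convergence, in time, of the integrals against uniformly convergent functions. -/
lemma tendstoUniformlyOn_integral_mul_right [MeasurableSpace E] [BorelSpace E] {μ : Measure E}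
    [IsFiniteMeasureOnCompacts μ] (hU : IsOpen U) {h : ℝ → E → ℝ} {T M : ℝ}
    (hc : ∀ t, ContinuousOn (h t) U) (hb : ∀ t, |t| ≤ T → ∀ x, |h t x| ≤ M)
    {K : Set E} (hK : IsCompact K) {ι : Type*} {l : Filter ι} {χ : ι → E → ℝ} {χ₀ : E → ℝ}
    (hχ : ∀ᶠ i in l, CcOn U (χ i)) (hχ₀ : CcOn U χ₀) (h0 : ∀ᶠ i in l, ∀ x, x ∉ K → χ i x = 0)
    (h0' : ∀ x, x ∉ K → χ₀ x = 0) (hlim : ∀ ε > 0, ∀ᶠ i in l, ∀ x, |χ i x - χ₀ x| ≤ ε) :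
    TendstoUniformlyOn (fun i t => ∫ x, h t x * χ i x ∂μ) (fun t => ∫ x, h t x * χ₀ x ∂μ) l
      (Ioo (-T) T) := by
  rw [Metric.tendstoUniformlyOn_iff]
  intro ε hε
  set C := |M| * μ.real K
  have hC : 0 ≤ C := mul_nonneg (abs_nonneg _) measureReal_nonneg
  filter_upwards [hχ, h0, hlim (ε / (C + 1)) (by positivity)] with i hi hi0 hil t ht
  have hbt : ∀ x, |h t x| ≤ |M| := fun x =>
    (hb t (abs_le.2 ⟨ht.1.le, ht.2.le⟩) x).trans (le_abs_self M)
  rw [dist_comm, dist_eq_norm, ← integral_sub (hi.mul_left hU (hc t)).integrable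
    (hχ₀.mul_left hU (hc t)).integrable]
  calc ‖∫ x, (h t x * χ i x - h t x * χ₀ x) ∂μ‖
      ≤ ∫ x, K.indicator (fun _ => |M| * (ε / (C + 1))) x ∂μ := by
        refine norm_integral_le_of_norm_le ?_ (Eventually.of_forall fun x => ?_)
        · exact (integrable_indicator_iff hK.measurableSet).2
            (integrableOn_const hK.measure_lt_top.ne)
        · by_cases hx : x ∈ K
          · rw [indicator_of_mem hx, ← mul_sub, norm_mul]
            exact mul_le_mul (hbt x) (hil x) (abs_nonneg _) (abs_nonneg _)
          · rw [indicator_of_notMem hx, hi0 x hx, h0' x hx, sub_self, norm_zero]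
    _ = ε / (C + 1) * C := by
        rw [integral_indicator_const _ hK.measurableSet, smul_eq_mul]
        ring
    _ < ε := by
        rw [div_mul_eq_mul_div, div_lt_iff₀ (by positivity)]
        nlinarith

/-- Difference quotients converge uniformly on compact sets. -/
lemma eventually_abs_sub_le_of_hasDerivAt {P D : ℝ → E → ℝ} {K : Set E} (hK : IsCompact K)
    {s₀ : ℝ} (hP : ∀ x s, HasDerivAt (fun s => P s x) (D s x) s)
    (hD : ∀ x ∈ K, ContinuousAt (fun z : ℝ × E => D z.1 z.2) (s₀, x)) {ε : ℝ} (hε : 0 < ε) :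
    ∀ᶠ s in 𝓝 s₀, ∀ x ∈ K, |P s x - P s₀ x - (s - s₀) * D s₀ x| ≤ ε * |s - s₀| := by
  have h1 : ∀ᶠ s in 𝓝 s₀, ∀ x ∈ K, |D s x - D s₀ x| < ε := by
    refine hK.eventually_forall_of_forall_eventually
      (P := fun s x => |D s x - D s₀ x| < ε) fun x hx => ?_
    have hc : ContinuousAt (fun z : ℝ × E => |D z.1 z.2 - D s₀ z.2|) (s₀, x) := by
      refine ((hD x hx).sub ?_).abs
      exact ContinuousAt.comp (f := fun z : ℝ × E => (s₀, z.2)) (g := fun z : ℝ × E => D z.1 z.2)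
        (hD x hx) (by fun_prop)
    exact hc.eventually_lt continuousAt_const (by simpa using hε)
  obtain ⟨δ, hδ, hball⟩ := Metric.eventually_nhds_iff_ball.1 h1
  filter_upwards [Metric.ball_mem_nhds s₀ hδ] with s hs x hx
  -- The mean value inequality is applied to `P τ x - τ * D s₀ x`, whose derivative is at most `ε`
  -- near `s₀`.
  have hder : ∀ τ ∈ Metric.ball s₀ δ, HasDerivWithinAt (fun τ => P τ x - τ * D s₀ x)
      (D τ x - D s₀ x) (Metric.ball s₀ δ) τ := fun τ _ => by
    have := (hP x τ).sub ((hasDerivAt_id τ).mul_const (D s₀ x))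
    rw [one_mul] at this
    exact this.hasDerivWithinAt
  have key := (convex_ball s₀ δ).norm_image_sub_le_of_norm_hasDerivWithin_le hder
    (fun τ hτ => (hball τ hτ x hx).le) (Metric.mem_ball_self hδ) hs
  rw [Real.norm_eq_abs, Real.norm_eq_abs] at key
  convert key using 2
  ring

end Mollification

end TopologicalParticles

end

noncomputable section

namespace TopologicalParticles

open Set Filter Topology MeasureTheory

/-! ### Weak solutions of the Liouville equation and their test functions -/

section WeakLiouville

variable {Φ : ℝ → ℝ} {σ R : ℝ} {a b : ℤ} {h : ℝ → Phase a b → ℝ}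

lemma liouvilleStar_eq_fderiv (φ : Phase a b → ℝ) (x : Phase a b) :
    liouvilleStar Φ a b φ x = -fderiv ℝ φ x (vectorField Φ x) := by
  rw [← liouville_eq_fderiv, liouville, neg_neg]

lemma IsPairPotential.continuousOn_vectorField (hΦ : IsPairPotential Φ σ R) :
    ContinuousOn (vectorField Φ : Phase a b → Phase a b) (Allowed σ a b) := by
  refine continuousOn_pi.2 fun i => ContinuousOn.prodMk (by fun_prop) ?_
  simp_rw [force_eq_sum]
  refine ContinuousOn.add (continuousOn_finsetSum _ fun j _ => ?_)
    (continuousOn_finsetSum _ fun j _ => ?_)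
  · split_ifs with hij
    · exact (hΦ.contDiffOn_coefficient hij).continuousOn.neg
    · exact continuousOn_const
  · split_ifs with hij
    · exact (hΦ.contDiffOn_coefficient hij).continuousOn
    · exact continuousOn_const

/-- Locally bounded weak solutions of the Liouville equation. -/
structure IsWeakLiouvilleSolution (Φ : ℝ → ℝ) (σ : ℝ) (a b : ℤ) (h : ℝ → Phase a b → ℝ) :
    Prop where
  continuousOn : ∀ t, ContinuousOn (h t) (Allowed σ a b)
  locally_bounded : ∀ T, ∃ M, ∀ t, |t| ≤ T → ∀ x, |h t x| ≤ M
  equation : ∀ φ, IsTest σ a b φ → ∀ t,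
    HasDerivAt (fun τ => ∫ x, h τ x * φ x) (∫ x, h t x * liouvilleStar Φ a b φ x) t

lemma mem_Ioo_abs_add_one (t : ℝ) : t ∈ Ioo (-(|t| + 1)) (|t| + 1) := by
  rw [mem_Ioo, ← abs_lt]
  exact lt_add_one _

lemma isTest_of_notMem {K : Set (Phase a b)} (hK : IsCompact K) (hKU : K ⊆ Allowed σ a b)
    {ψ : Phase a b → ℝ} (hψ : ContDiff ℝ ((⊤ : ℕ∞) : WithTop ℕ∞) ψ)
    (h0 : ∀ x, x ∉ K → ψ x = 0) : IsTest σ a b ψ := by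
  have h : CcOn (Allowed σ a b) ψ := ⟨hψ.continuous, K, hK, hKU, h0⟩
  exact ⟨hψ, h.hasCompactSupport, h.tsupport_subset⟩

lemma eventually_one_div_le {ε : ℝ} (hε : 0 < ε) : ∀ᶠ n : ℕ in atTop, 1 / ((n : ℝ) + 1) ≤ ε :=
  (tendsto_one_div_add_atTop_nhds_zero_nat.eventually_lt_const hε).mono fun _ h => h.le

/-- Nothing is assumed about the regularity of `h` in time. Pairings with smooth test functions are
differentiable by the equation, and local boundedness carries their continuity over to uniform
limits. -/
lemma IsWeakLiouvilleSolution.continuous_integral (hh : IsWeakLiouvilleSolution Φ σ a b h)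
    {χ : Phase a b → ℝ} (hχ : CcOn (Allowed σ a b) χ) :
    Continuous fun t => ∫ x, h t x * χ x := by
  have hU := isOpen_allowed σ a b
  obtain ⟨K, hK, hKU, h0, happ⟩ := hχ.exists_contDiff_approx hU
  have happ' : ∀ n : ℕ, _ := fun n => happ (1 / ((n : ℝ) + 1)) (by positivity)
  choose ψ hψ hψ0 hψχ _ using happ'
  refine continuous_iff_continuousAt.2 fun t => ?_
  obtain ⟨M, hM⟩ := hh.locally_bounded (|t| + 1)
  have hψt : ∀ n, IsTest σ a b (ψ n) := fun n => isTest_of_notMem hK hKU (hψ n) (hψ0 n)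
  have hlim := tendstoUniformlyOn_integral_mul_right (μ := volume) hU hh.continuousOn hM hK
    (l := atTop) (Eventually.of_forall fun n => (hψt n).ccOn) hχ
    (Eventually.of_forall hψ0) h0 fun ε hε =>
      (eventually_one_div_le hε).mono fun n hn x => (hψχ n x).trans hn
  have hcont := hlim.continuousOn (Frequently.of_forall fun n τ _ =>
    (hh.equation _ (hψt n) τ).continuousAt.continuousWithinAt)
  exact hcont.continuousAt (isOpen_Ioo.mem_nhds (mem_Ioo_abs_add_one t))

/-- The weak equation holds for continuously differentiable test functions. -/
lemma IsWeakLiouvilleSolution.equation_of_contDiff (hΦ : IsPairPotential Φ σ R)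
    (hh : IsWeakLiouvilleSolution Φ σ a b h)
    {φ : Phase a b → ℝ} (hφ : CcOn (Allowed σ a b) φ) (hd : ContDiff ℝ 1 φ) (t : ℝ) :
    HasDerivAt (fun τ => ∫ x, h τ x * φ x) (∫ x, h t x * liouvilleStar Φ a b φ x) t := by
  have hU := isOpen_allowed σ a b
  obtain ⟨K, hK, hKU, h0, happ⟩ := hφ.exists_contDiff_approx hU
  have happ' : ∀ n : ℕ, _ := fun n => happ (1 / ((n : ℝ) + 1)) (by positivity)
  choose ψ hψ hψ0 hψφ hψd using happ'
  obtain ⟨M, hM⟩ := hh.locally_bounded (|t| + 1)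
  have hψt : ∀ n, IsTest σ a b (ψ n) := fun n => isTest_of_notMem hK hKU (hψ n) (hψ0 n)
  have hlim := tendstoUniformlyOn_integral_mul_right (μ := volume) hU hh.continuousOn hM hK
    (l := atTop) (Eventually.of_forall fun n => (hψt n).ccOn) hφ
    (Eventually.of_forall hψ0) h0 fun ε hε =>
      (eventually_one_div_le hε).mono fun n hn x => (hψφ n x).trans hn
  have hstar0 : ∀ χ : Phase a b → ℝ, (∀ x, x ∉ K → χ x = 0) → ∀ x, x ∉ K →
      liouvilleStar Φ a b χ x = 0 := fun χ hχ x hx => by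
    rw [liouvilleStar_eq_fderiv, fderiv_eq_zero_of_notMem hK.isClosed hχ hx]
    simp
  -- The vector field is bounded on `K`, so convergence of the derivatives of `ψ n` gives uniform
  -- convergence of their Liouville images.
  obtain ⟨C, hC⟩ := hK.exists_bound_of_continuousOn (hΦ.continuousOn_vectorField.mono hKU)
  have hlim' := tendstoUniformlyOn_integral_mul_right (μ := volume) hU hh.continuousOn hM hK
    (l := atTop) (χ := fun n => liouvilleStar Φ a b (ψ n))
    (Eventually.of_forall fun n => hΦ.ccOn_liouvilleStar (hψt n).ccOn (hψt n).contDiff_one)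
    (hΦ.ccOn_liouvilleStar hφ hd) (Eventually.of_forall fun n => hstar0 _ (hψ0 n))
    (hstar0 _ h0) fun ε hε => ?_
  · exact hasDerivAt_of_tendstoUniformlyOn isOpen_Ioo hlim'
      (Eventually.of_forall fun n τ _ => hh.equation _ (hψt n) τ)
      (fun τ hτ => hlim.tendsto_at hτ) (mem_Ioo_abs_add_one t)
  · filter_upwards [eventually_one_div_le (show 0 < ε / (|C| + 1) by positivity)] with n hn x
    by_cases hx : x ∈ K
    · have e : liouvilleStar Φ a b (ψ n) x - liouvilleStar Φ a b φ x =
          -((fderiv ℝ (ψ n) x - fderiv ℝ φ x) (vectorField Φ x)) := by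
        rw [liouvilleStar_eq_fderiv, liouvilleStar_eq_fderiv, sub_apply]
        ring
      rw [e, abs_neg, ← Real.norm_eq_abs]
      calc ‖(fderiv ℝ (ψ n) x - fderiv ℝ φ x) (vectorField Φ x)‖
          ≤ ‖fderiv ℝ (ψ n) x - fderiv ℝ φ x‖ * ‖vectorField Φ x‖ :=
            ContinuousLinearMap.le_opNorm _ _
        _ ≤ ε / (|C| + 1) * (|C| + 1) := by
            refine mul_le_mul ((hψd n hd x).trans hn) ?_ (norm_nonneg _) (by positivity)
            exact (hC x hx).trans ((le_abs_self C).trans (le_add_of_nonneg_right zero_le_one))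
        _ = ε := div_mul_cancel₀ _ (by positivity)
    · rw [hstar0 _ (hψ0 n) x hx, hstar0 _ h0 x hx, sub_self, abs_zero]
      exact hε.le

end WeakLiouville

/-! ### Test functions transported by the flow -/

section Transport

variable {Φ : ℝ → ℝ} {σ R : ℝ} {a b : ℤ} {ψ : Phase a b → ℝ}

/-- The function `ψ ∘ flow s` on allowed phase points, zero on the forbidden ones. -/
def pullback (Φ : ℝ → ℝ) (σ : ℝ) {a b : ℤ} (ψ : Phase a b → ℝ) (s : ℝ) : Phase a b → ℝ :=
  indicator (Allowed σ a b) fun x => ψ (flow Φ σ a b s x)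

lemma pullback_of_mem {x : Phase a b} (hx : x ∈ Allowed σ a b) (s : ℝ) :
    pullback Φ σ ψ s x = ψ (flow Φ σ a b s x) := indicator_of_mem hx _

lemma pullback_of_notMem {x : Phase a b} (hx : x ∉ Allowed σ a b) (s : ℝ) :
    pullback Φ σ ψ s x = 0 := indicator_of_notMem hx _

lemma IsPairPotential.pullback_zero (hΦ : IsPairPotential Φ σ R) (hψ : CcOn (Allowed σ a b) ψ) :
    pullback Φ σ ψ 0 = ψ := by
  funext x
  by_cases hx : x ∈ Allowed σ a b
  · rw [pullback_of_mem hx, hΦ.flow_zero hx]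
  · rw [pullback_of_notMem hx, image_eq_zero_of_notMem_tsupport fun h => hx (hψ.tsupport_subset h)]

/-- The support at time `s` is the image of `K` under the flow at time `-s`; for `|s| ≤ S` all of
these lie in the image of `[-S, S] × K`. -/
lemma IsPairPotential.exists_isCompact_pullback (hΦ : IsPairPotential Φ σ R)
    (hψ : CcOn (Allowed σ a b) ψ) (S : ℝ) :
    ∃ K, IsCompact K ∧ K ⊆ Allowed σ a b ∧
      ∀ s, |s| ≤ S → ∀ x, x ∉ K → pullback Φ σ ψ s x = 0 := by
  obtain ⟨-, K, hK, hKU, h0⟩ := hψ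
  refine ⟨(fun z : ℝ × Phase a b => flow Φ σ a b z.1 z.2) '' (Icc (-S) S ×ˢ K),
    (isCompact_Icc.prod hK).image_of_continuousOn
      (hΦ.contDiffOn_flow.continuousOn.mono (prod_mono (subset_univ _) hKU)), ?_, ?_⟩
  · rintro _ ⟨z, hz, rfl⟩
    exact hΦ.flow_mem (hKU hz.2) _
  · intro s hs x hx
    by_cases hxU : x ∈ Allowed σ a b
    · rw [pullback_of_mem hxU]
      refine h0 _ fun hmem => hx ⟨(-s, flow Φ σ a b s x), ⟨?_, hmem⟩, ?_⟩
      · have := abs_le.1 hs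
        exact ⟨by linarith, by linarith⟩
      · show flow Φ σ a b (-s) (flow Φ σ a b s x) = x
        rw [hΦ.flow_flow hxU, neg_add_cancel, hΦ.flow_zero hxU]
    · exact pullback_of_notMem hxU s

lemma IsPairPotential.contDiffOn_pullback (hΦ : IsPairPotential Φ σ R) (hd : ContDiff ℝ 1 ψ) :
    ContDiffOn ℝ 1 (fun z : ℝ × Phase a b => pullback Φ σ ψ z.1 z.2)
      (univ ×ˢ Allowed σ a b) :=
  (hd.comp_contDiffOn hΦ.contDiffOn_flow).congr fun _ hz => pullback_of_mem hz.2 _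

lemma contDiff_of_contDiffOn_of_eq_zero {E : Type*} [NormedAddCommGroup E] [NormedSpace ℝ E]
    {U K : Set E} (hU : IsOpen U) (hK : IsClosed K) (hKU : K ⊆ U) {f : E → ℝ}
    (hf : ContDiffOn ℝ 1 f U) (h0 : ∀ x, x ∉ K → f x = 0) : ContDiff ℝ 1 f := by
  refine contDiff_iff_contDiffAt.2 fun x => ?_
  by_cases hx : x ∈ K
  · exact hf.contDiffAt (hU.mem_nhds (hKU hx))
  · refine (contDiffAt_const (c := (0 : ℝ))).congr_of_eventuallyEq ?_
    filter_upwards [hK.isOpen_compl.mem_nhds hx] with y hy using h0 y hy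

lemma IsPairPotential.contDiff_pullback (hΦ : IsPairPotential Φ σ R)
    (hψ : CcOn (Allowed σ a b) ψ) (hd : ContDiff ℝ 1 ψ) (s : ℝ) :
    ContDiff ℝ 1 (pullback Φ σ ψ s) ∧ CcOn (Allowed σ a b) (pullback Φ σ ψ s) := by
  obtain ⟨K, hK, hKU, h0⟩ := hΦ.exists_isCompact_pullback hψ |s|
  have h1 : ContDiffOn ℝ 1 (pullback Φ σ ψ s) (Allowed σ a b) :=
    (hΦ.contDiffOn_pullback hd).comp (f := fun x => (s, x)) (by fun_prop)
      fun x hx => ⟨trivial, hx⟩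
  have h2 := contDiff_of_contDiffOn_of_eq_zero (isOpen_allowed σ a b) hK.isClosed hKU h1
    (h0 s le_rfl)
  exact ⟨h2, h2.continuous, K, hK, hKU, h0 s le_rfl⟩

/-- By the group property, `pullback τ` is `pullback s` composed with the flow over the time `τ -
s`. At forbidden points both sides are zero. -/
lemma IsPairPotential.hasDerivAt_pullback (hΦ : IsPairPotential Φ σ R)
    (hψ : CcOn (Allowed σ a b) ψ) (hd : ContDiff ℝ 1 ψ) (x : Phase a b) (s : ℝ) :
    HasDerivAt (fun s => pullback Φ σ ψ s x) (liouville Φ a b (pullback Φ σ ψ s) x) s := by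
  obtain ⟨h1, h2⟩ := hΦ.contDiff_pullback hψ hd s
  rw [liouville_eq_fderiv]
  by_cases hx : x ∈ Allowed σ a b
  · have hfl : HasDerivAt (fun τ => flow Φ σ a b (τ - s) x) (vectorField Φ x) s := by
      have h := hΦ.hasDerivAt_flow hx 0
      rw [hΦ.flow_zero hx] at h
      have h' : HasDerivAt (fun s => flow Φ σ a b s x) (vectorField Φ x) (s - s) := by
        rwa [sub_self]
      exact h'.comp_sub_const s s
    have e : (fun τ => pullback Φ σ ψ τ x) = fun τ =>
        pullback Φ σ ψ s (flow Φ σ a b (τ - s) x) := by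
      funext τ
      rw [pullback_of_mem hx, pullback_of_mem (hΦ.flow_mem hx _), hΦ.flow_flow hx,
        add_sub_cancel]
    have hx' : flow Φ σ a b (s - s) x = x := by rw [sub_self, hΦ.flow_zero hx]
    rw [e]
    exact HasFDerivAt.comp_hasDerivAt s
      (by rw [hx']; exact (h1.differentiable one_ne_zero x).hasFDerivAt) hfl
  · have e : (fun τ => pullback Φ σ ψ τ x) = fun _ => 0 :=
      funext fun τ => pullback_of_notMem hx τ
    have h3 : fderiv ℝ (pullback Φ σ ψ s) x = 0 :=
      fderiv_eq_zero_of_notMem (isClosed_tsupport _)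
        (fun y hy => image_eq_zero_of_notMem_tsupport hy) fun h => hx (h2.tsupport_subset h)
    rw [e, h3]
    exact hasDerivAt_const _ _

/-- The Liouville image is the time derivative of a jointly `C¹` function, hence jointly continuous.
-/
lemma IsPairPotential.continuousOn_liouville_pullback (hΦ : IsPairPotential Φ σ R)
    (hψ : CcOn (Allowed σ a b) ψ) (hd : ContDiff ℝ 1 ψ) :
    ContinuousOn (fun z : ℝ × Phase a b => liouville Φ a b (pullback Φ σ ψ z.1) z.2)
      (univ ×ˢ Allowed σ a b) := by
  have hP := hΦ.contDiffOn_pullback (a := a) (b := b) hd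
  have hUo := isOpen_univ_prod_allowed σ a b
  have h1 : ContinuousOn (fun z : ℝ × Phase a b =>
      fderiv ℝ (fun z : ℝ × Phase a b => pullback Φ σ ψ z.1 z.2) z ((1 : ℝ), (0 : Phase a b)))
      (univ ×ˢ Allowed σ a b) :=
    (hP.continuousOn_fderiv_of_isOpen hUo le_rfl).clm_apply continuousOn_const
  refine h1.congr fun z hz => ?_
  have hF := ((hP.contDiffAt (hUo.mem_nhds hz)).differentiableAt one_ne_zero).hasFDerivAt
  have h2 := hF.comp_hasDerivAt (f := fun s => (s, z.2)) z.1
    ((hasDerivAt_id z.1).prodMk (hasDerivAt_const z.1 z.2))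
  exact (hΦ.hasDerivAt_pullback hψ hd z.2 z.1).unique h2

variable {h : ℝ → Phase a b → ℝ}

/-- The pairing of a weak solution with a transported test function is constant in time. -/
lemma IsWeakLiouvilleSolution.hasDerivAt_pairing (hΦ : IsPairPotential Φ σ R)
    (hh : IsWeakLiouvilleSolution Φ σ a b h) (hψ : CcOn (Allowed σ a b) ψ)
    (hd : ContDiff ℝ 1 ψ) (T t : ℝ) :
    HasDerivAt (fun τ => ∫ x, h τ x * pullback Φ σ ψ (τ - T) x) 0 t := by
  have hU := isOpen_allowed σ a b
  have hpc := fun s => hΦ.contDiff_pullback hψ hd s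
  set ψ₀ := pullback Φ σ ψ (t - T) with hψ₀
  have hD : CcOn (Allowed σ a b) (liouville Φ a b ψ₀) :=
    (hΦ.ccOn_liouvilleStar (hpc (t - T)).2 (hpc (t - T)).1).neg
  -- A product rule: `h1` varies the solution against the test function frozen at time `t`, and `h2`
  -- treats the change of the test function. Their derivatives are the integrals of `h t` against
  -- `L^*` and `L` of the same function, which cancel.
  have h1 := hh.equation_of_contDiff hΦ (hpc (t - T)).2 (hpc (t - T)).1 t
  have h2 : HasDerivAt (fun τ => ∫ x, h τ x * (pullback Φ σ ψ (τ - T) x - ψ₀ x))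
      (∫ x, h t x * liouville Φ a b ψ₀ x) t := by
    rw [hasDerivAt_iff_tendsto_slope]
    -- The difference quotients converge uniformly to `liouville ψ₀` with supports in one compact
    -- set. Local boundedness of `h` allows `q τ` to be replaced by this limit, and
    -- `continuous_integral` then lets `τ` tend to `t`.
    set q : ℝ → Phase a b → ℝ := fun τ x => (τ - t)⁻¹ * (pullback Φ σ ψ (τ - T) x - ψ₀ x)
    have hslope : (fun τ => ∫ x, h τ x * q τ x) =
        slope (fun τ => ∫ x, h τ x * (pullback Φ σ ψ (τ - T) x - ψ₀ x)) t := by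
      funext τ
      have e0 : ∫ x, h t x * (pullback Φ σ ψ (t - T) x - ψ₀ x) = 0 := by simp [hψ₀]
      rw [slope_def_field, e0, sub_zero, div_eq_inv_mul, ← integral_const_mul]
      refine integral_congr_ae (Eventually.of_forall fun x => ?_)
      show h τ x * ((τ - t)⁻¹ * (pullback Φ σ ψ (τ - T) x - ψ₀ x)) = _
      ring
    rw [← hslope]
    obtain ⟨M, hM⟩ := hh.locally_bounded (|t| + 1)
    obtain ⟨K, hK, hKU, h0⟩ := hΦ.exists_isCompact_pullback hψ (|t - T| + 1)
    have hK0 : ∀ x, x ∉ K → ψ₀ x = 0 := h0 _ (by linarith)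
    have hD0 : ∀ x, x ∉ K → liouville Φ a b ψ₀ x = 0 := fun x hx => by
      rw [liouville_eq_fderiv, fderiv_eq_zero_of_notMem hK.isClosed hK0 hx]
      rfl
    have hnear : ∀ᶠ τ in 𝓝[≠] t, |τ - T| ≤ |t - T| + 1 := by
      have h3 : ∀ᶠ τ in 𝓝 t, |τ - T| < |t - T| + 1 :=
        ContinuousAt.eventually_lt (by fun_prop) continuousAt_const (lt_add_one _)
      exact (h3.filter_mono nhdsWithin_le_nhds).mono fun _ h => h.le
    have hq : ∀ τ, CcOn (Allowed σ a b) (q τ) := fun τ =>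
      ((hpc _).2.sub (hpc _).2).mul_left hU continuousOn_const
    have hlim := tendstoUniformlyOn_integral_mul_right (μ := volume) hU hh.continuousOn hM hK
      (l := 𝓝[≠] t) (χ := q) (Eventually.of_forall hq) hD
      (hnear.mono fun τ hτ x hx => by simp [q, h0 _ hτ x hx, hK0 x hx]) hD0 fun ε hε => ?_
    · have hcont := (hh.continuous_integral hD).tendsto t
      rw [Metric.tendsto_nhds] at hcont ⊢
      intro ε hε
      have h3 := (hcont (ε / 2) (by positivity)).filter_mono
        (nhdsWithin_le_nhds (s := {t}ᶜ))
      have h4 := Metric.tendstoUniformlyOn_iff.1 hlim (ε / 2) (by positivity)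
      have h5 : ∀ᶠ τ in 𝓝[≠] t, τ ∈ Ioo (-(|t| + 1)) (|t| + 1) :=
        nhdsWithin_le_nhds (isOpen_Ioo.mem_nhds (mem_Ioo_abs_add_one t))
      filter_upwards [h3, h4, h5] with τ h3 h4 h5
      have h6 := h4 τ h5
      rw [dist_comm] at h6
      linarith [dist_triangle (∫ x, h τ x * q τ x) (∫ x, h τ x * liouville Φ a b ψ₀ x)
        (∫ x, h t x * liouville Φ a b ψ₀ x)]
    · have h3 := eventually_abs_sub_le_of_hasDerivAt (s₀ := t - T) hK
        (hΦ.hasDerivAt_pullback hψ hd) (fun x hx =>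
          (hΦ.continuousOn_liouville_pullback hψ hd).continuousAt
            ((isOpen_univ_prod_allowed σ a b).mem_nhds ⟨trivial, hKU hx⟩)) hε
      have h4 : Tendsto (fun τ => τ - T) (𝓝[≠] t) (𝓝 (t - T)) :=
        ((continuous_sub_right T).tendsto t).mono_left nhdsWithin_le_nhds
      filter_upwards [h4.eventually h3, hnear, self_mem_nhdsWithin] with τ hτ hτn hne x
      by_cases hx : x ∈ K
      · have hne' : τ - t ≠ 0 := sub_ne_zero.2 hne
        have h5 := hτ x hx
        rw [sub_sub_sub_cancel_right] at h5
        have e : q τ x - liouville Φ a b ψ₀ x = (τ - t)⁻¹ *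
            (pullback Φ σ ψ (τ - T) x - ψ₀ x - (τ - t) * liouville Φ a b ψ₀ x) := by
          simp only [q]
          field_simp
        rw [e, abs_mul, abs_inv, inv_mul_le_iff₀ (abs_pos.2 hne'), mul_comm |τ - t|]
        exact h5
      · simp only [q]
        rw [h0 _ hτn x hx, hK0 x hx, hD0 x hx]
        simpa using hε.le
  have hsum := h1.add h2
  have e1 : (∫ x, h t x * liouvilleStar Φ a b ψ₀ x) + ∫ x, h t x * liouville Φ a b ψ₀ x = 0 := by
    simp only [liouville, mul_neg]
    rw [integral_neg, add_neg_cancel]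
  rw [e1] at hsum
  refine hsum.congr_of_eventuallyEq (Eventually.of_forall fun τ => ?_)
  show _ = (∫ x, h τ x * ψ₀ x) + ∫ x, h τ x * (pullback Φ σ ψ (τ - T) x - ψ₀ x)
  rw [← integral_add ((hpc _).2.mul_left hU (hh.continuousOn τ)).integrable
    (((hpc _).2.sub (hpc _).2).mul_left hU (hh.continuousOn τ)).integrable]
  refine integral_congr_ae (Eventually.of_forall fun x => ?_)
  simp only
  ring

/-- Weak solutions of the Liouville equation with zero initial data vanish. -/
theorem IsWeakLiouvilleSolution.eq_zero (hΦ : IsPairPotential Φ σ R)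
    (hh : IsWeakLiouvilleSolution Φ σ a b h) (h0 : ∀ x, h 0 x = 0) (t : ℝ) {x : Phase a b}
    (hx : x ∈ Allowed σ a b) : h t x = 0 := by
  have hU := isOpen_allowed σ a b
  have key : ∀ ψ, IsTest σ a b ψ → ∫ x, h t x * ψ x = 0 := by
    intro ψ hψ
    -- The constant pairing is the wanted integral at `τ = t`, where the test function is `ψ`
    -- itself, and zero at `τ = 0`.
    have hder := hh.hasDerivAt_pairing hΦ hψ.ccOn hψ.contDiff_one t
    have := is_const_of_deriv_eq_zero (fun τ => (hder τ).differentiableAt)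
      (fun τ => (hder τ).deriv) t 0
    simpa [hΦ.pullback_zero hψ.ccOn, h0] using this
  -- The fundamental lemma gives zero almost everywhere; continuity on the open set of allowed
  -- points gives it everywhere there.
  have hae := hU.ae_eq_zero_of_integral_contDiff_smul_eq_zero (μ := volume)
    ((hh.continuousOn t).locallyIntegrableOn hU.measurableSet) fun g hg hgc hgs => by
      rw [← key g ⟨hg, hgc, hgs⟩]
      exact integral_congr_ae (Eventually.of_forall fun x => mul_comm _ _)
  have hae' : h t =ᵐ[volume.restrict (Allowed σ a b)] fun _ => 0 :=
    (ae_restrict_iff' hU.measurableSet).2 hae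
  exact Measure.eqOn_open_of_ae_eq hae' hU (hh.continuousOn t) continuousOn_const hx

end Transport

/-! ### Uniqueness of generalized solutions -/

section Uniqueness

variable {Φ : ℝ → ℝ} {σ R γ : ℝ}

lemma continuousOn_createLeft {V : DoubleSeq}
    (hV : ∀ s₁ s₂ : ℕ, ContinuousOn (V s₁ s₂) (Allowed σ (-(s₁ : ℤ)) s₂)) (s₁ s₂ : ℕ) :
    ContinuousOn (createLeft V s₁ s₂) (Allowed σ (-(s₁ : ℤ)) s₂) := by
  cases s₁ with
  | zero => exact continuousOn_const
  | succ m =>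
    have hc : -((m + 1 : ℕ) : ℤ) ≤ -(m : ℤ) := by push_cast; omega
    exact (hV m s₂).comp (continuous_restrict _ _ _ _).continuousOn
      fun x hx => restrict_mem_allowed hx hc le_rfl

lemma continuousOn_createRight {V : DoubleSeq}
    (hV : ∀ s₁ s₂ : ℕ, ContinuousOn (V s₁ s₂) (Allowed σ (-(s₁ : ℤ)) s₂)) (s₁ s₂ : ℕ) :
    ContinuousOn (createRight V s₁ s₂) (Allowed σ (-(s₁ : ℤ)) s₂) := by
  cases s₂ with
  | zero => exact continuousOn_const
  | succ m =>
    have hc : (m : ℤ) ≤ ((m + 1 : ℕ) : ℤ) := by push_cast; omega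
    exact (hV s₁ m).comp (continuous_restrict _ _ _ _).continuousOn
      fun x hx => restrict_mem_allowed hx le_rfl hc

/-- The triangular induction again: the source terms, having one particle less, agree for both
solutions and drop out of the difference, which is then a locally bounded weak solution of the
Liouville equation with zero initial data. -/
theorem IsPairPotential.generalizedSolution_unique (hΦ : IsPairPotential Φ σ R) (hγ : 0 < γ)
    {B₀ : DoubleSeq} {B C : ℝ → DoubleSeq} (hB : IsGeneralizedSolution Φ σ γ B₀ B)
    (hC : IsGeneralizedSolution Φ σ γ B₀ C) : B = C := by
  have cB : ∀ t, ∀ s₁ s₂ : ℕ, ContinuousOn (B t s₁ s₂) (Allowed σ (-(s₁ : ℤ)) s₂) :=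
    fun t s₁ s₂ => ((hB.mem t).1 s₁ s₂).1
  have cC : ∀ t, ∀ s₁ s₂ : ℕ, ContinuousOn (C t s₁ s₂) (Allowed σ (-(s₁ : ℤ)) s₂) :=
    fun t s₁ s₂ => ((hC.mem t).1 s₁ s₂).1
  have key : ∀ n s₁ s₂ : ℕ, s₁ + s₂ = n → ∀ t, B t s₁ s₂ = C t s₁ s₂ := by
    intro n
    induction n using Nat.strong_induction_on with
    | _ n ih =>
      intro s₁ s₂ hn t
      have hU := isOpen_allowed σ (-(s₁ : ℤ)) s₂
      have hlt : ∀ t n₁ n₂, n₁ + n₂ < s₁ + s₂ → B t n₁ n₂ = C t n₁ n₂ := fun t n₁ n₂ h' =>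
        ih (n₁ + n₂) (by omega) n₁ n₂ rfl t
      have hint : ∀ f g : Phase (-(s₁ : ℤ)) (s₂ : ℤ) → ℝ,
          CcOn (Allowed σ (-(s₁ : ℤ)) s₂) g → ContinuousOn f (Allowed σ (-(s₁ : ℤ)) s₂) →
          Integrable fun x => f x * g x := fun f g hg hf => (hg.mul_left hU hf).integrable
      have hw : IsWeakLiouvilleSolution Φ σ (-(s₁ : ℤ)) s₂
          fun t x => B t s₁ s₂ x - C t s₁ s₂ x := by
        refine ⟨fun t => (cB t s₁ s₂).sub (cC t s₁ s₂), fun T => ?_, fun φ hφ t => ?_⟩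
        · obtain ⟨M, hM⟩ := hB.locally_bounded T
          obtain ⟨M', hM'⟩ := hC.locally_bounded T
          exact ⟨M / γ ^ (s₁ + s₂) + M' / γ ^ (s₁ + s₂), fun t ht x => (abs_sub _ _).trans
            (add_le_add ((hM t ht).abs_le hγ s₁ s₂ x) ((hM' t ht).abs_le hγ s₁ s₂ x))⟩
        · have c1 := hΦ.ccOn_liouvilleStar hφ.ccOn hφ.contDiff_one
          have c2 := hΦ.ccOn_liouvilleStarInt hφ.ccOn hφ.contDiff_one (-(s₁ : ℤ))
          have c3 := hΦ.ccOn_liouvilleStarInt hφ.ccOn hφ.contDiff_one ((s₂ : ℤ) - 2)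
          have e1 := hB.equation s₁ s₂ φ hφ t
          have e2 := hC.equation s₁ s₂ φ hφ t
          rw [← createLeft_congr_of_lt (hlt t), ← createRight_congr_of_lt (hlt t)] at e2
          have e := e1.sub e2
          have i1 := ((hint _ _ c1 (cB t s₁ s₂)).add
            (hint _ _ c2 (continuousOn_createLeft (cB t) s₁ s₂))).add
            (hint _ _ c3 (continuousOn_createRight (cB t) s₁ s₂))
          have i2 := ((hint _ _ c1 (cC t s₁ s₂)).add
            (hint _ _ c2 (continuousOn_createLeft (cB t) s₁ s₂))).add
            (hint _ _ c3 (continuousOn_createRight (cB t) s₁ s₂))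
          have e3 := integral_sub i1 i2
          simp only [Pi.add_apply] at e3
          rw [← e3] at e
          convert! e using 1
          · funext τ
            rw [Pi.sub_apply, ← integral_sub (hint _ _ hφ.ccOn (cB τ s₁ s₂))
              (hint _ _ hφ.ccOn (cC τ s₁ s₂))]
            exact integral_congr_ae (Eventually.of_forall fun x => sub_mul _ _ _)
          · refine integral_congr_ae (Eventually.of_forall fun x => ?_)
            simp only
            ring
      funext x
      by_cases hx : x ∈ Allowed σ (-(s₁ : ℤ)) s₂
      · exact sub_eq_zero.1 (hw.eq_zero hΦ (fun y => by rw [hB.initial, hC.initial, sub_self]) t hx)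
      · rw [((hB.mem t).1 s₁ s₂).2.1 x hx, ((hC.mem t).1 s₁ s₂).2.1 x hx]
  funext t s₁ s₂
  exact key _ s₁ s₂ rfl t

end Uniqueness

end TopologicalParticles

end

theorem theorem3 (Φ : ℝ → ℝ) (σ R : ℝ) (hΦ : TopologicalParticles.IsPairPotential Φ σ R) :
    (∀ B₀ : TopologicalParticles.DoubleSeq, TopologicalParticles.MemCZero σ B₀ →
      TopologicalParticles.IsClassicalSolution Φ σ B₀
        (TopologicalParticles.expansion Φ σ B₀) ∧
      ∀ B : ℝ → TopologicalParticles.DoubleSeq,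
        TopologicalParticles.IsClassicalSolution Φ σ B₀ B →
          B = TopologicalParticles.expansion Φ σ B₀) ∧
    (∀ γ : ℝ, 0 < γ → γ < 1 →
      ∀ B₀ : TopologicalParticles.DoubleSeq, TopologicalParticles.MemCGamma σ γ B₀ →
        TopologicalParticles.IsGeneralizedSolution Φ σ γ B₀
          (TopologicalParticles.expansion Φ σ B₀) ∧
        ∀ B : ℝ → TopologicalParticles.DoubleSeq,
          TopologicalParticles.IsGeneralizedSolution Φ σ γ B₀ B →
            B = TopologicalParticles.expansion Φ σ B₀) := by
  refine ⟨fun B₀ hB => ?_, fun γ hγ hγ1 B₀ hB => ?_⟩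
  · have hsol := hΦ.isClassicalSolution_expansion
      (fun s₁ s₂ => (hB.1 s₁ s₂).2.2.of_le (by exact_mod_cast le_top))
      fun s₁ s₂ => (hB.1 s₁ s₂).1.2.1
    exact ⟨hsol, fun B h => hΦ.classicalSolution_unique h hsol⟩
  · have hsol := hΦ.isGeneralizedSolution_expansion hγ hγ1 hB
    exact ⟨hsol, fun B h => hΦ.generalizedSolution_unique hγ h hsol⟩
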